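/- Let $R$ be a principal ideal domain, let $m\ge 2$, and let $x_1,\dots,x_m$ be $m$ distinct points of the two-sphere $S^2$ (so $S^2$ is stratified into these $m$ points and their complement). Work in the category of sheaves of $R$-modules on $S^2$. Let $\mathcal W_i$ be the skyscraper sheaf with stalk $R$ at $x_i$, let $\underline{R}$ be the constant sheaf with stalk $R$ on $S^2$, and consider the complex of sheaves $$\mathcal L=\mathcal W_1\oplus\dots\oplus\mathcal W_m\oplus\underline{R}[1],$$ with the skyscrapers placed in degree $0$ and $\underline R[1]$ in degree $-1$. Let $I$ be any injective resolution of $\mathcal L$, i.e. a bounded below complex of injective sheaves of $R$-modules together with a quasi-isomorphism $\mathcal L\to I$. Then the dg algebra $\operatorname{End} I$ over $R$, given by $(\operatorname{End} I)^n=\prod_{p\in\mathbb Z}\operatorname{Hom}(I^p,I^{p+n})$ with composition as product and differential $a\mapsto d\circ a-(-1)^{n}a\circ d$ for $a$ of degree $n$, is formal. Here a dg algebra $\mathcal A$ over $R$ is called formal if there is a finite chain of dg algebras $\mathcal A=\mathcal A_1,\mathcal A_2,\dots,\mathcal A_k=H\mathcal A$ over $R$, where $H\mathcal A$ is the cohomology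 algebra of $\mathcal A$ with zero differential, such that $\mathcal A_i$ and $\mathcal A_{i+1}$ are quasi-equivalent for every $i$; and dg algebras $\mathcal A$, $\mathcal B$ are called quasi-equivalent if there are a dg $\mathcal A$-$\mathcal B$-bimodule $M$ and a cocycle $c\in M$ of degree zero such that the maps $\mathcal A\to M$, $a\mapsto a\cdot c$, and $\mathcal B\to M$, $b\mapsto c\cdot b$, both induce isomorphisms on cohomology. -/

import Mathlib

open CategoryTheory CategoryTheory.Limits TopologicalSpace

universe u v w

/-! ### Differential graded modules, algebras and bimodules over a commutative ring -/

/-- A dg module over `R`, that is, a `ℤ`-graded cochain complex of `R`-modules.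
The index `h : i + 1 = j` of the differential only serves to avoid casts between degrees. -/
structure DGModule (R : Type u) [CommRing R] where
  X : ℤ → Type v
  [addCommGroup : ∀ n, AddCommGroup (X n)]
  [module : ∀ n, Module R (X n)]
  d : ∀ i j : ℤ, i + 1 = j → (X i →ₗ[R] X j)
  d_d : ∀ (i j k : ℤ) (hij : i + 1 = j) (hjk : j + 1 = k) (x : X i),
    d j k hjk (d i j hij x) = 0

attribute [instance] DGModule.addCommGroup DGModule.module

namespace DGModule

variable {R : Type u} [CommRing R]

/-- The cocycles of degree `n`. -/
def cocycles (M : DGModule.{u, v} R) (n : ℤ) : Submodule R (M.X n) :=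
  LinearMap.ker (M.d n (n + 1) rfl)

/-- The coboundaries of degree `n`. -/
def coboundaries (M : DGModule.{u, v} R) (n : ℤ) : Submodule R (M.X n) :=
  LinearMap.range (M.d (n - 1) n (sub_add_cancel n 1))

/-- The cohomology module of degree `n`: cocycles modulo coboundaries. -/
abbrev H (M : DGModule.{u, v} R) (n : ℤ) : Type v :=
  M.cocycles n ⧸ (M.coboundaries n).submoduleOf (M.cocycles n)

lemma mem_cocycles {M : DGModule.{u, v} R} {i j : ℤ} (h : i + 1 = j) {x : M.X i} :
    x ∈ M.cocycles i ↔ M.d i j h x = 0 := by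
  subst h; exact LinearMap.mem_ker

lemma mem_coboundaries {M : DGModule.{u, v} R} {i j : ℤ} (h : i + 1 = j) {x : M.X j} :
    x ∈ M.coboundaries j ↔ ∃ y, M.d i j h y = x := by
  obtain rfl : i = j - 1 := by lia
  exact LinearMap.mem_range

/-- A morphism of dg modules over `R` (of degree zero). -/
structure Hom (M : DGModule.{u, v} R) (N : DGModule.{u, w} R) where
  f : ∀ n : ℤ, M.X n →ₗ[R] N.X n
  comm : ∀ (i j : ℤ) (h : i + 1 = j) (x : M.X i), f j (M.d i j h x) = N.d i j h (f i x)

namespace Hom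

variable {M : DGModule.{u, v} R} {N : DGModule.{u, w} R}

/-- The map induced on cocycles. -/
def mapCocycles (φ : Hom M N) (n : ℤ) : M.cocycles n →ₗ[R] N.cocycles n :=
  (φ.f n).restrict fun x hx => by
    rw [mem_cocycles rfl] at hx ⊢
    rw [← φ.comm, hx, map_zero]

/-- The map induced on cohomology. -/
def mapH (φ : Hom M N) (n : ℤ) : M.H n →ₗ[R] N.H n :=
  Submodule.mapQ _ _ (φ.mapCocycles n) <| by
    rintro ⟨x, hx⟩ hx'
    obtain ⟨y, rfl⟩ := (mem_coboundaries (sub_add_cancel n 1)).1 hx'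
    exact (mem_coboundaries (sub_add_cancel n 1)).2 ⟨φ.f _ y, (φ.comm _ _ _ y).symm⟩

/-- Quasi-isomorphisms: morphisms inducing isomorphisms on cohomology. -/
def IsQuasiIso (φ : Hom M N) : Prop :=
  ∀ n : ℤ, Function.Bijective (φ.mapH n)

end Hom

end DGModule

/-- A dg algebra over `R` (associative, unital, `ℤ`-graded, not necessarily graded commutative,
with a differential of degree `1` satisfying the graded Leibniz rule). -/
structure DGAlgebra (R : Type u) [CommRing R] extends DGModule.{u, v} R where
  one : X 0
  mul : ∀ {i j k : ℤ}, i + j = k → (X i →ₗ[R] X j →ₗ[R] X k)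
  one_mul : ∀ {n : ℤ} (a : X n), mul (zero_add n) one a = a
  mul_one : ∀ {n : ℤ} (a : X n), mul (add_zero n) a one = a
  mul_assoc : ∀ {i j k ij jk ijk : ℤ} (hij : i + j = ij) (hjk : j + k = jk)
    (h : ij + k = ijk) (h' : i + jk = ijk) (a : X i) (b : X j) (c : X k),
    mul h (mul hij a b) c = mul h' a (mul hjk b c)
  d_mul : ∀ {i j k i' j' k' : ℤ} (h : i + j = k) (hi : i + 1 = i') (hj : j + 1 = j')
    (hk : k + 1 = k') (h₁ : i' + j = k') (h₂ : i + j' = k') (a : X i) (b : X j),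
    d k k' hk (mul h a b) =
      mul h₁ (d i i' hi a) b + i.negOnePow • mul h₂ a (d j j' hj b)

namespace DGAlgebra

variable {R : Type u} [CommRing R] (A : DGAlgebra.{u, v} R)

lemma d_one : A.d 0 1 (zero_add 1) A.one = 0 := by
  have h := A.d_mul (zero_add 0) (zero_add 1) (zero_add 1) (zero_add 1) (add_zero 1)
    (zero_add 1) A.one A.one
  rw [A.one_mul, A.mul_one, A.one_mul, Int.negOnePow_zero, one_smul] at h
  simpa using h

lemma mul_mem_cocycles {i j k : ℤ} (h : i + j = k) {a : A.X i} {b : A.X j}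
    (ha : a ∈ A.cocycles i) (hb : b ∈ A.cocycles j) : A.mul h a b ∈ A.cocycles k := by
  rw [DGModule.mem_cocycles rfl] at ha hb ⊢
  rw [A.d_mul h rfl rfl rfl (by lia) (by lia), ha, hb]
  simp

lemma mul_mem_coboundaries_left {i j k : ℤ} (h : i + j = k) {a : A.X i} {b : A.X j}
    (ha : a ∈ A.coboundaries i) (hb : b ∈ A.cocycles j) : A.mul h a b ∈ A.coboundaries k := by
  obtain ⟨y, rfl⟩ := (DGModule.mem_coboundaries (sub_add_cancel i 1)).1 ha
  rw [DGModule.mem_cocycles rfl] at hb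
  refine (DGModule.mem_coboundaries (sub_add_cancel k 1)).2 ⟨A.mul (by lia) y b, ?_⟩
  rw [A.d_mul (i' := i) _ (by lia) rfl _ h (by lia), hb]
  simp

lemma mul_mem_coboundaries_right {i j k : ℤ} (h : i + j = k) {a : A.X i} {b : A.X j}
    (ha : a ∈ A.cocycles i) (hb : b ∈ A.coboundaries j) : A.mul h a b ∈ A.coboundaries k := by
  obtain ⟨y, rfl⟩ := (DGModule.mem_coboundaries (sub_add_cancel j 1)).1 hb
  rw [DGModule.mem_cocycles rfl] at ha
  refine (DGModule.mem_coboundaries (sub_add_cancel k 1)).2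
    ⟨i.negOnePow • A.mul (by lia) a y, ?_⟩
  rw [Units.smul_def, map_zsmul, ← Units.smul_def,
    A.d_mul (j' := j) _ rfl (by lia) _ (by lia) h, ha, map_zero, LinearMap.zero_apply,
    zero_add, smul_smul, Int.units_mul_self, one_smul]

/-- The product of cocycles. -/
def mulCocycles {i j k : ℤ} (h : i + j = k) :
    A.cocycles i →ₗ[R] A.cocycles j →ₗ[R] A.cocycles k :=
  LinearMap.mk₂ R (fun a b => ⟨A.mul h a.1 b.1, A.mul_mem_cocycles h a.2 b.2⟩)
    (fun a a' b => by ext; simp) (fun r a b => by ext; simp)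
    (fun a b b' => by ext; simp) (fun r a b => by ext; simp)

/-- The product of cohomology classes, `[a] * [b] = [a * b]`. -/
def mulH {i j k : ℤ} (h : i + j = k) : A.H i →ₗ[R] A.H j →ₗ[R] A.H k :=
  Submodule.liftQ _
    { toFun := fun a => Submodule.mapQ _ _ (A.mulCocycles h a)
        (fun b hb => A.mul_mem_coboundaries_right h a.2 hb)
      map_add' := fun a a' => by ext b; simp; rfl
      map_smul' := fun r a => by ext b; simp; rfl }
    (fun a ha => by
      rw [LinearMap.mem_ker]
      ext b
      exact (Submodule.Quotient.mk_eq_zero _).2 (A.mul_mem_coboundaries_left h ha b.2))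

/-- The cohomology algebra `HA` of a dg algebra `A`, as a dg algebra with zero differential. -/
def cohomology : DGAlgebra.{u, v} R where
  X := A.H
  d _ _ _ := 0
  d_d _ _ _ _ _ _ := rfl
  one := Submodule.Quotient.mk ⟨A.one, (DGModule.mem_cocycles (zero_add 1)).2 A.d_one⟩
  mul h := A.mulH h
  one_mul a := by
    obtain ⟨a, rfl⟩ := Submodule.Quotient.mk_surjective _ a
    exact congrArg Submodule.Quotient.mk (Subtype.ext (A.one_mul a.1))
  mul_one a := by
    obtain ⟨a, rfl⟩ := Submodule.Quotient.mk_surjective _ a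
    exact congrArg Submodule.Quotient.mk (Subtype.ext (A.mul_one a.1))
  mul_assoc hij hjk h h' a b c := by
    obtain ⟨a, rfl⟩ := Submodule.Quotient.mk_surjective _ a
    obtain ⟨b, rfl⟩ := Submodule.Quotient.mk_surjective _ b
    obtain ⟨c, rfl⟩ := Submodule.Quotient.mk_surjective _ c
    exact congrArg Submodule.Quotient.mk (Subtype.ext (A.mul_assoc hij hjk h h' a.1 b.1 c.1))
  d_mul := by intros; simp

end DGAlgebra

/-- A dg bimodule, with `A` acting from the left and `B` from the right; the two actions are
`R`-bilinear, unital, associative, commute with each other and satisfy the graded Leibniz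
rules. -/
structure DGBimodule {R : Type u} [CommRing R] (A B : DGAlgebra.{u, v} R)
    extends DGModule.{u, v} R where
  lact : ∀ {i j k : ℤ}, i + j = k → (A.X i →ₗ[R] X j →ₗ[R] X k)
  ract : ∀ {i j k : ℤ}, i + j = k → (X i →ₗ[R] B.X j →ₗ[R] X k)
  one_lact : ∀ {n : ℤ} (m : X n), lact (zero_add n) A.one m = m
  ract_one : ∀ {n : ℤ} (m : X n), ract (add_zero n) m B.one = m
  mul_lact : ∀ {i j k ij jk ijk : ℤ} (hij : i + j = ij) (hjk : j + k = jk)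
    (h : ij + k = ijk) (h' : i + jk = ijk) (a a' : _) (m : X k),
    lact h (A.mul hij a a') m = lact h' a (lact hjk a' m)
  ract_mul : ∀ {i j k ij jk ijk : ℤ} (hij : i + j = ij) (hjk : j + k = jk)
    (h : ij + k = ijk) (h' : i + jk = ijk) (m : X i) (b b' : _),
    ract h (ract hij m b) b' = ract h' m (B.mul hjk b b')
  lact_ract : ∀ {i j k ij jk ijk : ℤ} (hij : i + j = ij) (hjk : j + k = jk)
    (h : ij + k = ijk) (h' : i + jk = ijk) (a : A.X i) (m : X j) (b : B.X k),
    ract h (lact hij a m) b = lact h' a (ract hjk m b)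
  d_lact : ∀ {i j k i' j' k' : ℤ} (h : i + j = k) (hi : i + 1 = i') (hj : j + 1 = j')
    (hk : k + 1 = k') (h₁ : i' + j = k') (h₂ : i + j' = k') (a : A.X i) (m : X j),
    d k k' hk (lact h a m) =
      lact h₁ (A.d i i' hi a) m + i.negOnePow • lact h₂ a (d j j' hj m)
  d_ract : ∀ {i j k i' j' k' : ℤ} (h : i + j = k) (hi : i + 1 = i') (hj : j + 1 = j')
    (hk : k + 1 = k') (h₁ : i' + j = k') (h₂ : i + j' = k') (m : X i) (b : B.X j),
    d k k' hk (ract h m b) =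
      ract h₁ (d i i' hi m) b + i.negOnePow • ract h₂ m (B.d j j' hj b)

namespace DGBimodule

variable {R : Type u} [CommRing R] {A B : DGAlgebra.{u, v} R} (M : DGBimodule A B)

/-- For a cocycle `c` of degree zero, the morphism `A ⟶ M`, `a ↦ a • c`. -/
def leftMap (c : M.X 0) (hc : M.d 0 1 (zero_add 1) c = 0) :
    DGModule.Hom A.toDGModule M.toDGModule where
  f n := (M.lact (add_zero n)).flip c
  comm i j h a := by
    simp only [LinearMap.flip_apply]
    rw [M.d_lact (add_zero i) h (zero_add 1) h (add_zero j) h, hc]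
    simp

/-- For a cocycle `c` of degree zero, the morphism `B ⟶ M`, `b ↦ c • b`. -/
def rightMap (c : M.X 0) (hc : M.d 0 1 (zero_add 1) c = 0) :
    DGModule.Hom B.toDGModule M.toDGModule where
  f n := M.ract (zero_add n) c
  comm i j h b := by
    rw [M.d_ract (zero_add i) (zero_add 1) h h (by lia) (zero_add j), hc]
    simp

end DGBimodule

namespace DGAlgebra

variable {R : Type u} [CommRing R]

/-- Two dg algebras `A` and `B` are quasi-equivalent if there are a dg `A`-`B`-bimodule `M` and
a cocycle `c` of degree zero in `M` such that `a ↦ a • c` and `b ↦ c • b` induce isomorphisms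
on cohomology. -/
def QuasiEquivalent (A B : DGAlgebra.{u, v} R) : Prop :=
  ∃ (M : DGBimodule A B) (c : M.X 0) (hc : M.d 0 1 (zero_add 1) c = 0),
    (M.leftMap c hc).IsQuasiIso ∧ (M.rightMap c hc).IsQuasiIso

/-- A dg algebra is formal if it is connected to its cohomology algebra by a finite chain of
dg algebras in which consecutive members are quasi-equivalent. -/
def IsFormal (A : DGAlgebra.{u, v} R) : Prop :=
  Relation.ReflTransGen QuasiEquivalent A A.cohomology

end DGAlgebra

/-! ### The endomorphism dg algebra of a complex -/

open CochainComplex.HomComplex in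
/-- The endomorphism dg algebra of a cochain complex `K` in an `R`-linear category: in degree `n`
it consists of all families of morphisms `K.X p ⟶ K.X (p + n)`; the product `a * b` is the
composition `a ∘ b` (first `b`, then `a`) and the differential is
`a ↦ d ∘ a - (-1) ^ n • a ∘ d`. -/
def endDGAlgebra (R : Type u) [CommRing R] {C : Type w} [Category.{v} C] [Preadditive C]
    [Linear R C] (K : CochainComplex C ℤ) : DGAlgebra.{u, v} R where
  X n := Cochain K K n
  d i j _ := δ_hom R K K i j
  d_d i j k _ _ x := δ_δ i j k x
  one := Cochain.ofHom (𝟙 K)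
  mul {i j k} h := LinearMap.mk₂ R (fun a b => b.comp a (by lia))
    (fun a a' b => by simp) (fun r a b => by simp)
    (fun a b b' => by simp) (fun r a b => by simp)
  one_mul a := Cochain.comp_id a
  mul_one a := Cochain.id_comp a
  mul_assoc hij hjk h h' a b c :=
    (Cochain.comp_assoc c b a (by lia) (by lia) (by lia)).symm
  d_mul {i j k i' j' k'} h hi hj hk h₁ h₂ a b :=
    δ_comp b a (show j + i = k by lia) j' i' k' hk hj hi

/-! ### Injective resolutions -/

/-- An injective resolution of a complex `L` in an abelian category: a quasi-isomorphism from `L`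
to a complex of injective objects that is bounded below. -/
structure IsInjectiveResolution {C : Type w} [Category.{v} C] [Abelian C]
    {L I : CochainComplex C ℤ} (φ : L ⟶ I) : Prop where
  quasiIso : QuasiIso φ
  injective : ∀ n : ℤ, Injective (I.X n)
  boundedBelow : ∃ n : ℤ, I.IsStrictlyGE n

/-! ### Sheaves on the two-sphere -/

/-- The two-sphere: the unit sphere in Euclidean three-space, lifted to the universe of the base
ring. -/
abbrev TwoSphere : TopCat.{u} :=
  TopCat.of (ULift.{u} (Metric.sphere (0 : EuclideanSpace ℝ (Fin 3)) 1))

/-- The category of sheaves of `R`-modules on a topological space. -/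
abbrev ModSheaf (R : Type u) [CommRing R] (X : TopCat.{u}) :=
  TopCat.Sheaf (ModuleCat.{u} R) X

/-- Morphisms of sheaves of `R`-modules form `R`-modules, with the sectionwise operations. -/
noncomputable instance modSheafLinear (R : Type u) [CommRing R] (X : TopCat.{u}) :
    Linear R (ModSheaf R X) :=
  inferInstanceAs <|
    Linear R (CategoryTheory.Sheaf (Opens.grothendieckTopology X) (ModuleCat.{u} R))

instance modSheafHasFiniteBiproducts (R : Type u) [CommRing R] (X : TopCat.{u}) :
    HasFiniteBiproducts (ModSheaf R X) :=
  Abelian.hasFiniteBiproducts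

open Classical in
/-- The skyscraper sheaf with stalk `R` at the point `x`. -/
noncomputable def skyscraper (R : Type u) [CommRing R] {X : TopCat.{u}} (x : X) :
    ModSheaf R X :=
  skyscraperSheaf x (ModuleCat.of R R)

/-- The constant sheaf with stalk `R`. -/
noncomputable def constSheaf (R : Type u) [CommRing R] (X : TopCat.{u}) : ModSheaf R X :=
  (constantSheaf (Opens.grothendieckTopology X) (ModuleCat.{u} R)).obj (ModuleCat.of R R)

/-- The complex `W₁ ⊕ ⋯ ⊕ Wₘ ⊕ R_X[1]`, where `Wᵢ` is the skyscraper at the point `x i`, in degree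
zero, and `R_X[1]` is the constant sheaf shifted by one (so it sits in degree `-1`). -/
noncomputable def skyscrapersPlusShiftedConst (R : Type u) [CommRing R] {X : TopCat.{u}} {m : ℕ}
    (x : Fin m → X) : CochainComplex (ModSheaf R X) ℤ :=
  (CochainComplex.singleFunctor (ModSheaf R X) 0).obj (⨁ fun i => skyscraper R (x i)) ⊞
    ((CochainComplex.singleFunctor (ModSheaf R X) 0).obj (constSheaf R X))⟦(1 : ℤ)⟧

-- Write O for the constant sheaf and W_i for the skyscrapers. On the sphere the groups Ext between
-- them are as small as possible: O to O is free of rank one in degrees 0 and 2, O to W_i in degree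
-- 0, W_i to O in degree 2, W_i to itself in degree 0, and everything else vanishes. Evaluation α_i
-- : O → W_i followed by a suitable generator β_i : W_i → O[2] is a generator ω of H²(S²), the same
-- for all i; the remaining products of these generators lie in zero groups. Formality follows once
-- these relations hold on the nose, and not only up to homotopy, for cocycles between suitable
-- complexes.
--
-- Suppose complexes P_0 ≃ O and P_i ≃ W_i carry such cocycles (`StarCocycles`). With S = ⊕ P_i ⊕
-- P_0[1], the matrices whose entries are combinations of the identities and the α_i, β_i, ω form a
-- dg algebra B with zero differential (`StrictFamily.matrixDGAlgebra`) that maps isomorphically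
-- onto the endomorphisms of S of all degrees in the derived category. The complex Hom(S, I) is an
-- (End I)-B-bimodule, and a cocycle representing S ≃ I makes End I and B quasi-equivalent
-- (`StrictFamily.IsModel.isFormal`): one side because I is K-injective, the other because B
-- computes the derived endomorphisms. The P's themselves need not be injective. A dg algebra
-- quasi-equivalent to one with zero differential is formal (`DGAlgebra.QuasiEquivalent.isFormal`).
--
-- The strict relations come from geometry. In a plane chart omitting one further point, the x_i can
-- be moved onto the horizontal axis (`exists_hemisphere`). Let D be the open lower half-plane, R_D
-- the extension by zero of the constant sheaf on D, and Z = O/R_D, so that every evaluation O → W_i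
-- factors through Z, with kernel K_i of Z → W_i. A generator of H²(S²) can be concentrated at a
-- point of D, hence factors as O → Z → R_D[2] → O[2] for some class ζ (`Hemisphere.exists_isGen`).
-- Since Ext²(K_i, R_D) = 0 (`Hemisphere.subsingleton_ext_kerEval`), ζ extends from Z to every W_i.
-- Now let J be an injective resolution of R_D, P_0 the pushout of O and J over R_D, and P_i the
-- cone of K_i → Z. All α_i begin with t : P_0 → Z, all β_i end with s : J → P_0, and t∘s = 0
-- exactly. So every product that should vanish does, while β_i∘α_i is always the same cocycle
-- through a representative of ζ (`exists_starCocycles`).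
--
-- The Ext groups are computed by hand. The sheaf `FU R U` represents sections over U, so Ext out of
-- it is cohomology of U. Open rectangles in a chart are acyclic for the constant sheaf
-- (`isLifting_isBox`), and Mayer–Vietoris yields the punctured plane (`punctured_chart`) and the
-- sphere (`ext_const_const`).

universe w' w''

/-! ### Sections of sheaves of modules: gluing and local criteria. -/

namespace ModSheaf
open Opposite
variable {R : Type u} [CommRing R] {X : TopCat.{u}}

/-- The module of sections of a sheaf of modules over an open subset. -/
abbrev Sec (F : ModSheaf R X) (U : Opens X) : Type u := F.obj.obj (op U)

/-- Restriction of sections. -/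
noncomputable def res (F : ModSheaf R X) {V U : Opens X} (h : V ≤ U) : Sec F U →ₗ[R] Sec F V :=
  (F.obj.map (homOfLE h).op).hom

/-- The action of a morphism of sheaves on sections. -/
noncomputable def app {F G : ModSheaf R X} (φ : F ⟶ G) (U : Opens X) : Sec F U →ₗ[R] Sec G U :=
  (φ.hom.app (op U)).hom

variable {F G H : ModSheaf R X}

@[simp] lemma res_refl {U : Opens X} (h : U ≤ U) (s : Sec F U) : res F h s = s := by
  have : (homOfLE h).op = 𝟙 (op U) := Subsingleton.elim _ _
  simp [res]

@[simp] lemma res_res {W V U : Opens X} (h : W ≤ V) (h' : V ≤ U) (s : Sec F U) :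
    res F h (res F h' s) = res F (h.trans h') s := by
  have : (homOfLE (h.trans h')).op = (homOfLE h').op ≫ (homOfLE h).op := rfl
  simp [res, this]

lemma app_res (φ : F ⟶ G) {V U : Opens X} (h : V ≤ U) (s : Sec F U) :
    app φ V (res F h s) = res G h (app φ U s) :=
  congr($(φ.hom.naturality (homOfLE h).op).hom s)

@[simp] lemma app_comp (φ : F ⟶ G) (ψ : G ⟶ H) (U : Opens X) (s : Sec F U) :
    app (φ ≫ ψ) U s = app ψ U (app φ U s) := rfl

@[simp] lemma app_id (U : Opens X) (s : Sec F U) : app (𝟙 F) U s = s := rfl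

@[simp] lemma app_add (φ ψ : F ⟶ G) (U : Opens X) (s : Sec F U) :
    app (φ + ψ) U s = app φ U s + app ψ U s := rfl

@[simp] lemma app_neg (φ : F ⟶ G) (U : Opens X) (s : Sec F U) :
    app (-φ) U s = - app φ U s := rfl

@[simp] lemma app_zero (U : Opens X) (s : Sec F U) : app (0 : F ⟶ G) U s = 0 := rfl

@[simp] lemma app_smul (r : R) (φ : F ⟶ G) (U : Opens X) (s : Sec F U) :
    app (r • φ) U s = r • app φ U s := rfl

lemma hom_ext_sec {φ ψ : F ⟶ G} (h : ∀ U (s : Sec F U), app φ U s = app ψ U s) : φ = ψ := by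
  apply ObjectProperty.hom_ext
  ext U s
  exact h _ s

lemma sec_ext {V : Opens X} {s t : Sec F V}
    (h : ∀ y ∈ V, ∃ (N : Opens X) (hN : N ≤ V), y ∈ N ∧ res F hN s = res F hN t) : s = t := by
  choose N hN hy he using h
  refine TopCat.Sheaf.eq_of_locally_eq' F (fun y : V => N y.1 y.2) V
    (fun y => homOfLE (hN y.1 y.2)) (fun y hyV => ?_) s t (fun y => he y.1 y.2)
  exact Opens.mem_iSup.2 ⟨⟨y, hyV⟩, hy y hyV⟩

lemma exists_glue {ι : Type*} (U : ι → Opens X) (V : Opens X) (hU : ∀ i, U i ≤ V)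
    (hV : ∀ y ∈ V, ∃ i, y ∈ U i) (s : ∀ i, Sec F (U i))
    (hs : ∀ i j, res F (inf_le_left : U i ⊓ U j ≤ U i) (s i) = res F inf_le_right (s j)) :
    ∃ t : Sec F V, ∀ i, res F (hU i) t = s i := by
  obtain ⟨t, ht, -⟩ := TopCat.Sheaf.existsUnique_gluing' F U V (fun i => homOfLE (hU i))
    (fun y hy => Opens.mem_iSup.2 (hV y hy)) s hs
  exact ⟨t, ht⟩

/-- If a local property pins down a section, local solutions agree on overlaps automatically, so
local existence suffices for a global section that satisfies the property locally. -/
lemma exists_glue_of_local {V : Opens X} (Q : ∀ N : Opens X, Sec F N → Prop)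
    (hres : ∀ (N N' : Opens X) (h : N' ≤ N) (s : Sec F N), Q N s → Q N' (res F h s))
    (huniq : ∀ (N : Opens X) (s t : Sec F N), N ≤ V → Q N s → Q N t → s = t)
    (hloc : ∀ y ∈ V, ∃ N ≤ V, y ∈ N ∧ ∃ s : Sec F N, Q N s) :
    ∃ t : Sec F V, ∀ y ∈ V, ∃ (N : Opens X) (hN : N ≤ V), y ∈ N ∧ Q N (res F hN t) := by
  choose N hN hy s hs using hloc
  obtain ⟨t, ht⟩ := exists_glue (F := F) (fun y : V => N y.1 y.2) V (fun y => hN y.1 y.2)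
    (fun y h => ⟨⟨y, h⟩, hy y h⟩) (fun y => s y.1 y.2)
    (fun i j => huniq _ _ _ (inf_le_left.trans (hN i.1 i.2)) (hres _ _ _ _ (hs i.1 i.2))
      (hres _ _ _ _ (hs j.1 j.2)))
  exact ⟨t, fun y h => ⟨N y h, hN y h, hy y h, by rw [ht ⟨y, h⟩]; exact hs y h⟩⟩

lemma epi_iff_locally (g : F ⟶ G) : Epi g ↔ ∀ (V : Opens X) (s : Sec G V), ∀ y ∈ V,
    ∃ (N : Opens X) (hN : N ≤ V), y ∈ N ∧ ∃ t : Sec F N, app g N t = res G hN s := by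
  rw [← TopCat.Sheaf.isLocallySurjective_iff_epi]
  rw [TopCat.Presheaf.isLocallySurjective_iff]
  constructor
  · intro h V s y hy
    obtain ⟨N, hN, ⟨t, ht⟩, hyN⟩ := h V s y hy
    exact ⟨N, hN, hyN, t, ht⟩
  · intro h V s y hy
    obtain ⟨N, hN, hyN, t, ht⟩ := h V s y hy
    exact ⟨N, hN, ⟨t, ht⟩, hyN⟩


/-! ### Sheaves representing sections over an open subset. -/

/-- The sheaf freely generated by a section over `U`. -/
noncomputable def FU (R : Type u) [CommRing R] {X : TopCat.{u}} (U : Opens X) : ModSheaf R X :=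
  (presheafToSheaf (Opens.grothendieckTopology X) (ModuleCat.{u} R)).obj
    (yoneda.obj U ⋙ ModuleCat.free R)

/-- The canonical map from the presheaf freely generated by a section over `U`. -/
noncomputable def toFU (R : Type u) [CommRing R] {X : TopCat.{u}} (U : Opens X) :
    yoneda.obj U ⋙ ModuleCat.free R ⟶ (FU R U).obj :=
  toSheafify (Opens.grothendieckTopology X) _

/-- The universal section of `FU R U`. -/
noncomputable def gen (R : Type u) [CommRing R] {X : TopCat.{u}} (U : Opens X) : Sec (FU R U) U :=
  ((toFU R U).app (op U)).hom (ModuleCat.freeMk (R := R) (𝟙 U))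

lemma toFU_freeMk {U V : Opens X} (h : V ≤ U) :
    ((toFU R U).app (op V)).hom (ModuleCat.freeMk (R := R) (homOfLE h)) =
      res (FU R U) h (gen R U) := by
  have := congr($((toFU R U).naturality (homOfLE h).op).hom (ModuleCat.freeMk (R := R) (𝟙 U)))
  refine Eq.trans ?_ this
  change _ = ((toFU R U).app (op V)).hom (((ModuleCat.free R).map _).hom _)
  congr 1
  erw [ModuleCat.free_map_apply]
  rfl

/-- The section of `F` over `U` determined by a morphism from `FU R U`. -/
noncomputable def toSec (U : Opens X) (F : ModSheaf R X) : (FU R U ⟶ F) →ₗ[R] Sec F U where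
  toFun φ := app φ U (gen R U)
  map_add' _ _ := rfl
  map_smul' _ _ := rfl

lemma toSec_apply {U : Opens X} (φ : FU R U ⟶ F) : toSec U F φ = app φ U (gen R U) := rfl

/-- With `toSec_surjective` this is the Yoneda lemma after sheafification. `FU R U` is thereby the
extension by zero of the constant sheaf on `U`, and Ext groups out of it are sheaf cohomology over
`U`. -/
lemma toSec_injective (U : Opens X) (F : ModSheaf R X) : Function.Injective (toSec U F) := by
  intro φ ψ h
  apply ObjectProperty.hom_ext
  refine sheafify_hom_ext (Opens.grothendieckTopology X) _ _ F.property ?_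
  ext V : 2
  refine ModuleCat.free_hom_ext ?_
  intro i
  have hV : V.unop ≤ U := leOfHom i
  have hi : i = homOfLE hV := Subsingleton.elim (α := V.unop ⟶ U) _ _
  have h1 := congr(res F hV $h)
  simp only [toSec_apply, ← app_res] at h1
  rw [hi]
  rw [← toFU_freeMk hV] at h1
  exact h1

lemma toSec_surjective (U : Opens X) (F : ModSheaf R X) : Function.Surjective (toSec U F) := by
  intro s
  let η : yoneda.obj U ⋙ ModuleCat.free R ⟶ F.obj :=
    { app V := ModuleCat.freeDesc (TypeCat.ofHom fun i : V.unop ⟶ U => res F (leOfHom i) s)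
      naturality V W k := by
        refine ModuleCat.free_hom_ext ?_
        intro i
        rw [ModuleCat.comp_apply, ModuleCat.comp_apply]
        erw [ModuleCat.free_map_apply, ModuleCat.freeDesc_apply, ModuleCat.freeDesc_apply]
        exact (res_res (leOfHom k.unop) (leOfHom i) s).symm }
  refine ⟨⟨sheafifyLift _ η F.property⟩, ?_⟩
  have := congr($(toSheafify_sheafifyLift (Opens.grothendieckTopology X) η F.property).app (op U))
  have := congr($(this).hom (ModuleCat.freeMk (R := R) (𝟙 U)))
  refine Eq.trans this ?_
  erw [ModuleCat.freeDesc_apply]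
  exact res_refl _ _

lemma mono_iff_injective (f : F ⟶ G) : Mono f ↔ ∀ V, Function.Injective (app f V) := by
  constructor
  · intro h V s t hst
    obtain ⟨φ, rfl⟩ := toSec_surjective V F s
    obtain ⟨ψ, rfl⟩ := toSec_surjective V F t
    congr 1
    rw [← cancel_mono f]
    exact toSec_injective _ _ hst
  · intro h
    exact ⟨fun a b hab => hom_ext_sec fun U s => h U congr(app $hab U s)⟩

/-- The comparison map from `A` to the kernel of `g` is mono because `f` is, and epi by the local
lifting `hfg`; in an abelian category it is then an isomorphism. -/
lemma shortExact_of_sections {A B C : ModSheaf R X} (f : A ⟶ B) (g : B ⟶ C) (w : f ≫ g = 0)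
    (hf : ∀ V, Function.Injective (app f V))
    (hfg : ∀ (V : Opens X) (s : Sec B V), app g V s = 0 → ∀ y ∈ V,
      ∃ (N : Opens X) (hN : N ≤ V), y ∈ N ∧ ∃ t : Sec A N, app f N t = res B hN s)
    (hg : ∀ (V : Opens X) (s : Sec C V), ∀ y ∈ V,
      ∃ (N : Opens X) (hN : N ≤ V), y ∈ N ∧ ∃ t : Sec B N, app g N t = res C hN s) :
    (ShortComplex.mk f g w).ShortExact := by
  have : Mono f := (mono_iff_injective f).2 hf
  have : Epi g := (epi_iff_locally g).2 hg
  refine ⟨ShortComplex.exact_of_f_is_kernel _ ?_⟩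
  have key : Epi (kernel.lift g f w) := by
    rw [epi_iff_locally]
    intro V s y hy
    obtain ⟨N, hN, hyN, t, ht⟩ := hfg V (app (kernel.ι g) V s)
      (by rw [← app_comp, kernel.condition]; rfl) y hy
    refine ⟨N, hN, hyN, t, (mono_iff_injective (kernel.ι g)).1 inferInstance N ?_⟩
    rw [← app_comp, kernel.lift_ι, ht, app_res]
  have : Mono (kernel.lift g f w) := by
    have : Mono (kernel.lift g f w ≫ kernel.ι g) := by rw [kernel.lift_ι]; infer_instance
    exact mono_of_mono _ (kernel.ι g)
  have : IsIso (kernel.lift g f w) := isIso_of_mono_of_epi _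
  exact IsLimit.ofIsoLimit (kernelIsKernel g)
    (Fork.ext (asIso (kernel.lift g f w)).symm (by simp))

/-- A section killed by `S.g` is a morphism from `FU R V` killed by `S.g`, so it factors through the
kernel: left exactness of sections with no sheaf argument. -/
lemma exact_sections {S : ShortComplex (ModSheaf R X)} (hS : S.ShortExact) {V : Opens X}
    {s : Sec S.X₂ V} (hs : app S.g V s = 0) : ∃ t, app S.f V t = s := by
  have := hS.mono_f
  obtain ⟨φ, rfl⟩ := toSec_surjective V _ s
  have h : φ ≫ S.g = 0 := toSec_injective _ _ hs
  exact ⟨toSec _ _ (hS.exact.lift φ h), congr(app $(hS.exact.lift_f φ h) V (gen R V))⟩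

/-- The morphism `FU R U ⟶ F` given by a section of `F` over `U`. -/
noncomputable def ofSec {U : Opens X} (s : Sec F U) : FU R U ⟶ F :=
  (toSec_surjective U F s).choose

@[simp] lemma app_ofSec_gen {U : Opens X} (s : Sec F U) : app (ofSec s) U (gen R U) = s :=
  (toSec_surjective U F s).choose_spec

lemma FU_hom_ext {U : Opens X} {φ ψ : FU R U ⟶ F} (h : app φ U (gen R U) = app ψ U (gen R U)) :
    φ = ψ := toSec_injective U F h

/-- The map `FU R V ⟶ FU R U` for `V ≤ U`. -/
noncomputable def FUmap (R : Type u) [CommRing R] {X : TopCat.{u}} {V U : Opens X} (h : V ≤ U) :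
    FU R V ⟶ FU R U := ofSec (res _ h (gen R U))

@[simp] lemma app_FUmap_gen {V U : Opens X} (h : V ≤ U) :
    app (FUmap R h) V (gen R V) = res _ h (gen R U) := app_ofSec_gen _

lemma app_FUmap_comp {V U : Opens X} (h : V ≤ U) (φ : FU R U ⟶ F) :
    app (FUmap R h ≫ φ) V (gen R V) = res F h (app φ U (gen R U)) := by
  rw [app_comp, app_FUmap_gen, app_res]

lemma FUmap_FUmap {W V U : Opens X} (h : W ≤ V) (h' : V ≤ U) :
    FUmap R h ≫ FUmap R h' = FUmap R (h.trans h') := by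
  apply FU_hom_ext
  rw [app_FUmap_comp, app_FUmap_gen, app_FUmap_gen, res_res]

/-- There is at most one inclusion `V ≤ U`, so the free module on it is `R` or `0`. -/
lemma free_presheaf_cases {U V : Opens X} (s : ((yoneda.obj U ⋙ ModuleCat.free R).obj (op V))) :
    (∃ (h : V ≤ U) (r : R), s = r • ModuleCat.freeMk (R := R) (homOfLE h)) ∨ s = 0 := by
  by_cases h : V ≤ U
  · left
    refine ⟨h, DFunLike.coe (F := (V ⟶ U) →₀ R) s (homOfLE h), ?_⟩
    refine Finsupp.ext (α := V ⟶ U) fun i => ?_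
    obtain rfl : i = homOfLE h := Subsingleton.elim _ _
    change DFunLike.coe (F := (V ⟶ U) →₀ R) s (homOfLE h) =
      DFunLike.coe (F := (V ⟶ U) →₀ R) s (homOfLE h) •
        ((Finsupp.single (homOfLE h) 1 : (V ⟶ U) →₀ R)) (homOfLE h)
    simp
  · right
    refine Finsupp.ext (α := V ⟶ U) fun i => (h (leOfHom i)).elim

/-- Sheafification is locally surjective, so the dichotomy for the free presheaf persists locally.
Exactness statements about `FU` are then checked on constants. -/
lemma FU_local {U V : Opens X} (s : Sec (FU R U) V) (y : X) (hy : y ∈ V) :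
    ∃ (N : Opens X) (hN : N ≤ V), y ∈ N ∧
      ((∃ (h : N ≤ U) (r : R), res _ hN s = r • res _ h (gen R U)) ∨ res _ hN s = 0) := by
  have hls : Presheaf.IsLocallySurjective (Opens.grothendieckTopology X) (toFU R U) :=
    inferInstanceAs (Presheaf.IsLocallySurjective _ (toSheafify _ _))
  obtain ⟨N, hN, ⟨t, ht⟩, hyN⟩ :=
    (TopCat.Presheaf.isLocallySurjective_iff (toFU R U)).1 hls V s y hy
  refine ⟨N, hN, hyN, ?_⟩
  have ht' : ((toFU R U).app (op N)).hom t = res _ hN s := ht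
  obtain ⟨h, r, rfl⟩ | rfl := free_presheaf_cases t
  · left
    refine ⟨h, r, ?_⟩
    rw [← ht', map_smul, toFU_freeMk]
  · right
    rw [← ht', map_zero]

/-- Sheafification is locally injective, so near `y` the relation already holds in the free
presheaf, where the coefficient is visible. The point `y` is needed: over the empty set all sections
vanish. -/
lemma gen_smul_eq_zero {U V : Opens X} (h : V ≤ U) (r : R) (y : X) (hy : y ∈ V)
    (hr : r • res (FU R U) h (gen R U) = 0) : r = 0 := by
  have hli : Presheaf.IsLocallyInjective (Opens.grothendieckTopology X) (toFU R U) :=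
    inferInstanceAs (Presheaf.IsLocallyInjective _ (toSheafify _ _))
  have h0 : ((toFU R U).app (op V)).hom (r • ModuleCat.freeMk (R := R) (homOfLE h)) =
      ((toFU R U).app (op V)).hom 0 := by
    rw [map_smul, toFU_freeMk, hr, map_zero]
  have hS := Presheaf.equalizerSieve_mem (Opens.grothendieckTopology X) (toFU R U) _ _ h0
  obtain ⟨N, i, hi, hyN⟩ := hS y hy
  have h1 : (((yoneda.obj U ⋙ ModuleCat.free R).map i.op).hom
    (r • ModuleCat.freeMk (R := R) (homOfLE h))) = 0 := by
    refine Eq.trans hi ?_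
    exact map_zero _
  rw [map_smul] at h1
  erw [ModuleCat.free_map_apply] at h1
  have h2 := DFunLike.congr_fun (F := (N ⟶ U) →₀ R) h1 (i ≫ homOfLE h)
  change r • (Finsupp.single (i ≫ homOfLE h) (1 : R)) (i ≫ homOfLE h) = 0 at h2
  simpa using h2

/-- The constant sheaf is freely generated by a global section. -/
noncomputable def constSheafIso (R : Type u) [CommRing R] (X : TopCat.{u}) :
    constSheaf R X ≅ FU R (⊤ : Opens X) :=
  (presheafToSheaf (Opens.grothendieckTopology X) (ModuleCat.{u} R)).mapIso
    (NatIso.ofComponents (fun V => LinearEquiv.toModuleIso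
      (LinearEquiv.ofBijective
        (Finsupp.lsingle (homOfLE le_top) : R →ₗ[R] ((V.unop ⟶ (⊤ : Opens X)) →₀ R))
        ⟨Finsupp.single_injective _, fun f => ⟨f (homOfLE le_top), Finsupp.ext fun i => by
          obtain rfl : i = homOfLE le_top := Subsingleton.elim _ _
          simp⟩⟩)) (by
      intro V W k
      ext
      change Finsupp.single _ (1 : R) = ((ModuleCat.free R).map _).hom (ModuleCat.freeMk _)
      erw [ModuleCat.free_map_apply]
      rfl))

end ModSheaf

namespace ModSheaf
open Opposite
variable {R : Type u} [CommRing R] {X : TopCat.{u}}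
variable {F G H : ModSheaf R X}

/-! ### Sections of skyscraper sheaves. -/

section Skyscraper

variable (R) (x : X)

lemma subsingleton_sec_skyscraper {V : Opens X} (hx : x ∉ V) :
    Subsingleton (Sec (skyscraper R x) V) := by
  classical
  have h : IsZero ((skyscraper R x).obj.obj (op V)) :=
    (isZero_zero _).of_iso ((isTerminalSkyscraperSheafObjObjOfNotMem (U := op V) hx).uniqueUpToIso
      (isZero_zero (ModuleCat R)).isTerminal)
  exact ModuleCat.subsingleton_of_isZero h

lemma bijective_res_skyscraper {V U : Opens X} (h : V ≤ U) (hx : x ∈ V) :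
    Function.Bijective (res (skyscraper R x) h) := by
  have : IsIso ((skyscraper R x).obj.map (homOfLE h).op) := by
    have hx' := h hx
    dsimp [skyscraper, skyscraperSheaf, skyscraperPresheaf]
    simp only [hx, ↓reduceDIte]
    infer_instance
  exact ConcreteCategory.bijective_of_isIso ((skyscraper R x).obj.map (homOfLE h).op)

/-- Global sections of the skyscraper sheaf. -/
noncomputable def skyscraperTop : Sec (skyscraper R x) ⊤ ≃ₗ[R] R :=
  (eqToIso (if_pos trivial) : (skyscraper R x).obj.obj (op ⊤) ≅ ModuleCat.of R R).toLinearEquiv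

/-- The generator of the global sections of the skyscraper sheaf. -/
noncomputable def skyGen : Sec (skyscraper R x) ⊤ := (skyscraperTop R x).symm 1

lemma bijective_smul_skyGen {V : Opens X} (hx : x ∈ V) :
    Function.Bijective (fun r : R => r • res (skyscraper R x) (le_top : V ≤ ⊤) (skyGen R x)) := by
  have : (fun r : R => r • res (skyscraper R x) (le_top : V ≤ ⊤) (skyGen R x)) =
      res (skyscraper R x) (le_top : V ≤ ⊤) ∘ (skyscraperTop R x).symm := by
    ext r
    simp only [Function.comp_apply]
    rw [← map_smul, skyGen, ← map_smul, smul_eq_mul, mul_one]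
  rw [this]
  exact (bijective_res_skyscraper R x le_top hx).comp (skyscraperTop R x).symm.bijective

/-- The evaluation map `FU R V ⟶ skyscraper R x`. -/
noncomputable def toSky (V : Opens X) : FU R V ⟶ skyscraper R x :=
  ofSec (res _ le_top (skyGen R x))

@[simp] lemma app_toSky_gen (V : Opens X) :
    app (toSky R x V) V (gen R V) = res _ le_top (skyGen R x) := app_ofSec_gen _

variable {x}

lemma FUmap_toSky {V U : Opens X} (h : V ≤ U) : FUmap R h ≫ toSky R x U = toSky R x V := by
  apply FU_hom_ext
  rw [app_FUmap_comp, app_toSky_gen, app_toSky_gen, res_res]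

lemma hom_skyscraper_eq_zero {V : Opens X} (hx : x ∉ V) (φ : FU R V ⟶ skyscraper R x) : φ = 0 := by
  have := subsingleton_sec_skyscraper R x hx
  exact FU_hom_ext (Subsingleton.elim _ _)

end Skyscraper

/-! ### Short exact sequences: a point, an exterior region, Mayer–Vietoris. -/

lemma app_FUmap_injective {V U : Opens X} (h : V ≤ U) (W : Opens X) :
    Function.Injective (app (FUmap R h) W) := by
  rw [injective_iff_map_eq_zero]
  intro s hs
  apply sec_ext
  intro y hy
  obtain ⟨N, hN, hyN, ⟨hNV, r, hr⟩ | h0⟩ := FU_local s y hy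
  · refine ⟨N, hN, hyN, ?_⟩
    have h1 : app (FUmap R h) N (res _ hN s) = 0 := by rw [app_res, hs, map_zero]
    rw [hr, map_smul, app_res, app_FUmap_gen, res_res] at h1
    rw [hr, gen_smul_eq_zero _ r y hyN h1, zero_smul, map_zero]
  · exact ⟨N, hN, hyN, by rw [h0, map_zero]⟩

instance mono_FUmap {V U : Opens X} (h : V ≤ U) : Mono (FUmap R h) :=
  (mono_iff_injective _).2 (app_FUmap_injective h)

/-- Injective sheaves are flasque: a section over `V` is a map from `FU R V`, which extends along
the mono `FU R V ⟶ FU R U`. -/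
lemma injective_res_surjective (I : ModSheaf R X) [Injective I] {V U : Opens X} (h : V ≤ U) :
    Function.Surjective (res I h) := by
  intro s
  refine ⟨app (Injective.factorThru (ofSec s) (FUmap R h)) U (gen R U), ?_⟩
  rw [← app_FUmap_comp, Injective.comp_factorThru, app_ofSec_gen]

/-- A local section near `x` is a constant that equals its value at `x`, so it is killed only if it
is zero; near other points the first two sheaves agree and the skyscraper vanishes. -/
lemma shortExact_point [T1Space X] {V' V : Opens X} (h : V' ≤ V) {x : X} (hx : x ∈ V)
    (hV' : ∀ y, y ∈ V' ↔ y ∈ V ∧ y ≠ x) :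
    (ShortComplex.mk (FUmap R h) (toSky R x V) (by
      rw [FUmap_toSky]
      exact hom_skyscraper_eq_zero R (fun h' => ((hV' x).1 h').2 rfl) _)).ShortExact := by
  refine shortExact_of_sections _ _ _ (app_FUmap_injective h) ?_ ?_
  · intro W s hs y hy
    obtain ⟨N, hN, hyN, ⟨hNV, r, hr⟩ | h0⟩ := FU_local s y hy
    · refine ⟨N, hN, hyN, ?_⟩
      by_cases hxN : x ∈ N
      · refine ⟨0, ?_⟩
        have h1 : app (toSky R x V) N (res _ hN s) = 0 := by rw [app_res, hs, map_zero]
        rw [hr, map_smul, app_res, app_toSky_gen, res_res] at h1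
        have : r = 0 := (bijective_smul_skyGen R x hxN).1 (h1.trans (zero_smul R _).symm)
        rw [hr, this, zero_smul, map_zero]
      · have hN' : N ≤ V' := fun z hz => (hV' z).2 ⟨hNV hz, fun e => hxN (e ▸ hz)⟩
        refine ⟨r • res _ hN' (gen R V'), ?_⟩
        rw [hr, map_smul, app_res, app_FUmap_gen, res_res]
    · exact ⟨N, hN, hyN, 0, by rw [h0, map_zero]⟩
  · intro W s y hy
    by_cases hyV : y ∈ V
    · refine ⟨W ⊓ V, inf_le_left, ⟨hy, hyV⟩, ?_⟩
      by_cases hxN : x ∈ W ⊓ V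
      · obtain ⟨r, hr⟩ := (bijective_smul_skyGen R x hxN).2 (res _ inf_le_left s)
        refine ⟨r • res _ inf_le_right (gen R V), ?_⟩
        rw [map_smul, app_res, app_toSky_gen, res_res]
        exact hr
      · have := subsingleton_sec_skyscraper R x hxN
        exact ⟨0, Subsingleton.elim _ _⟩
    · have hyx : y ≠ x := fun e => hyV (e ▸ hx)
      -- Here `y` lies outside `V`, hence differs from `x`; removing the closed point `x` from `W`
      -- leaves the skyscraper without nonzero sections.
      let N : Opens X := W ⊓ ⟨{x}ᶜ, isOpen_compl_singleton⟩
      have hN : x ∉ N := fun h => h.2 rfl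
      have := subsingleton_sec_skyscraper R x hN
      exact ⟨N, inf_le_left, ⟨hy, hyx⟩, 0, Subsingleton.elim _ _⟩

/-- The presheaf `V ↦ F(V ∩ U)`. -/
noncomputable def restrictPresheaf (F : ModSheaf R X) (U : Opens X) :
    TopCat.Presheaf (ModuleCat.{u} R) X where
  obj V := F.obj.obj (op (V.unop ⊓ U))
  map i := F.obj.map (homOfLE (inf_le_inf_right U (leOfHom i.unop))).op
  map_id V := F.obj.map_id _
  map_comp i j := F.obj.map_comp (homOfLE (inf_le_inf_right U (leOfHom i.unop))).op
    (homOfLE (inf_le_inf_right U (leOfHom j.unop))).op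

/-- The sheaf `V ↦ F(V ∩ U)`, the pushforward to `X` of the restriction of `F` to `U`. -/
noncomputable def restrictSheaf (F : ModSheaf R X) (U : Opens X) : ModSheaf R X where
  obj := restrictPresheaf F U
  property := by
    refine (TopCat.Presheaf.isSheaf_iff_isSheafUniqueGluing (restrictPresheaf F U)).2 ?_
    intro ι W sf hsf
    obtain ⟨t, ht⟩ := exists_glue (F := F) (fun i => W i ⊓ U) (iSup W ⊓ U)
      (fun i => inf_le_inf_right U (le_iSup W i))
      (fun y hy => by
        obtain ⟨i, hi⟩ := Opens.mem_iSup.1 hy.1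
        exact ⟨i, hi, hy.2⟩) sf (fun i j => by
        have h1 : (W i ⊓ U) ⊓ (W j ⊓ U) ≤ (W i ⊓ W j) ⊓ U :=
          fun z hz => ⟨⟨hz.1.1, hz.2.1⟩, hz.1.2⟩
        have h2 := congr(res F h1 $(hsf i j))
        exact (res_res h1 _ _).symm.trans (h2.trans (res_res h1 _ _)))
    refine ⟨t, ht, fun t' ht' => ?_⟩
    refine sec_ext (F := F) fun y hy => ?_
    obtain ⟨i, hi⟩ := Opens.mem_iSup.1 hy.1
    exact ⟨W i ⊓ U, inf_le_inf_right U (le_iSup W i), ⟨hi, hy.2⟩, (ht' i).trans (ht i).symm⟩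

/-- Sections of `restrictSheaf F U` over `V` are sections of `F` over `V ∩ U`. -/
noncomputable def secRestrict (F : ModSheaf R X) (U V : Opens X) :
    Sec (restrictSheaf F U) V ≃ₗ[R] Sec F (V ⊓ U) := LinearEquiv.refl R _

/-- The restriction map `F ⟶ restrictSheaf F U`. -/
noncomputable def toRestrict (F : ModSheaf R X) (U : Opens X) : F ⟶ restrictSheaf F U where
  hom :=
    { app V := F.obj.map (homOfLE (inf_le_left : V.unop ⊓ U ≤ V.unop)).op
      naturality V W i := by
        change F.obj.map i ≫ F.obj.map _ = F.obj.map _ ≫ F.obj.map _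
        rw [← F.obj.map_comp, ← F.obj.map_comp]
        rfl }

lemma subsingleton_sec_bot (F : ModSheaf R X) {V : Opens X} (h : V = ⊥) :
    Subsingleton (Sec F V) :=
  ⟨fun s t => sec_ext fun y hy => by subst h; exact hy.elim⟩

/-- The first hypothesis says that `D` is the exterior of `U`. A constant on `N` that dies on `N ⊓
U` is zero unless `N ⊓ U` is empty, that is, unless `N ≤ D`; this identifies the kernel. Local
surjectivity off `D` is the hypothesis `hloc`, and over `D` the target is zero. -/
lemma shortExact_restrict {D U : Opens X} (hD : ∀ V : Opens X, V ≤ D ↔ V ⊓ U = ⊥)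
    (hloc : ∀ y, y ∉ D → ∀ V : Opens X, y ∈ V → ∃ N ≤ V, y ∈ N ∧
      Function.Surjective (res (FU R (⊤ : Opens X)) (inf_le_left : N ⊓ U ≤ N))) :
    (ShortComplex.mk (FUmap R (le_top : D ≤ ⊤)) (toRestrict (FU R ⊤) U) (by
      have := subsingleton_sec_bot (FU R (⊤ : Opens X)) ((hD D).1 le_rfl)
      exact FU_hom_ext (Subsingleton.elim (α := Sec (FU R (⊤ : Opens X)) (D ⊓ U)) _ _))).ShortExact := by
  refine shortExact_of_sections _ _ _ (app_FUmap_injective _) ?_ ?_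
  · intro V s hs y hy
    have hs' : res _ (inf_le_left : V ⊓ U ≤ V) s = 0 := hs
    obtain ⟨N, hN, hyN, ⟨_, r, hr⟩ | h0⟩ := FU_local s y hy
    · refine ⟨N, hN, hyN, ?_⟩
      by_cases hND : N ≤ D
      · exact ⟨r • res _ hND (gen R D), by rw [hr, map_smul, app_res, app_FUmap_gen, res_res]⟩
      · refine ⟨0, ?_⟩
        rw [hD, Opens.ext_iff, Opens.coe_bot, ← ne_eq, ← Set.nonempty_iff_ne_empty] at hND
        obtain ⟨z, hz⟩ := hND
        have h1 : res _ (inf_le_left : N ⊓ U ≤ N) (res _ hN s) = 0 := by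
          have := congr(res _ (inf_le_inf_right U hN) $hs')
          rw [res_res, map_zero] at this
          rw [res_res, this]
        rw [hr, map_smul, res_res] at h1
        rw [hr, gen_smul_eq_zero _ r z hz h1, zero_smul, map_zero]
    · exact ⟨N, hN, hyN, 0, by rw [h0, map_zero]⟩
  · intro V s y hy
    by_cases hyD : y ∈ D
    · have : Subsingleton (Sec (restrictSheaf (FU R (⊤ : Opens X)) U) (V ⊓ D)) :=
        subsingleton_sec_bot (FU R (⊤ : Opens X)) ((hD (V ⊓ D)).1 inf_le_right)
      exact ⟨V ⊓ D, inf_le_left, ⟨hy, hyD⟩, 0, Subsingleton.elim _ _⟩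
    · obtain ⟨N, hN, hyN, h⟩ := hloc y hyD V hy
      obtain ⟨t, ht⟩ := h (secRestrict _ _ _ (res _ hN s))
      exact ⟨N, hN, hyN, t, ht⟩

section Biprod

instance : HasBinaryBiproducts (ModSheaf R X) := hasBinaryBiproducts_of_finite_biproducts _

lemma app_biprod_ext {V : Opens X} {s t : Sec (F ⊞ G) V}
    (h₁ : app (biprod.fst : F ⊞ G ⟶ F) V s = app (biprod.fst : F ⊞ G ⟶ F) V t) (h₂ : app (biprod.snd : F ⊞ G ⟶ G) V s = app (biprod.snd : F ⊞ G ⟶ G) V t) :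
    s = t := by
  have h : ∀ s : Sec (F ⊞ G) V, s = app (biprod.inl : F ⟶ F ⊞ G) V (app (biprod.fst : F ⊞ G ⟶ F) V s) +
      app (biprod.inr : G ⟶ F ⊞ G) V (app (biprod.snd : F ⊞ G ⟶ G) V s) := fun s => by
    rw [← app_comp, ← app_comp, ← app_add, biprod.total, app_id]
  rw [h s, h t, h₁, h₂]

lemma app_desc {f : F ⟶ H} {g : G ⟶ H} {V : Opens X} (s : Sec (F ⊞ G) V) :
    app (biprod.desc f g) V s = app f V (app (biprod.fst : F ⊞ G ⟶ F) V s) +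
      app g V (app (biprod.snd : F ⊞ G ⟶ G) V s) := by
  rw [← app_comp, ← app_comp, ← app_add, biprod.desc_eq]

end Biprod

lemma shortExact_mayerVietoris (A B : Opens X) :
    (ShortComplex.mk (biprod.lift (FUmap R (inf_le_left : A ⊓ B ≤ A)) (-FUmap R (inf_le_right : A ⊓ B ≤ B)))
      (biprod.desc (FUmap R (le_sup_left : A ≤ A ⊔ B)) (FUmap R (le_sup_right : B ≤ A ⊔ B)))
      (by rw [biprod.lift_desc, FUmap_FUmap, Preadditive.neg_comp, FUmap_FUmap,
        add_neg_cancel])).ShortExact := by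
  refine shortExact_of_sections _ _ _ ?_ ?_ ?_
  · intro V s t h
    have := congr(app (biprod.fst : FU R A ⊞ FU R B ⟶ FU R A) V $h)
    rw [← app_comp, ← app_comp, biprod.lift_fst] at this
    exact app_FUmap_injective _ V this
  · intro V s hs y hy
    rw [app_desc] at hs
    obtain ⟨N₁, hN₁, hyN₁, h₁⟩ := FU_local (app (biprod.fst : FU R A ⊞ FU R B ⟶ FU R A) V s) y hy
    obtain ⟨N, hNN, hyN, h₂⟩ := FU_local (res _ hN₁ (app (biprod.snd : FU R A ⊞ FU R B ⟶ FU R B) V s)) y hyN₁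
    have hN := hNN.trans hN₁
    rw [res_res, ← app_res] at h₂
    replace h₁ : (∃ (h : N ≤ A) (r : R), app (biprod.fst : FU R A ⊞ FU R B ⟶ FU R A) N (res _ hN s) = r • res _ h (gen R A)) ∨
        app (biprod.fst : FU R A ⊞ FU R B ⟶ FU R A) N (res _ hN s) = 0 := by
      rw [app_res, ← res_res hNN hN₁]
      obtain ⟨h, r, hr⟩ | h0 := h₁
      · exact .inl ⟨hNN.trans h, r, by rw [hr, map_smul, res_res]⟩
      · exact .inr (by rw [h0, map_zero])
    replace hs := congr(res _ hN $hs)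
    rw [map_add, ← app_res, ← app_res, ← app_res, ← app_res, map_zero] at hs
    refine ⟨N, hN, hyN, ?_⟩
    generalize res _ hN s = s' at *
    obtain ⟨hA, r, hr⟩ | h0 := h₁
    · obtain ⟨hB, r', hr'⟩ | h0' := h₂
      · refine ⟨r • res _ (le_inf hA hB) (gen R (A ⊓ B)), ?_⟩
        rw [hr, hr', map_smul, map_smul, app_res, app_res, app_FUmap_gen, app_FUmap_gen,
          res_res, res_res, ← add_smul] at hs
        have h3 := gen_smul_eq_zero _ _ y hyN hs
        apply app_biprod_ext
        · rw [← app_comp, biprod.lift_fst, hr, map_smul, app_res, app_FUmap_gen, res_res]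
        · rw [← app_comp, biprod.lift_snd, hr', map_smul, app_res, app_neg, app_FUmap_gen, map_neg,
            res_res, eq_neg_of_add_eq_zero_right h3, neg_smul, smul_neg]
      · refine ⟨0, ?_⟩
        rw [hr, h0', map_zero, add_zero, map_smul, app_res, app_FUmap_gen, res_res] at hs
        rw [gen_smul_eq_zero _ _ y hyN hs, zero_smul] at hr
        apply app_biprod_ext
        · rw [map_zero, map_zero, hr]
        · rw [map_zero, map_zero, h0']
    · refine ⟨0, ?_⟩
      apply app_biprod_ext
      · rw [map_zero, map_zero, h0]
      · rw [map_zero, map_zero]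
        rw [h0, map_zero, zero_add] at hs
        exact (app_FUmap_injective _ N (hs.trans (map_zero _).symm)).symm
  · intro V s y hy
    obtain ⟨N, hN, hyN, ⟨hNU, r, hr⟩ | h0⟩ := FU_local s y hy
    · obtain h | h := hNU hyN
      · refine ⟨N ⊓ A, inf_le_left.trans hN, ⟨hyN, h⟩,
          r • app (biprod.inl : FU R A ⟶ FU R A ⊞ FU R B) _
            (res _ inf_le_right (gen R A)), ?_⟩
        rw [← res_res inf_le_left hN, hr, map_smul, map_smul, ← app_comp, biprod.inl_desc, app_res,
          app_FUmap_gen, res_res, res_res]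
      · refine ⟨N ⊓ B, inf_le_left.trans hN, ⟨hyN, h⟩,
          r • app (biprod.inr : FU R B ⟶ FU R A ⊞ FU R B) _
            (res _ inf_le_right (gen R B)), ?_⟩
        rw [← res_res inf_le_left hN, hr, map_smul, map_smul, ← app_comp, biprod.inr_desc, app_res,
          app_FUmap_gen, res_res, res_res]
    · exact ⟨N, hN, hyN, 0, by rw [h0, map_zero]⟩

end ModSheaf

namespace ModSheaf
open Opposite
variable {R : Type u} [CommRing R] {X : TopCat.{u}}
variable {F G H : ModSheaf R X}

/-! ### Lifting sections along epimorphisms. -/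

section Lifting

variable {S : ShortComplex (ModSheaf R X)} (hS : S.ShortExact)

/-- The section `s` lifts along `g` after restriction to `N`. -/
def Lifts (g : G ⟶ H) {V : Opens X} (s : Sec H V) (N : Opens X) : Prop :=
  ∃ (hN : N ≤ V) (t : Sec G N), app g N t = res H hN s

lemma Lifts.mono {g : G ⟶ H} {V : Opens X} {s : Sec H V} {N N' : Opens X} (h : Lifts g s N)
    (hN : N' ≤ N) : Lifts g s N' := by
  obtain ⟨hNV, t, ht⟩ := h
  exact ⟨hN.trans hNV, res _ hN t, by rw [app_res, ht, res_res]⟩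

include hS in
lemma exists_local_lift {V : Opens X} (s : Sec S.X₃ V) {y : X} (hy : y ∈ V) :
    ∃ N, y ∈ N ∧ Lifts S.g s N := by
  obtain ⟨N, hN, hyN, t, ht⟩ := (epi_iff_locally S.g).1 hS.epi_g V s y hy
  exact ⟨N, hyN, hN, t, ht⟩

-- On `A ⊓ B` two lifts differ by a section of the kernel. Extending that difference to `A` and
-- subtracting it there makes the lifts agree without changing `t`, which is what iteration and Zorn
-- arguments require.
include hS in
lemma extend_lift {V A B : Opens X} (s : Sec S.X₃ V) (hA : Lifts S.g s A) (hB : B ≤ V)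
    (t : Sec S.X₂ B) (ht : app S.g B t = res _ hB s)
    (hF : Function.Surjective (res S.X₁ (inf_le_left : A ⊓ B ≤ A))) :
    ∃ (hAB : A ⊔ B ≤ V) (t' : Sec S.X₂ (A ⊔ B)),
      app S.g _ t' = res _ hAB s ∧ res _ le_sup_right t' = t := by
  obtain ⟨hAV, a, ha⟩ := hA
  obtain ⟨d, hd⟩ := exact_sections hS (V := A ⊓ B)
    (s := res _ inf_le_left a - res _ inf_le_right t) (by
      rw [map_sub, app_res, app_res, ha, ht, res_res, res_res, sub_self])
  obtain ⟨e, rfl⟩ := hF d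
  have h1 : res _ inf_le_left (a - app S.f A e) = res _ (inf_le_right : A ⊓ B ≤ B) t := by
    rw [map_sub, ← app_res, hd]; abel
  obtain ⟨t', ht'⟩ := exists_glue (F := S.X₂) (fun b : Bool => cond b A B) (A ⊔ B)
    (by rintro (_ | _) <;> simp) (by
      rintro y (h | h)
      · exact ⟨true, h⟩
      · exact ⟨false, h⟩)
    (fun b => Bool.casesOn (motive := fun b => Sec S.X₂ (cond b A B)) b t (a - app S.f A e)) (by
      rintro (_ | _) (_ | _)
      · rfl
      · have := congr(res _ (le_of_eq (inf_comm _ _) : B ⊓ A ≤ A ⊓ B) $h1)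
        rw [res_res, res_res] at this
        exact this.symm
      · exact h1
      · rfl)
  have hA' : res _ le_sup_left t' = a - app S.f A e := ht' true
  have hB' : res _ le_sup_right t' = t := ht' false
  refine ⟨sup_le hAV hB, t', ?_, hB'⟩
  have hfg : ∀ (W : Opens X) (u : Sec S.X₁ W), app S.g W (app S.f W u) = 0 := fun W u => by
    rw [← app_comp, S.zero, app_zero]
  apply sec_ext
  rintro y (h | h)
  · exact ⟨A, le_sup_left, h, by rw [← app_res, hA', map_sub, hfg, ha, res_res, sub_zero]⟩
  · exact ⟨B, le_sup_right, h, by rw [← app_res, hB', ht, res_res]⟩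

include hS in
lemma Lifts.sup {V A B : Opens X} {s : Sec S.X₃ V} (hA : Lifts S.g s A) (hB : Lifts S.g s B)
    (hF : Function.Surjective (res S.X₁ (inf_le_left : A ⊓ B ≤ A))) : Lifts S.g s (A ⊔ B) := by
  obtain ⟨hBV, t, ht⟩ := hB
  obtain ⟨h, t', ht', -⟩ := extend_lift hS s hA hBV t ht hF
  exact ⟨h, t', ht'⟩

-- A Mittag-Leffler argument: a lift over `W (n + 1)` differs on `W n` from the chosen one by a
-- section of the kernel, which extends to `W (n + 1)` and can be subtracted. The corrected lifts
-- are compatible and glue.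
include hS in
lemma lifts_iSup {V : Opens X} (s : Sec S.X₃ V) (W : ℕ → Opens X) (hW : Monotone W)
    (hl : ∀ n, Lifts S.g s (W n))
    (hF : ∀ n, Function.Surjective (res S.X₁ (hW (Nat.le_succ n)))) (U : Opens X)
    (hWU : ∀ n, W n ≤ U) (hU : ∀ y ∈ U, ∃ n, y ∈ W n) : Lifts S.g s U := by
  have hWV : ∀ n, W n ≤ V := fun n => (hl n).1
  have step : ∀ (n : ℕ) (t : {t : Sec S.X₂ (W n) // app S.g _ t = res _ (hWV n) s}),
      ∃ t' : {t : Sec S.X₂ (W (n + 1)) // app S.g _ t = res _ (hWV (n + 1)) s},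
        res _ (hW (Nat.le_succ n)) t'.1 = t.1 := by
    rintro n ⟨t, ht⟩
    obtain ⟨_, a, ha⟩ := hl (n + 1)
    obtain ⟨d, hd⟩ := exact_sections hS (V := W n) (s := res _ (hW (Nat.le_succ n)) a - t) (by
      rw [map_sub, app_res, ha, ht, res_res, sub_self])
    obtain ⟨e, rfl⟩ := hF n d
    refine ⟨⟨a - app S.f _ e, ?_⟩, ?_⟩
    · rw [map_sub, ha, ← app_comp, S.zero, app_zero, sub_zero]
    · rw [map_sub, ← app_res, hd]; abel
  choose next hnext using step
  let t : ∀ n, {t : Sec S.X₂ (W n) // app S.g _ t = res _ (hWV n) s} := fun n =>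
    Nat.rec ⟨(hl 0).2.choose, (hl 0).2.choose_spec⟩ next n
  have ht1 : ∀ n, res _ (hW (Nat.le_succ n)) (t (n + 1)).1 = (t n).1 := fun n => hnext n (t n)
  have ht : ∀ i j (h : i ≤ j), res _ (hW h) (t j).1 = (t i).1 := by
    intro i j h
    induction j, h using Nat.le_induction with
    | base => exact res_refl _ _
    | succ j h ih => rw [← ih, ← ht1 j, res_res]
  obtain ⟨t', ht'⟩ := exists_glue (F := S.X₂) W U hWU hU (fun n => (t n).1) (by
    intro i j
    obtain h | h := le_total i j
    · rw [← ht i j h, res_res]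
    · rw [← ht j i h, res_res])
  refine ⟨fun y hy => ?_, t', ?_⟩
  · obtain ⟨n, hn⟩ := hU y hy
    exact hWV n hn
  · apply sec_ext
    intro y hy
    obtain ⟨n, hn⟩ := hU y hy
    exact ⟨W n, hWU n, hn, by rw [← app_res, ht', (t n).2, res_res]⟩

/-- A lift of the section `s` along `g` over an open subset. -/
structure PartialLift (g : G ⟶ H) {V : Opens X} (s : Sec H V) where
  dom : Opens X
  le : dom ≤ V
  sec : Sec G dom
  app_sec : app g dom sec = res H le s

/-- The extension relation between partial lifts. -/
def PartialLift.Extends {g : G ⟶ H} {V : Opens X} {s : Sec H V} (a b : PartialLift g s) : Prop :=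
  ∃ h : a.dom ≤ b.dom, res G h b.sec = a.sec

lemma PartialLift.exists_upper_bound {g : G ⟶ H} {V : Opens X} {s : Sec H V}
    (c : Set (PartialLift g s)) (hc : IsChain PartialLift.Extends c) :
    ∃ b : PartialLift g s, ∀ a ∈ c, a.Extends b := by
  obtain ⟨t, ht⟩ := exists_glue (F := G) (fun a : c => a.1.dom) (⨆ a : c, a.1.dom)
    (fun a => le_iSup (fun a : c => a.1.dom) a)
    (fun y hy => Opens.mem_iSup.1 hy) (fun a => a.1.sec) (by
      intro i j
      obtain e | e := eq_or_ne i j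
      · subst e; rfl
      · obtain ⟨h, e⟩ | ⟨h, e⟩ := hc i.2 j.2 (fun h => e (Subtype.ext h))
        · rw [← e, res_res]
        · rw [← e, res_res])
  have ht' : app g _ t = res H (iSup_le fun a : c => a.1.le) s := by
    apply sec_ext
    intro y hy
    obtain ⟨a, hya⟩ := Opens.mem_iSup.1 hy
    exact ⟨a.1.dom, le_iSup (fun a : c => a.1.dom) a, hya, by
      rw [← app_res, ht, a.1.app_sec, res_res]⟩
  exact ⟨⟨_, _, t, ht'⟩, fun a ha => ⟨le_iSup (fun a : c => a.1.dom) ⟨a, ha⟩, ht ⟨a, ha⟩⟩⟩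

lemma PartialLift.Extends.trans {g : G ⟶ H} {V : Opens X} {s : Sec H V} {a b c : PartialLift g s}
    (h₁ : a.Extends b) (h₂ : b.Extends c) : a.Extends c := by
  obtain ⟨h, e⟩ := h₁
  obtain ⟨h', e'⟩ := h₂
  exact ⟨h.trans h', by rw [← e, ← e', res_res]⟩

-- Zorn's lemma for partial lifts: by `extend_lift` a maximal one absorbs every local lift, so its
-- domain is all of `V`.
include hS in
lemma lifts_of_flasque {V : Opens X} (s : Sec S.X₃ V)
    (hF : ∀ (A B : Opens X) (h : A ≤ B), B ≤ V → Function.Surjective (res S.X₁ h)) :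
    Lifts S.g s V := by
  obtain ⟨m, hm⟩ := exists_maximal_of_chains_bounded (r := PartialLift.Extends (g := S.g) (s := s))
    PartialLift.exists_upper_bound PartialLift.Extends.trans
  obtain ⟨W, hW, t, ht⟩ := m
  suffices W = V by subst this; exact ⟨le_rfl, t, ht⟩
  refine le_antisymm hW fun y hy => ?_
  obtain ⟨N, hyN, hN⟩ := exists_local_lift hS s hy
  obtain ⟨h, t', ht', e⟩ := extend_lift hS s hN hW t ht (hF _ _ _ hN.1)
  obtain ⟨h', -⟩ := hm ⟨N ⊔ W, h, t', ht'⟩ ⟨le_sup_right, e⟩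
  exact h' (Or.inl hyN)

-- When sections of the kernel are determined by, and extend from, their restrictions to `U`, a
-- local lift has exactly one correction agreeing with the given lift on `U`. Uniqueness makes these
-- corrections glue.
include hS in
lemma lifts_of_bijective_res {U V : Opens X} (s : Sec S.X₃ V)
    (hF : ∀ N : Opens X, N ≤ V → Function.Bijective (res S.X₁ (inf_le_left : N ⊓ U ≤ N)))
    (hs : Lifts S.g s (V ⊓ U)) : Lifts S.g s V := by
  obtain ⟨_, t, ht⟩ := hs
  let Q : ∀ N : Opens X, Sec S.X₂ N → Prop := fun N a => ∃ h : N ≤ V, app S.g N a = res _ h s ∧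
    res _ (inf_le_left : N ⊓ U ≤ N) a = res _ (inf_le_inf_right U h) t
  obtain ⟨t', ht'⟩ := exists_glue_of_local (F := S.X₂) (V := V) Q
    (by
      rintro N N' h a ⟨hN, h1, h2⟩
      refine ⟨h.trans hN, by rw [app_res, h1, res_res], ?_⟩
      have := congr(res _ (inf_le_inf_right U h) $h2)
      rw [res_res, res_res] at this
      rw [res_res, ← this])
    (by
      rintro N a b hN ⟨_, h1, h2⟩ ⟨_, h3, h4⟩
      obtain ⟨d, hd⟩ := exact_sections hS (V := N) (s := a - b) (by
        rw [map_sub, h1, h3, sub_self])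
      have hd0 : d = 0 := by
        apply (hF N hN).1
        have := hS.mono_f
        apply (mono_iff_injective S.f).1 inferInstance
        rw [app_res, hd, map_sub, h2, h4, sub_self, map_zero, map_zero]
      rw [hd0, map_zero] at hd
      exact (sub_eq_zero.1 hd.symm))
    (by
      intro y hy
      obtain ⟨N, hyN, hN, a, ha⟩ := exists_local_lift hS s hy
      obtain ⟨d, hd⟩ := exact_sections hS (V := N ⊓ U)
        (s := res _ inf_le_left a - res _ (inf_le_inf_right U hN) t) (by
        rw [map_sub, app_res, app_res, ha, ht, res_res, res_res, sub_self])
      obtain ⟨e, rfl⟩ := (hF N hN).2 d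
      refine ⟨N, hN, hyN, a - app S.f N e, hN, ?_, ?_⟩
      · rw [map_sub, ha, ← app_comp, S.zero, app_zero, sub_zero]
      · rw [map_sub, ← app_res, hd]; abel)
  refine ⟨le_rfl, t', sec_ext fun y hy => ?_⟩
  obtain ⟨N, hN, hyN, h, h1, -⟩ := ht' y hy
  exact ⟨N, hN, hyN, by rw [← app_res, h1, res_res]⟩

end Lifting

/-! ### Vanishing of Ext from lifting of sections. -/

section Ext

open Abelian

instance : HasExt.{u} (ModSheaf R X) := hasExt_of_enoughInjectives _

/-- The sheaf `F` has surjective restriction maps to all open subsets satisfying `P` from all open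
subsets satisfying `P`. -/
def SurjectiveOn (P : Opens X → Prop) (F : ModSheaf R X) : Prop :=
  ∀ (A B : Opens X) (h : A ≤ B), P A → P B → Function.Surjective (res F h)

/-- Sections over open subsets satisfying `P` can be lifted along epimorphisms whose kernel has
surjective restriction maps between such open subsets. -/
def IsLifting (R : Type u) [CommRing R] (P : Opens X → Prop) : Prop :=
  ∀ (S : ShortComplex (ModSheaf R X)), S.ShortExact → SurjectiveOn P S.X₁ →
    ∀ V, P V → Function.Surjective (app S.g V)

lemma Lifts.exists {g : G ⟶ H} {V : Opens X} {s : Sec H V} (h : Lifts g s V) :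
    ∃ t, app g V t = s := by
  obtain ⟨h, t, ht⟩ := h
  exact ⟨t, by rw [ht, res_refl]⟩

lemma isLifting_le (U : Opens X) : IsLifting R (fun V => V ≤ U) := by
  intro S hS hF V hV s
  exact (lifts_of_flasque hS s fun A B h hB => hF A B h (h.trans (hB.trans hV)) (hB.trans hV)).exists

/-- This stability under quotients is what keeps dimension shifting going: lift the section, extend
it in the middle term, project back. -/
lemma SurjectiveOn.quotient {P : Opens X → Prop} (hP : IsLifting R P)
    {S : ShortComplex (ModSheaf R X)} (hS : S.ShortExact) (h₁ : SurjectiveOn P S.X₁)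
    (h₂ : SurjectiveOn P S.X₂) : SurjectiveOn P S.X₃ := by
  intro A B h hA hB s
  obtain ⟨t, rfl⟩ := hP S hS h₁ A hA s
  obtain ⟨t', rfl⟩ := h₂ A B h hA hB t
  exact ⟨app S.g B t', (app_res _ _ _).symm⟩

/-- The short exact sequence given by an embedding into an injective sheaf. -/
noncomputable def injSeq (F : ModSheaf R X) : ShortComplex (ModSheaf R X) :=
  ShortComplex.mk (Injective.ι F) (cokernel.π (Injective.ι F)) (cokernel.condition _)

lemma injSeq_shortExact (F : ModSheaf R X) : (injSeq F).ShortExact where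
  exact := ShortComplex.exact_of_g_is_cokernel _ (cokernelIsCokernel _)
  mono_f := by dsimp [injSeq]; infer_instance
  epi_g := by dsimp [injSeq]; infer_instance

instance (F : ModSheaf R X) : Injective (injSeq F).X₂ := by dsimp [injSeq]; infer_instance

/-- With an injective middle term every class in degree one is the image of a section of the
quotient under the connecting map, and a section that lifts has zero image. -/
lemma ext_one_eq_zero {V : Opens X} {S : ShortComplex (ModSheaf R X)} (hS : S.ShortExact)
    [Injective S.X₂] (h : Function.Surjective (app S.g V)) (x : Ext (FU R V) S.X₁ 1) : x = 0 := by
  obtain ⟨y, rfl⟩ := Ext.covariant_sequence_exact₁ _ hS x (Ext.eq_zero_of_injective _) (zero_add 1)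
  obtain ⟨φ, rfl⟩ := (Ext.mk₀_bijective _ _).2 y
  obtain ⟨t, ht⟩ := h (app φ V (gen R V))
  obtain rfl : ofSec t ≫ S.g = φ := FU_hom_ext (by rw [app_comp, app_ofSec_gen, ht])
  rw [← Ext.mk₀_comp_mk₀, Ext.comp_assoc _ _ _ (zero_add 0) (zero_add 1) (by lia),
    hS.comp_extClass, Ext.comp_zero]

lemma surjective_of_ext_one {V : Opens X} {S : ShortComplex (ModSheaf R X)} (hS : S.ShortExact)
    (h : ∀ x : Ext (FU R V) S.X₁ 1, x = 0) : Function.Surjective (app S.g V) := by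
  intro s
  obtain ⟨y, hy⟩ := Ext.covariant_sequence_exact₃ _ hS (Ext.mk₀ (ofSec s)) (zero_add 1) (h _)
  obtain ⟨φ, rfl⟩ := (Ext.mk₀_bijective _ _).2 y
  rw [Ext.mk₀_comp_mk₀] at hy
  refine ⟨app φ V (gen R V), ?_⟩
  rw [← app_comp, (Ext.mk₀_bijective _ _).1 hy, app_ofSec_gen]

/-- Dimension shifting along `injSeq`: the injective middle term is flasque, so the cokernel
inherits `SurjectiveOn` and the degree drops by one. -/
lemma ext_eq_zero_of_isLifting {P : Opens X → Prop} (hP : IsLifting R P) {V : Opens X} (hV : P V)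
    {n : ℕ} (hn : 1 ≤ n) {F : ModSheaf R X} (hF : SurjectiveOn P F) (x : Ext (FU R V) F n) :
    x = 0 := by
  induction n, hn using Nat.le_induction generalizing F with
  | base => exact ext_one_eq_zero (injSeq_shortExact F) (hP _ (injSeq_shortExact F) hF V hV) x
  | succ n hn ih =>
    obtain ⟨y, rfl⟩ := Ext.covariant_sequence_exact₁ _ (injSeq_shortExact F) x
      (Ext.eq_zero_of_injective _) rfl
    have := ih (hF.quotient hP (injSeq_shortExact F) fun A B h _ _ => injective_res_surjective _ h) y
    rw [this]
    exact Ext.zero_comp ..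

lemma ext_one_eq_zero_of_bijective_res {U V : Opens X} {F : ModSheaf R X}
    (hF : ∀ N : Opens X, N ≤ V → Function.Bijective (res F (inf_le_left : N ⊓ U ≤ N)))
    (h : ∀ x : Ext (FU R (V ⊓ U)) F 1, x = 0) (x : Ext (FU R V) F 1) : x = 0 := by
  refine ext_one_eq_zero (injSeq_shortExact F) (fun s => ?_) x
  obtain ⟨t, ht⟩ := surjective_of_ext_one (injSeq_shortExact F) h (res _ inf_le_left s)
  exact (lifts_of_bijective_res (injSeq_shortExact F) s hF ⟨inf_le_left, t, ht⟩).exists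

end Ext

end ModSheaf

/-! ### Compactness and exhaustion for real intervals. -/

/-- A gluing principle for intervals: a property of open intervals which is inherited by smaller
intervals, passes to unions of overlapping intervals and holds locally on `[a, b]` holds for some
open interval containing `[a, b]`. -/
lemma exists_interval_of_local (P : ℝ → ℝ → Prop)
    (mono : ∀ l r l' r', P l r → l ≤ l' → r' ≤ r → P l' r')
    (glue : ∀ l r l' r', P l r → P l' r' → l' < r → P l r') {a b : ℝ} (hab : a ≤ b)
    (hloc : ∀ x ∈ Set.Icc a b, ∃ ε > 0, P (x - ε) (x + ε)) :
    ∃ ε > 0, P (a - ε) (b + ε) := by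
  let S : Set ℝ := {x | x ∈ Set.Icc a b ∧ ∃ ε > 0, P (a - ε) (x + ε)}
  have haS : a ∈ S := ⟨⟨le_rfl, hab⟩, hloc a ⟨le_rfl, hab⟩⟩
  have hbdd : BddAbove S := ⟨b, fun x hx => hx.1.2⟩
  have hc : sSup S ∈ Set.Icc a b := ⟨le_csSup hbdd haS, csSup_le ⟨a, haS⟩ fun x hx => hx.1.2⟩
  obtain ⟨ε, hε, h⟩ := hloc _ hc
  obtain ⟨x, ⟨hx, δ, hδ, h'⟩, hxc⟩ := exists_lt_of_lt_csSup ⟨a, haS⟩ (sub_lt_self (sSup S) hε)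
  have key : P (a - δ) (sSup S + ε) := glue _ _ _ _ h' h (by linarith)
  obtain hcb | hcb := hc.2.eq_or_lt
  · refine ⟨min δ ε, lt_min hδ hε, mono _ _ _ _ key ?_ ?_⟩
    · linarith [min_le_left δ ε]
    · linarith [min_le_right δ ε]
  · exfalso
    -- Both bounds are used: the first keeps `sSup S + η` inside `[a, b]`, the second leaves room `ε
    -- / 2` beyond it, so the supremum could be exceeded.
    let η := min (b - sSup S) (ε / 2)
    have hη : 0 < η := lt_min (by linarith) (by linarith)
    have h1 : η ≤ b - sSup S := min_le_left _ _
    have h2 : η ≤ ε / 2 := min_le_right _ _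
    have : sSup S + η ∈ S := by
      refine ⟨⟨by linarith [hc.1], by linarith⟩, min δ (ε / 2), lt_min hδ (by linarith),
        mono _ _ _ _ key ?_ ?_⟩
      · linarith [min_le_left δ (ε / 2)]
      · linarith [min_le_right δ (ε / 2)]
    linarith [le_csSup hbdd this]

/-- An open interval is the increasing union of a sequence of compact intervals. -/
lemma exists_exhaustion (I : Opens ℝ) (hI : (I : Set ℝ).OrdConnected) (hne : (I : Set ℝ).Nonempty) :
    ∃ a b : ℕ → ℝ, Antitone a ∧ Monotone b ∧ (∀ n, a n ≤ b n) ∧ (∀ n, Set.Icc (a n) (b n) ⊆ I) ∧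
      ∀ x ∈ I, ∃ n, x ∈ Set.Ioo (a n) (b n) := by
  have : Nonempty I := hne.to_subtype
  let q : ℕ → ℝ := fun n => (denseSeq I n : I)
  have hq : ∀ n, q n ∈ I := fun n => (denseSeq I n).2
  have hdense : ∀ l r : ℝ, (∃ x ∈ I, x ∈ Set.Ioo l r) → ∃ n, q n ∈ Set.Ioo l r := by
    rintro l r ⟨x, hx, hx'⟩
    obtain ⟨n, hn⟩ := (denseRange_denseSeq I).exists_mem_open
      (isOpen_Ioo.preimage continuous_subtype_val : IsOpen ((↑) ⁻¹' Set.Ioo l r : Set I))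
      ⟨⟨x, hx⟩, hx'⟩
    exact ⟨n, hn⟩
  -- The endpoints are running minima and maxima of a dense sequence in `I`; they stay in `I` and
  -- eventually pass any given point on both sides.
  let a : ℕ → ℝ := fun n => (Finset.range (n + 1)).inf' (by simp) q
  let b : ℕ → ℝ := fun n => (Finset.range (n + 1)).sup' (by simp) q
  have ha : ∀ n k, k ≤ n → a n ≤ q k := fun n k h =>
    Finset.inf'_le _ (by simpa [Nat.lt_succ_iff] using h)
  have hb : ∀ n k, k ≤ n → q k ≤ b n := fun n k h =>
    Finset.le_sup' _ (by simpa [Nat.lt_succ_iff] using h)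
  refine ⟨a, b, fun n m h => Finset.inf'_mono _ (by simpa using h) _,
    fun n m h => Finset.sup'_mono _ (by simpa using h) _,
    fun n => (ha n 0 (Nat.zero_le n)).trans (hb n 0 (Nat.zero_le n)), fun n => ?_, fun x hx => ?_⟩
  · have h1 : a n ∈ I := by
      change (Finset.range (n + 1)).inf' _ q ∈ I
      obtain ⟨k, -, hk⟩ := Finset.exists_mem_eq_inf' (by simp : (Finset.range (n + 1)).Nonempty) q
      rw [show _ = q k from hk]; exact hq k
    have h2 : b n ∈ I := by
      change (Finset.range (n + 1)).sup' _ q ∈ I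
      obtain ⟨k, -, hk⟩ := Finset.exists_mem_eq_sup' (by simp : (Finset.range (n + 1)).Nonempty) q
      rw [show _ = q k from hk]; exact hq k
    exact hI.out h1 h2
  · obtain ⟨ε, hε, h⟩ := Metric.isOpen_iff.1 I.2 x hx
    obtain ⟨k, hk⟩ := hdense (x - ε) x ⟨x - ε / 2, h (by
      rw [Metric.mem_ball, Real.dist_eq, abs_lt]; constructor <;> linarith),
      by constructor <;> linarith⟩
    obtain ⟨l, hl⟩ := hdense x (x + ε) ⟨x + ε / 2, h (by
      rw [Metric.mem_ball, Real.dist_eq, abs_lt]; constructor <;> linarith),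
      by constructor <;> linarith⟩
    exact ⟨max k l, (ha _ k (le_max_left _ _)).trans_lt hk.2,
      hl.1.trans_le (hb _ l (le_max_right _ _))⟩

namespace ModSheaf
variable {R : Type u} [CommRing R] {X : TopCat.{u}}

/-! ### Open rectangles in a chart. -/

section Box

variable {f : ℝ × ℝ → X} (hf : Topology.IsOpenEmbedding f)

/-- The image of a product of two open subsets of the line. -/
def box (I J : Opens ℝ) : Opens X := ⟨f '' (I ×ˢ J), hf.isOpenMap _ (I.2.prod J.2)⟩

/-- The open interval `(a, b)`. -/
def ivl (a b : ℝ) : Opens ℝ := ⟨Set.Ioo a b, isOpen_Ioo⟩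

/-- The images of products of two open intervals. -/
def IsBox (V : Opens X) : Prop :=
  ∃ I J : Opens ℝ, (I : Set ℝ).OrdConnected ∧ (J : Set ℝ).OrdConnected ∧ V = box hf I J

lemma mem_box {I J : Opens ℝ} {v : ℝ × ℝ} : f v ∈ box hf I J ↔ v.1 ∈ I ∧ v.2 ∈ J := by
  change f v ∈ f '' _ ↔ _
  rw [hf.injective.mem_set_image]
  rfl

lemma box_mono {I J I' J' : Opens ℝ} (hI : I ≤ I') (hJ : J ≤ J') : box hf I J ≤ box hf I' J' :=
  Set.image_mono (Set.prod_mono hI hJ)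

lemma box_inf (I J I' J' : Opens ℝ) : box hf I J ⊓ box hf I' J' = box hf (I ⊓ I') (J ⊓ J') := by
  ext y
  constructor
  · rintro ⟨⟨v, hv, rfl⟩, h⟩
    have h' := (mem_box hf).1 h
    exact (mem_box hf).2 ⟨⟨hv.1, h'.1⟩, ⟨hv.2, h'.2⟩⟩
  · rintro ⟨v, hv, rfl⟩
    exact ⟨(mem_box hf).2 ⟨hv.1.1, hv.2.1⟩, (mem_box hf).2 ⟨hv.1.2, hv.2.2⟩⟩

lemma ivl_mono {a b a' b' : ℝ} (ha : a ≤ a') (hb : b' ≤ b) : ivl a' b' ≤ ivl a b :=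
  Set.Ioo_subset_Ioo ha hb

lemma ivl_le_sup {l r l' r' : ℝ} (h : l' < r) : ivl l r' ≤ ivl l r ⊔ ivl l' r' := by
  intro x hx
  obtain h' | h' := lt_or_ge x r
  · exact Or.inl ⟨hx.1, h'⟩
  · exact Or.inr ⟨h.trans_le h', hx.2⟩

lemma isBox_box {I J : Opens ℝ} (hI : (I : Set ℝ).OrdConnected) (hJ : (J : Set ℝ).OrdConnected) :
    IsBox hf (box hf I J) := ⟨I, J, hI, hJ, rfl⟩

lemma ordConnected_ivl (a b : ℝ) : (ivl a b : Set ℝ).OrdConnected := Set.ordConnected_Ioo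

lemma isBox_inf {A B : Opens X} (hA : IsBox hf A) (hB : IsBox hf B) : IsBox hf (A ⊓ B) := by
  obtain ⟨I, J, hI, hJ, rfl⟩ := hA
  obtain ⟨I', J', hI', hJ', rfl⟩ := hB
  rw [box_inf]
  exact isBox_box hf (hI.inter hI') (hJ.inter hJ')

lemma isBox_ivl (a b c d : ℝ) : IsBox hf (box hf (ivl a b) (ivl c d)) :=
  isBox_box hf (ordConnected_ivl a b) (ordConnected_ivl c d)

variable {S : ShortComplex (ModSheaf R X)} (hS : S.ShortExact)

-- The interval principle is applied twice: horizontally at a fixed height, giving a strip of some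
-- positive thickness, then vertically to the strips. Lifts glue because two rectangles meet in a
-- rectangle, from which kernel sections extend.
include hS in
lemma lifts_compact_box (hF : SurjectiveOn (IsBox hf) S.X₁) {V : Opens X} (s : Sec S.X₃ V)
    {a b c d : ℝ} (hab : a ≤ b) (hcd : c ≤ d)
    (hV : ∀ v : ℝ × ℝ, v.1 ∈ Set.Icc a b → v.2 ∈ Set.Icc c d → f v ∈ V) :
    Lifts S.g s (box hf (ivl a b) (ivl c d)) := by
  have hsurj : ∀ l r l' r' m n m' n' : ℝ, Function.Surjective (res S.X₁ (inf_le_left :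
      box hf (ivl l r) (ivl m n) ⊓ box hf (ivl l' r') (ivl m' n') ≤ _)) := fun _ _ _ _ _ _ _ _ =>
    hF _ _ _ (isBox_inf hf (isBox_ivl hf _ _ _ _) (isBox_ivl hf _ _ _ _)) (isBox_ivl hf _ _ _ _)
  have hrow : ∀ q ∈ Set.Icc c d, ∃ δ > 0,
      Lifts S.g s (box hf (ivl a b) (ivl (q - δ) (q + δ))) := by
    intro q hq
    obtain ⟨ε, hε, δ, hδ, h⟩ := exists_interval_of_local
      (fun l r => ∃ δ > 0, Lifts S.g s (box hf (ivl l r) (ivl (q - δ) (q + δ))))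
      (fun l r l' r' ⟨δ, hδ, h⟩ hl hr => ⟨δ, hδ, h.mono (box_mono hf (ivl_mono hl hr) le_rfl)⟩)
      (fun l r l' r' ⟨δ, hδ, h⟩ ⟨δ', hδ', h'⟩ hlr => by
        refine ⟨min δ δ', lt_min hδ hδ', ?_⟩
        have hm := min_le_left δ δ'
        have hm' := min_le_right δ δ'
        refine ((h.mono (box_mono hf le_rfl (ivl_mono (a' := q - min δ δ') (b' := q + min δ δ')
          (by linarith) (by linarith)))).sup hS
          (h'.mono (box_mono hf le_rfl (ivl_mono (a' := q - min δ δ') (b' := q + min δ δ')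
          (by linarith) (by linarith)))) (hsurj _ _ _ _ _ _ _ _)).mono ?_
        rintro _ ⟨v, hv, rfl⟩
        obtain h1 | h1 := ivl_le_sup hlr hv.1
        · exact Or.inl ((mem_box hf).2 ⟨h1, hv.2⟩)
        · exact Or.inr ((mem_box hf).2 ⟨h1, hv.2⟩)) hab (by
        intro p hp
        obtain ⟨N, hN, hl⟩ := exists_local_lift hS s (hV (p, q) hp hq)
        obtain ⟨ε, hε, h⟩ := Metric.isOpen_iff.1 (N.2.preimage hf.continuous) (p, q) hN
        refine ⟨ε, hε, ε, hε, hl.mono ?_⟩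
        rintro _ ⟨v, hv, rfl⟩
        apply h
        rw [← ball_prod_same, Real.ball_eq_Ioo, Real.ball_eq_Ioo]
        exact hv)
    exact ⟨δ, hδ, h.mono (box_mono hf (ivl_mono (by linarith) (by linarith)) le_rfl)⟩
  obtain ⟨ε, hε, h⟩ := exists_interval_of_local
    (fun m n => Lifts S.g s (box hf (ivl a b) (ivl m n)))
    (fun l r l' r' h hl hr => h.mono (box_mono hf le_rfl (ivl_mono hl hr)))
    (fun l r l' r' h h' hlr => by
      refine (h.sup hS h' (hsurj _ _ _ _ _ _ _ _)).mono ?_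
      rintro _ ⟨v, hv, rfl⟩
      obtain h1 | h1 := ivl_le_sup hlr hv.2
      · exact Or.inl ((mem_box hf).2 ⟨hv.1, h1⟩)
      · exact Or.inr ((mem_box hf).2 ⟨hv.1, h1⟩)) hcd hrow
  exact h.mono (box_mono hf le_rfl (ivl_mono (by linarith) (by linarith)))

/-- Exhaust the rectangle by interiors of compact rectangles, lift over each, and pass to the union
by `lifts_iSup`. -/
lemma isLifting_isBox : IsLifting R (IsBox hf) := by
  rintro S hS hF _ ⟨I, J, hI, hJ, rfl⟩ s
  obtain hbot | ⟨_, ⟨v, hv, rfl⟩⟩ := ((box hf I J : Opens X) : Set X).eq_empty_or_nonempty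
  · have := subsingleton_sec_bot S.X₃ (Opens.ext (hbot.trans Opens.coe_bot.symm))
    exact ⟨0, Subsingleton.elim _ _⟩
  obtain ⟨a, b, ha, hb, hab, hI', hIc⟩ := exists_exhaustion I hI ⟨_, hv.1⟩
  obtain ⟨c, d, hc, hd, hcd, hJ', hJc⟩ := exists_exhaustion J hJ ⟨_, hv.2⟩
  have hmono : Monotone fun n => box hf (ivl (a n) (b n)) (ivl (c n) (d n)) := fun n m h =>
    box_mono hf (ivl_mono (ha h) (hb h)) (ivl_mono (hc h) (hd h))
  refine (lifts_iSup hS s _ hmono (fun n => lifts_compact_box hf hS hF s (hab n) (hcd n)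
    fun v h1 h2 => (mem_box hf).2 ⟨hI' n h1, hJ' n h2⟩)
    (fun n => hF _ _ _ (isBox_ivl hf _ _ _ _) (isBox_ivl hf _ _ _ _)) _
    (fun n => box_mono hf (Set.Ioo_subset_Icc_self.trans (hI' n))
      (Set.Ioo_subset_Icc_self.trans (hJ' n))) ?_).exists
  rintro _ ⟨v, hv, rfl⟩
  obtain ⟨n, hn⟩ := hIc _ hv.1
  obtain ⟨m, hm⟩ := hJc _ hv.2
  exact ⟨max n m, (mem_box hf).2
    ⟨ivl_mono (ha (le_max_left n m)) (hb (le_max_left n m)) hn,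
      ivl_mono (hc (le_max_right n m)) (hd (le_max_right n m)) hm⟩⟩

end Box

end ModSheaf

/-! ### Vanishing consequences of the long exact sequences of Ext. -/

section Ext

open Abelian

variable {C : Type u} [Category.{v} C] [Abelian C] [HasExt.{w} C]
variable {S : ShortComplex C} (hS : S.ShortExact) {Y : C}

include hS

/-- `Ext` groups of the quotient vanish if those of the middle term do and if the previous `Ext`
groups of the subobject come from the middle term. -/
lemma CategoryTheory.ShortComplex.ShortExact.ext_X₃ {n m : ℕ} (h : 1 + n = m)
    (h₁ : ∀ x : Ext S.X₁ Y n, ∃ z : Ext S.X₂ Y n, (Ext.mk₀ S.f).comp z (zero_add n) = x)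
    (h₂ : Subsingleton (Ext S.X₂ Y m)) : Subsingleton (Ext S.X₃ Y m) := by
  refine subsingleton_of_forall_eq 0 fun x => ?_
  obtain ⟨y, rfl⟩ := Ext.contravariant_sequence_exact₃ hS Y x (Subsingleton.elim _ _) h
  obtain ⟨z, rfl⟩ := h₁ y
  rw [← Ext.comp_assoc _ _ _ (add_zero 1) (zero_add n) (by lia), hS.extClass_comp, Ext.zero_comp]

lemma CategoryTheory.ShortComplex.ShortExact.ext_X₃' {n m : ℕ} (h : 1 + n = m)
    (h₁ : Subsingleton (Ext S.X₁ Y n))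
    (h₂ : Subsingleton (Ext S.X₂ Y m)) : Subsingleton (Ext S.X₃ Y m) :=
  hS.ext_X₃ h (fun _ => ⟨0, Subsingleton.elim _ _⟩) h₂

/-- The covariant analogue, for `Ext` groups with values in the subobject. -/
lemma CategoryTheory.ShortComplex.ShortExact.ext_X₁ {n m : ℕ} (h : n + 1 = m)
    (h₃ : Subsingleton (Ext Y S.X₃ n)) (h₂ : Subsingleton (Ext Y S.X₂ m)) :
    Subsingleton (Ext Y S.X₁ m) := by
  refine subsingleton_of_forall_eq 0 fun x => ?_
  obtain ⟨y, rfl⟩ := Ext.covariant_sequence_exact₁ _ hS x (Subsingleton.elim _ _) h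
  rw [Subsingleton.elim y 0, Ext.zero_comp]

end Ext

/-! ### Free generators of modules of rank one. -/

section Gen

/-- The element `m` freely generates the module `M`. -/
def IsGen (R : Type*) {M : Type*} [CommRing R] [AddCommGroup M] [Module R M] (m : M) : Prop :=
  Function.Bijective fun r : R => r • m

variable {R M N : Type*} [CommRing R] [AddCommGroup M] [Module R M] [AddCommGroup N] [Module R N]

lemma IsGen.of_bijective {m : M} (h : IsGen R m) (e : M →ₗ[R] N) (he : Function.Bijective e) :
    IsGen R (e m) := by
  have : (fun r : R => r • e m) = e ∘ fun r : R => r • m := by ext r; simp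
  rw [IsGen, this]
  exact he.comp h

lemma isGen_of {m : M} (h₁ : ∀ x : M, ∃ r : R, r • m = x) (h₂ : ∀ r : R, r • m = 0 → r = 0) :
    IsGen R m :=
  ⟨(injective_iff_map_eq_zero (LinearMap.toSpanSingleton R M m)).2 h₂, h₁⟩

lemma IsGen.smul_eq_zero {m : M} (h : IsGen R m) {r : R} (hr : r • m = 0) : r = 0 :=
  h.1 (hr.trans (zero_smul R m).symm)

end Gen

namespace ModSheaf
open Abelian
variable {R : Type u} [CommRing R] {X : TopCat.{u}}

/-! ### The constant sheaf on connected sets and on rectangles. -/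

section Const

lemma isGen_toSec {U : Opens X} {F : ModSheaf R X} {φ : FU R U ⟶ F} :
    IsGen R φ ↔ IsGen R (app φ U (gen R U)) := by
  let e := LinearEquiv.ofBijective (toSec U F) ⟨toSec_injective U F, toSec_surjective U F⟩
  constructor
  · intro h
    exact h.of_bijective e.toLinearMap e.bijective
  · intro h
    have := h.of_bijective e.symm.toLinearMap e.symm.bijective
    rwa [show e.symm.toLinearMap (app φ U (gen R U)) = φ from e.symm_apply_apply φ] at this

/-- Sections of the constant sheaf over a preconnected open subset are constant. -/
lemma exists_eq_smul_gen {U V : Opens X} (h : V ≤ U) (hV : IsPreconnected (V : Set X))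
    (s : Sec (FU R U) V) : ∃ r : R, s = r • res _ h (gen R U) := by
  obtain hne | ⟨y₀, hy₀⟩ := (V : Set X).eq_empty_or_nonempty
  · have := subsingleton_sec_bot (FU R U) (Opens.ext (hne.trans Opens.coe_bot.symm))
    exact ⟨0, Subsingleton.elim _ _⟩
  -- The sets where `s` takes the value `r` are open, disjoint for different `r`, and cover `V`;
  -- preconnectedness leaves room for only one of them.
  let A : R → Set X := fun r => {y | ∃ (N : Opens X) (hN : N ≤ V), y ∈ N ∧
    res _ hN s = r • res _ (hN.trans h) (gen R U)}
  have hA : ∀ r, IsOpen (A r) := fun r => isOpen_iff_mem_nhds.2 fun y ⟨N, hN, hy, e⟩ =>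
    Filter.mem_of_superset (N.2.mem_nhds hy) fun z hz => ⟨N, hN, hz, e⟩
  have hdisj : ∀ r r' y, y ∈ A r → y ∈ A r' → r = r' := by
    rintro r r' y ⟨N, hN, hy, e⟩ ⟨N', hN', hy', e'⟩
    rw [← sub_eq_zero]
    apply gen_smul_eq_zero (inf_le_left.trans (hN.trans h) : N ⊓ N' ≤ U) _ y ⟨hy, hy'⟩
    have h1 := congr(res _ (inf_le_left : N ⊓ N' ≤ N) $e)
    have h2 := congr(res _ (inf_le_right : N ⊓ N' ≤ N') $e')
    rw [res_res, map_smul, res_res] at h1 h2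
    rw [sub_smul, ← h1, ← h2, sub_self]
  have hcov : ∀ y ∈ V, ∃ r, y ∈ A r := by
    intro y hy
    obtain ⟨N, hN, hyN, ⟨_, r, hr⟩ | h0⟩ := FU_local s y hy
    · exact ⟨r, N, hN, hyN, hr⟩
    · exact ⟨0, N, hN, hyN, by rw [h0, zero_smul]⟩
  obtain ⟨r₀, hr₀⟩ := hcov y₀ hy₀
  refine ⟨r₀, sec_ext fun y hy => ?_⟩
  have hsub : (V : Set X) ⊆ A r₀ := by
    refine hV.subset_left_of_subset_union (hA r₀)
      (isOpen_iUnion fun r : {r // r ≠ r₀} => hA r.1) ?_ ?_ ⟨y₀, hy₀, hr₀⟩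
    · rw [Set.disjoint_iUnion_right]
      rintro ⟨r, hr⟩
      rw [Set.disjoint_left]
      exact fun z hz hz' => hr (hdisj r r₀ z hz' hz)
    · intro z hz
      obtain ⟨r, hr⟩ := hcov z hz
      by_cases e : r = r₀
      · exact Or.inl (e ▸ hr)
      · exact Or.inr (Set.mem_iUnion.2 ⟨⟨r, e⟩, hr⟩)
  obtain ⟨N, hN, hyN, e⟩ := hsub hy
  exact ⟨N, hN, hyN, by rw [e, map_smul, res_res]⟩

lemma isGen_res_gen {U V : Opens X} (h : V ≤ U) (hV : IsPreconnected (V : Set X))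
    (hne : (V : Set X).Nonempty) : IsGen R (res (FU R U) h (gen R U)) := by
  obtain ⟨y, hy⟩ := hne
  refine isGen_of (fun s => ?_) fun r hr => gen_smul_eq_zero h r y hy hr
  obtain ⟨r, rfl⟩ := exists_eq_smul_gen h hV s
  exact ⟨r, rfl⟩

lemma surjective_res_of_isPreconnected {V W : Opens X} (h : V ≤ W)
    (hV : IsPreconnected (V : Set X)) : Function.Surjective (res (FU R (⊤ : Opens X)) h) := by
  intro s
  obtain ⟨r, rfl⟩ := exists_eq_smul_gen le_top hV s
  exact ⟨r • res _ le_top (gen R ⊤), by rw [map_smul, res_res]⟩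

lemma isPreconnected_of_isBox {f : ℝ × ℝ → X} (hf : Topology.IsOpenEmbedding f) {V : Opens X}
    (hV : IsBox hf V) : IsPreconnected (V : Set X) := by
  obtain ⟨I, J, hI, hJ, rfl⟩ := hV
  exact (hI.isPreconnected.prod hJ.isPreconnected).image f hf.continuous.continuousOn

lemma surjectiveOn_const {f : ℝ × ℝ → X} (hf : Topology.IsOpenEmbedding f) :
    SurjectiveOn (IsBox hf) (FU R (⊤ : Opens X)) :=
  fun _ _ h hA _ => surjective_res_of_isPreconnected h (isPreconnected_of_isBox hf hA)

lemma subsingleton_ext_box_const {f : ℝ × ℝ → X} (hf : Topology.IsOpenEmbedding f) {V : Opens X}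
    (hV : IsBox hf V) {n : ℕ} (hn : 1 ≤ n) : Subsingleton (Ext (FU R V) (FU R (⊤ : Opens X)) n) :=
  subsingleton_of_forall_eq 0
    (ext_eq_zero_of_isLifting (isLifting_isBox hf) hV hn (surjectiveOn_const hf))

end Const

/-! ### Vanishing by Mayer–Vietoris. -/

section MayerVietoris

variable {A B : Opens X} {F : ModSheaf R X}

lemma subsingleton_ext_biprod {G H : ModSheaf R X} {n : ℕ} (h₁ : Subsingleton (Ext G F n))
    (h₂ : Subsingleton (Ext H F n)) : Subsingleton (Ext (G ⊞ H) F n) :=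
  ⟨fun _ _ => Ext.biprod_ext (Subsingleton.elim _ _) (Subsingleton.elim _ _)⟩

lemma subsingleton_ext_sup {n m : ℕ} (h : 1 + n = m) (hAB : Subsingleton (Ext (FU R (A ⊓ B)) F n))
    (hA : Subsingleton (Ext (FU R A) F m)) (hB : Subsingleton (Ext (FU R B) F m)) :
    Subsingleton (Ext (FU R (A ⊔ B)) F m) :=
  (shortExact_mayerVietoris A B).ext_X₃' h hAB (subsingleton_ext_biprod hA hB)

/-- Every section over the overlap already comes from `A`, so the connecting map out of degree zero
vanishes. -/
lemma subsingleton_ext_one_sup (hAB : Function.Surjective (res F (inf_le_left : A ⊓ B ≤ A)))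
    (hA : Subsingleton (Ext (FU R A) F 1)) (hB : Subsingleton (Ext (FU R B) F 1)) :
    Subsingleton (Ext (FU R (A ⊔ B)) F 1) := by
  refine (shortExact_mayerVietoris A B).ext_X₃ (add_zero 1) (fun x => ?_)
    (subsingleton_ext_biprod hA hB)
  obtain ⟨φ, rfl⟩ := (Ext.mk₀_bijective _ _).2 x
  obtain ⟨t, ht⟩ := hAB (app φ _ (gen R _))
  refine ⟨Ext.mk₀ (biprod.desc (ofSec t) 0), ?_⟩
  rw [Ext.mk₀_comp_mk₀]
  congr 1
  dsimp only
  rw [biprod.lift_desc, comp_zero, add_zero]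
  exact FU_hom_ext (by rw [app_FUmap_comp, app_ofSec_gen, ht])

/-- The free sheaf on the empty overlap is zero, since its identity corresponds to a section over
the empty set; hence its Ext groups vanish in all degrees, including degree zero. -/
lemma subsingleton_ext_sup_of_disjoint {n : ℕ} (hn : 1 ≤ n) (h : A ⊓ B = ⊥)
    (hA : Subsingleton (Ext (FU R A) F n)) (hB : Subsingleton (Ext (FU R B) F n)) :
    Subsingleton (Ext (FU R (A ⊔ B)) F n) := by
  obtain ⟨m, rfl⟩ := Nat.exists_eq_add_of_le hn
  refine subsingleton_ext_sup rfl ?_ hA hB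
  have : 𝟙 (FU R (A ⊓ B)) = 0 :=
    have := subsingleton_sec_bot (FU R (A ⊓ B)) h
    FU_hom_ext (Subsingleton.elim _ _)
  refine subsingleton_of_forall_eq 0 fun x => ?_
  rw [← Ext.mk₀_id_comp x, this, Ext.mk₀_zero, Ext.zero_comp]

end MayerVietoris

end ModSheaf

namespace ModSheaf
open Abelian
variable {R : Type u} [CommRing R] {X : TopCat.{u}}

/-! ### Connecting homomorphisms as linear maps. -/

section ExtLinear

variable {S : ShortComplex (ModSheaf R X)} (hS : S.ShortExact) (Y : ModSheaf R X)

/-- The connecting homomorphism in the first variable of `Ext`. -/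
noncomputable def extδ {n m : ℕ} (h : 1 + n = m) : Ext S.X₁ Y n →ₗ[R] Ext S.X₃ Y m where
  toFun x := hS.extClass.comp x h
  map_add' _ _ := Ext.comp_add _ _ _ _
  map_smul' _ _ := Ext.comp_smul _ _ _ _

/-- Precomposition with a morphism, on `Ext`. -/
noncomputable def extPrecomp {G H : ModSheaf R X} (φ : G ⟶ H) (n : ℕ) :
    Ext H Y n →ₗ[R] Ext G Y n where
  toFun x := (Ext.mk₀ φ).comp x (zero_add n)
  map_add' _ _ := Ext.comp_add _ _ _ _
  map_smul' _ _ := Ext.comp_smul _ _ _ _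

include hS in
lemma extδ_surjective {n m : ℕ} (h : 1 + n = m) (h₂ : Subsingleton (Ext S.X₂ Y m)) :
    Function.Surjective (extδ hS Y h) :=
  fun x => Ext.contravariant_sequence_exact₃ hS Y x (Subsingleton.elim _ _) h

lemma extδ_mk₀_comp {n m : ℕ} (h : 1 + n = m) (z : Ext S.X₂ Y n) :
    extδ hS Y h (extPrecomp Y S.f n z) = 0 := by
  change hS.extClass.comp ((Ext.mk₀ S.f).comp z (zero_add n)) h = 0
  rw [← Ext.comp_assoc _ _ _ (add_zero 1) (zero_add n) (by lia), hS.extClass_comp, Ext.zero_comp]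

lemma exists_of_extδ_eq_zero {n m : ℕ} (h : 1 + n = m) {x : Ext S.X₁ Y n}
    (hx : extδ hS Y h x = 0) : ∃ z, extPrecomp Y S.f n z = x :=
  Ext.contravariant_sequence_exact₁ hS Y x h hx

lemma bijective_extδ {n m : ℕ} (h : 1 + n = m) (h₁ : Subsingleton (Ext S.X₂ Y n))
    (h₂ : Subsingleton (Ext S.X₂ Y m)) : Function.Bijective (extδ hS Y h) := by
  refine ⟨(injective_iff_map_eq_zero _).2 fun x hx => ?_, extδ_surjective hS Y h h₂⟩
  obtain ⟨z, rfl⟩ := exists_of_extδ_eq_zero hS Y h hx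
  rw [Subsingleton.elim z 0, map_zero]

include hS in
lemma bijective_extPrecomp {n m : ℕ} (h : 1 + n = m) (h₁ : Subsingleton (Ext S.X₁ Y n))
    (h₂ : Subsingleton (Ext S.X₁ Y m)) : Function.Bijective (extPrecomp Y S.g m) := by
  constructor
  · rw [injective_iff_map_eq_zero]
    intro x hx
    obtain ⟨z, rfl⟩ := Ext.contravariant_sequence_exact₃ hS Y x hx h
    rw [Subsingleton.elim z 0, Ext.comp_zero]
  · intro x
    exact Ext.contravariant_sequence_exact₂ hS Y x (Subsingleton.elim _ _)

end ExtLinear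

lemma exists_sec_sup {F : ModSheaf R X} {A B : Opens X} (a : Sec F A) (b : Sec F B)
    (h : res F inf_le_left a = res F (inf_le_right : A ⊓ B ≤ B) b) :
    ∃ t : Sec F (A ⊔ B), res F le_sup_left t = a ∧ res F le_sup_right t = b := by
  obtain ⟨t', ht'⟩ := exists_glue (F := F) (fun b : Bool => cond b A B) (A ⊔ B)
    (by rintro (_ | _) <;> simp) (by
      rintro y (h | h)
      · exact ⟨true, h⟩
      · exact ⟨false, h⟩)
    (fun i => Bool.casesOn (motive := fun b => Sec F (cond b A B)) i b a) (by
      rintro (_ | _) (_ | _)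
      · rfl
      · have := congr(res _ (le_of_eq (inf_comm _ _) : B ⊓ A ≤ A ⊓ B) $h)
        rw [res_res, res_res] at this
        exact this.symm
      · exact h
      · rfl)
  exact ⟨t', ht' true, ht' false⟩

section MayerVietoris

variable (A B : Opens X) (F : ModSheaf R X)

/-- The connecting homomorphism of the Mayer-Vietoris sequence. -/
noncomputable def mvδ {n m : ℕ} (h : 1 + n = m) :
    Ext (FU R (A ⊓ B)) F n →ₗ[R] Ext (FU R (A ⊔ B)) F m :=
  extδ (shortExact_mayerVietoris A B) F h

lemma mvδ_surjective {n m : ℕ} (h : 1 + n = m) (hA : Subsingleton (Ext (FU R A) F m))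
    (hB : Subsingleton (Ext (FU R B) F m)) : Function.Surjective (mvδ A B F h) :=
  extδ_surjective _ _ h (subsingleton_ext_biprod hA hB)

lemma mvδ_bijective {n m : ℕ} (h : 1 + n = m) (hA : Subsingleton (Ext (FU R A) F n))
    (hB : Subsingleton (Ext (FU R B) F n)) (hA' : Subsingleton (Ext (FU R A) F m))
    (hB' : Subsingleton (Ext (FU R B) F m)) : Function.Bijective (mvδ A B F h) :=
  bijective_extδ _ _ h (subsingleton_ext_biprod hA hB) (subsingleton_ext_biprod hA' hB')

lemma exists_eq_mk₀_ofSec {U : Opens X} (x : Ext (FU R U) F 0) :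
    ∃ s : Sec F U, x = Ext.mk₀ (ofSec s) := by
  obtain ⟨φ, rfl⟩ := (Ext.mk₀_bijective _ _).2 x
  exact ⟨app φ U (gen R U), congrArg _ (FU_hom_ext (app_ofSec_gen _).symm)⟩

variable {F}

lemma ofSec_add {U : Opens X} (s t : Sec F U) : ofSec (s + t) = ofSec s + ofSec t :=
  FU_hom_ext (by simp)

lemma ofSec_smul {U : Opens X} (r : R) (s : Sec F U) : ofSec (r • s) = r • ofSec s :=
  FU_hom_ext (by simp)

lemma mvδ_res (a : Sec F A) :
    mvδ A B F (add_zero 1) (Ext.mk₀ (ofSec (res F inf_le_left a))) = 0 := by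
  have h : ofSec (res F (inf_le_left : A ⊓ B ≤ A) a) =
      biprod.lift (FUmap R inf_le_left) (-FUmap R inf_le_right) ≫
        biprod.desc (ofSec a) (0 : FU R B ⟶ F) := by
    apply FU_hom_ext
    rw [biprod.lift_desc, comp_zero, add_zero, app_FUmap_comp, app_ofSec_gen, app_ofSec_gen]
  rw [h, ← Ext.mk₀_comp_mk₀]
  exact extδ_mk₀_comp (shortExact_mayerVietoris A B) F (add_zero 1) _

lemma exists_of_mvδ_eq_zero {u : Sec F (A ⊓ B)}
    (hu : mvδ A B F (add_zero 1) (Ext.mk₀ (ofSec u)) = 0) :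
    ∃ (a : Sec F A) (b : Sec F B), u = res F inf_le_left a - res F inf_le_right b := by
  obtain ⟨z, hz⟩ := exists_of_extδ_eq_zero (shortExact_mayerVietoris A B) F (add_zero 1) hu
  obtain ⟨ψ, rfl⟩ : ∃ ψ : FU R A ⊞ FU R B ⟶ F, Ext.mk₀ ψ = z := (Ext.mk₀_bijective _ _).2 z
  replace hz := (Ext.mk₀_bijective _ _).1 ((Ext.mk₀_comp_mk₀ _ _).symm.trans hz)
  have hψ : ψ = biprod.desc (biprod.inl ≫ ψ) (biprod.inr ≫ ψ) := by
    apply biprod.hom_ext' <;> simp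
  refine ⟨app (biprod.inl ≫ ψ : FU R A ⟶ F) _ (gen R _),
    app (biprod.inr ≫ ψ : FU R B ⟶ F) _ (gen R _), ?_⟩
  rw [← app_ofSec_gen u, ← hz, hψ]
  dsimp only
  rw [biprod.lift_desc, Preadditive.neg_comp, app_add, app_neg, app_FUmap_comp, app_FUmap_comp,
    ← hψ, sub_eq_add_neg]

end MayerVietoris

/-! ### Unions of acyclic sets and first cohomology of an annulus. -/

section Annulus

/-- The vanishing of the higher cohomology of the constant sheaf over `U`. -/
def ConstAcyclic (R : Type u) [CommRing R] {X : TopCat.{u}} (U : Opens X) : Prop :=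
  ∀ n, 1 ≤ n → Subsingleton (Ext (FU R U) (FU R (⊤ : Opens X)) n)

variable {A B : Opens X}

/-- Connectedness of the overlap settles degree one; its acyclicity settles all higher degrees. -/
lemma ConstAcyclic.sup (hA : ConstAcyclic R A) (hB : ConstAcyclic R B)
    (hAB : ConstAcyclic R (A ⊓ B)) (hp : IsPreconnected ((A ⊓ B : Opens X) : Set X)) :
    ConstAcyclic R (A ⊔ B) := by
  intro n hn
  obtain rfl | hn' := hn.eq_or_lt
  · exact subsingleton_ext_one_sup (surjective_res_of_isPreconnected _ hp) (hA 1 le_rfl)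
      (hB 1 le_rfl)
  · obtain ⟨m, rfl⟩ := Nat.exists_eq_add_of_lt hn'
    exact subsingleton_ext_sup (n := m + 1) (by lia) (hAB _ (by lia)) (hA _ (by lia)) (hB _ (by lia))

lemma ConstAcyclic.sup_of_disjoint (hA : ConstAcyclic R A) (hB : ConstAcyclic R B)
    (h : A ⊓ B = ⊥) : ConstAcyclic R (A ⊔ B) :=
  fun n hn => subsingleton_ext_sup_of_disjoint hn h (hA n hn) (hB n hn)

/-- The overlap has two components, so degree one is `R × R` modulo the constants from `A` and `B`,
which form the diagonal. The generator is the image of the section equal to 1 on `P` and 0 on `Q`.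
-/
lemma exists_isGen_ext_one_sup {P Q : Opens X} (hPQ : A ⊓ B = P ⊔ Q) (hd : P ⊓ Q = ⊥)
    (hA : IsPreconnected (A : Set X)) (hB : IsPreconnected (B : Set X))
    (hP : IsPreconnected (P : Set X)) (hQ : IsPreconnected (Q : Set X))
    (hP' : (P : Set X).Nonempty) (hQ' : (Q : Set X).Nonempty)
    (hA₁ : ConstAcyclic R A) (hB₁ : ConstAcyclic R B) :
    ∃ ξ : Ext (FU R (A ⊔ B)) (FU R (⊤ : Opens X)) 1, IsGen R ξ := by
  have hPA : P ≤ A ⊓ B := hPQ ▸ le_sup_left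
  have hQA : Q ≤ A ⊓ B := hPQ ▸ le_sup_right
  have hext : ∀ s t : Sec (FU R (⊤ : Opens X)) (A ⊓ B), res _ hPA s = res _ hPA t →
      res _ hQA s = res _ hQA t → s = t := by
    intro s t h₁ h₂
    apply sec_ext
    intro y hy
    obtain h | h := hPQ.le hy
    · exact ⟨P, hPA, h, h₁⟩
    · exact ⟨Q, hQA, h, h₂⟩
  obtain ⟨u, hu₁, hu₂⟩ : ∃ u : Sec (FU R (⊤ : Opens X)) (A ⊓ B),
      res _ hPA u = res _ le_top (gen R ⊤) ∧ res _ hQA u = 0 := by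
    have := subsingleton_sec_bot (FU R (⊤ : Opens X)) hd
    obtain ⟨t, h1, h2⟩ := exists_sec_sup (F := FU R (⊤ : Opens X)) (A := P) (B := Q)
      (res _ le_top (gen R ⊤)) 0 (Subsingleton.elim _ _)
    refine ⟨res _ hPQ.le t, ?_, ?_⟩
    · rw [res_res, h1]
    · rw [res_res, h2]
  refine ⟨mvδ A B _ (add_zero 1) (Ext.mk₀ (ofSec u)), isGen_of (fun x => ?_) fun r hr => ?_⟩
  · obtain ⟨y, rfl⟩ := mvδ_surjective A B _ (add_zero 1) (hA₁ 1 le_rfl) (hB₁ 1 le_rfl) x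
    obtain ⟨s, rfl⟩ := exists_eq_mk₀_ofSec _ y
    obtain ⟨c₁, h₁⟩ := exists_eq_smul_gen le_top hP (res _ hPA s)
    obtain ⟨c₂, h₂⟩ := exists_eq_smul_gen le_top hQ (res _ hQA s)
    -- The constant `c₂` extends to `A` and is invisible to the connecting map; only the jump
    -- between the components remains.
    have hs : s = (c₁ - c₂) • u + res _ inf_le_left (c₂ • res _ le_top (gen R (⊤ : Opens X))) := by
      rw [map_smul, res_res]
      apply hext
      · rw [h₁, map_add, map_smul, hu₁, map_smul, res_res, ← add_smul, sub_add_cancel]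
      · rw [h₂, map_add, map_smul, hu₂, map_smul, res_res, smul_zero, zero_add]
    refine ⟨c₁ - c₂, ?_⟩
    rw [hs, ofSec_add, ofSec_smul, Ext.mk₀_add, Ext.mk₀_smul, map_add, map_smul, mvδ_res, add_zero]
  · rw [← map_smul, ← Ext.mk₀_smul, ← ofSec_smul] at hr
    -- A multiple of `u` in the kernel is a difference of two constants, hence a constant; it
    -- vanishes on `Q`, so on `P` as well.
    obtain ⟨a, b, hz⟩ := exists_of_mvδ_eq_zero A B hr
    obtain ⟨a, rfl⟩ := exists_eq_smul_gen le_top hA a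
    obtain ⟨b, rfl⟩ := exists_eq_smul_gen le_top hB b
    rw [map_smul, map_smul, res_res, res_res, ← sub_smul] at hz
    have e₁ := congr(res _ hPA $hz)
    have e₂ := congr(res _ hQA $hz)
    rw [map_smul, hu₁, map_smul, res_res] at e₁
    rw [map_smul, hu₂, map_smul, res_res, smul_zero] at e₂
    rw [(isGen_res_gen le_top hQ hQ').smul_eq_zero e₂.symm, zero_smul] at e₁
    exact (isGen_res_gen le_top hP hP').smul_eq_zero e₁

end Annulus

/-! ### Cohomology of the punctured plane. -/

section Chart

variable {f : ℝ × ℝ → X} (hf : Topology.IsOpenEmbedding f)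

lemma constAcyclic_of_isBox {V : Opens X} (hV : IsBox hf V) : ConstAcyclic R V :=
  fun _ hn => subsingleton_ext_box_const hf hV hn

/-- The open positive half-line. -/
def pos : Opens ℝ := ⟨Set.Ioi 0, isOpen_Ioi⟩

/-- The open negative half-line. -/
def neg : Opens ℝ := ⟨Set.Iio 0, isOpen_Iio⟩

lemma ordConnected_pos : (pos : Set ℝ).OrdConnected := Set.ordConnected_Ioi
lemma ordConnected_neg : (neg : Set ℝ).OrdConnected := Set.ordConnected_Iio
lemma ordConnected_top : ((⊤ : Opens ℝ) : Set ℝ).OrdConnected := Set.ordConnected_univ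
lemma mem_pos {t : ℝ} : t ∈ pos ↔ 0 < t := Iff.rfl
lemma not_mem_pos_neg {t : ℝ} (h : t ∈ pos) (h' : t ∈ neg) : False :=
  lt_asymm (α := ℝ) h h'
lemma mem_neg {t : ℝ} : t ∈ neg ↔ t < 0 := Iff.rfl

include hf in
/-- The complement of the origin in a chart is preconnected; it has the expected cohomology. -/
lemma punctured_chart {V : Opens X} (hV : ∀ y, y ∈ V ↔ ∃ v, v ≠ 0 ∧ f v = y) :
    IsPreconnected (V : Set X) ∧
    (∃ ξ : Ext (FU R V) (FU R (⊤ : Opens X)) 1, IsGen R ξ) ∧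
    ∀ n, 2 ≤ n → Subsingleton (Ext (FU R V) (FU R (⊤ : Opens X)) n) := by
  -- The punctured plane is covered by four half-planes. The first three are added with a single
  -- rectangle as overlap each time, so their union is acyclic and connected; the last meets that
  -- union in two disjoint quadrants, which creates the class in degree one.
  let N := box hf ⊤ pos
  let E := box hf pos ⊤
  let S := box hf ⊤ neg
  let W := box hf neg ⊤
  let NW := box hf neg pos
  let SW := box hf neg neg
  have bN : IsBox hf N := isBox_box hf ordConnected_top ordConnected_pos
  have bE : IsBox hf E := isBox_box hf ordConnected_pos ordConnected_top
  have bS : IsBox hf S := isBox_box hf ordConnected_top ordConnected_neg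
  have bW : IsBox hf W := isBox_box hf ordConnected_neg ordConnected_top
  have bNW : IsBox hf NW := isBox_box hf ordConnected_neg ordConnected_pos
  have bSW : IsBox hf SW := isBox_box hf ordConnected_neg ordConnected_neg
  have bNE : IsBox hf (N ⊓ E) := isBox_inf hf bN bE
  have e₁ : (N ⊔ E) ⊓ S = box hf pos neg := by
    ext y
    constructor
    · rintro ⟨h, ⟨v, hv, rfl⟩⟩
      obtain h | h := h
      · exact (not_mem_pos_neg ((mem_box hf).1 h).2 hv.2).elim
      · exact (mem_box hf).2 ⟨((mem_box hf).1 h).1, hv.2⟩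
    · rintro ⟨v, hv, rfl⟩
      exact ⟨Or.inr ((mem_box hf).2 ⟨hv.1, trivial⟩), (mem_box hf).2 ⟨trivial, hv.2⟩⟩
  have e₂ : (N ⊔ E ⊔ S) ⊓ W = NW ⊔ SW := by
    ext y
    constructor
    · rintro ⟨h, ⟨v, hv, rfl⟩⟩
      obtain (h | h) | h := h
      · exact Or.inl ((mem_box hf).2 ⟨hv.1, ((mem_box hf).1 h).2⟩)
      · exact (not_mem_pos_neg ((mem_box hf).1 h).1 hv.1).elim
      · exact Or.inr ((mem_box hf).2 ⟨hv.1, ((mem_box hf).1 h).2⟩)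
    · rintro (⟨v, hv, rfl⟩ | ⟨v, hv, rfl⟩)
      · exact ⟨Or.inl (Or.inl ((mem_box hf).2 ⟨trivial, hv.2⟩)), (mem_box hf).2 ⟨hv.1, trivial⟩⟩
      · exact ⟨Or.inr ((mem_box hf).2 ⟨trivial, hv.2⟩), (mem_box hf).2 ⟨hv.1, trivial⟩⟩
  have e₃ : NW ⊓ SW = ⊥ := by
    ext y
    refine ⟨?_, fun h => h.elim⟩
    rintro ⟨⟨v, hv, rfl⟩, h⟩
    exact (not_mem_pos_neg hv.2 ((mem_box hf).1 h).2).elim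
  have e₄ : V = N ⊔ E ⊔ S ⊔ W := by
    ext y
    rw [SetLike.mem_coe, hV]
    constructor
    · rintro ⟨v, hv, rfl⟩
      obtain h | h | h := lt_trichotomy v.1 0
      · exact Or.inr ((mem_box hf).2 ⟨h, trivial⟩)
      · obtain h' | h' | h' := lt_trichotomy v.2 0
        · exact Or.inl (Or.inr ((mem_box hf).2 ⟨trivial, h'⟩))
        · exact absurd (Prod.ext h h') hv
        · exact Or.inl (Or.inl (Or.inl ((mem_box hf).2 ⟨trivial, h'⟩)))
      · exact Or.inl (Or.inl (Or.inr ((mem_box hf).2 ⟨h, trivial⟩)))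
    · rintro (((⟨v, hv, rfl⟩ | ⟨v, hv, rfl⟩) | ⟨v, hv, rfl⟩) | ⟨v, hv, rfl⟩) <;>
        refine ⟨v, fun h0 => ?_, rfl⟩ <;> subst h0
      · exact lt_irrefl (0 : ℝ) hv.2
      · exact lt_irrefl (0 : ℝ) hv.1
      · exact lt_irrefl (0 : ℝ) hv.2
      · exact lt_irrefl (0 : ℝ) hv.1
  have mem : ∀ {I J : Opens ℝ} (a b : ℝ), a ∈ I → b ∈ J → f (a, b) ∈ box hf I J :=
    fun a b ha hb => (mem_box hf).2 ⟨ha, hb⟩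
  have h1 : (1 : ℝ) ∈ pos := mem_pos.2 one_pos
  have h2 : (-1 : ℝ) ∈ neg := mem_neg.2 (by norm_num)
  have pV₁ : IsPreconnected ((N ⊔ E : Opens X) : Set X) :=
    (isPreconnected_of_isBox hf bN).union (f (1, 1)) (mem _ _ trivial h1) (mem _ _ h1 trivial)
      (isPreconnected_of_isBox hf bE)
  have pV₂ : IsPreconnected ((N ⊔ E ⊔ S : Opens X) : Set X) :=
    pV₁.union (f (1, -1)) (Or.inr (mem _ _ h1 trivial)) (mem _ _ trivial h2)
      (isPreconnected_of_isBox hf bS)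
  have pV : IsPreconnected ((N ⊔ E ⊔ S ⊔ W : Opens X) : Set X) :=
    pV₂.union (f (-1, -1)) (Or.inr (mem _ _ trivial h2)) (mem _ _ h2 trivial)
      (isPreconnected_of_isBox hf bW)
  have bES : IsBox hf (box hf pos neg) := isBox_box hf ordConnected_pos ordConnected_neg
  have aV₁ : ConstAcyclic R (N ⊔ E) := (constAcyclic_of_isBox hf bN).sup
    (constAcyclic_of_isBox hf bE) (constAcyclic_of_isBox hf bNE) (isPreconnected_of_isBox hf bNE)
  have aV₂ : ConstAcyclic R (N ⊔ E ⊔ S) := aV₁.sup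
    (constAcyclic_of_isBox hf bS) (by rw [e₁]; exact constAcyclic_of_isBox hf bES)
    (by rw [e₁]; exact isPreconnected_of_isBox hf bES)
  have aW := constAcyclic_of_isBox (R := R) hf bW
  have aI : ConstAcyclic R (NW ⊔ SW) := (constAcyclic_of_isBox hf bNW).sup_of_disjoint
    (constAcyclic_of_isBox hf bSW) e₃
  subst e₄
  refine ⟨pV, ?_, fun n hn => ?_⟩
  · exact exists_isGen_ext_one_sup e₂ e₃ pV₂ (isPreconnected_of_isBox hf bW)
      (isPreconnected_of_isBox hf bNW) (isPreconnected_of_isBox hf bSW)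
      ⟨_, mem _ _ h2 h1⟩ ⟨_, mem _ _ h2 h2⟩ aV₂ aW
  · obtain ⟨k, rfl⟩ := Nat.exists_eq_add_of_le hn
    exact subsingleton_ext_sup (n := 1 + k) (by lia) (by rw [e₂]; exact aI _ (by lia))
      (aV₂ _ (by lia)) (aW _ (by lia))

end Chart

/-! ### Cohomology of the sphere. -/

section Sphere

/-- The complement of a point. -/
def compl [T1Space X] (p : X) : Opens X := ⟨{p}ᶜ, isOpen_compl_singleton⟩

/-- A nonempty space in which the complement of every point is a plane. -/
class SphereLike (X : TopCat.{u}) : Prop extends T1Space X where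
  nonempty : Nonempty X
  exists_chart : ∀ p : X, ∃ f : ℝ × ℝ → X, Topology.IsOpenEmbedding f ∧ Set.range f = {p}ᶜ

variable [SphereLike X]

lemma exists_isBox_compl (p : X) :
    ∃ (f : ℝ × ℝ → X) (hf : Topology.IsOpenEmbedding f), IsBox hf (compl p) := by
  obtain ⟨f, hf, h⟩ := SphereLike.exists_chart p
  refine ⟨f, hf, ⊤, ⊤, ordConnected_top, ordConnected_top, ?_⟩
  ext y
  change y ∈ ({p}ᶜ : Set X) ↔ y ∈ f '' _
  rw [← h, Opens.coe_top, Set.univ_prod_univ, Set.image_univ]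

lemma constAcyclic_compl (p : X) : ConstAcyclic R (compl p) := by
  obtain ⟨f, hf, h⟩ := exists_isBox_compl p
  exact constAcyclic_of_isBox hf h

lemma isPreconnected_compl (p : X) : IsPreconnected (compl p : Set X) := by
  obtain ⟨f, hf, h⟩ := exists_isBox_compl p
  exact isPreconnected_of_isBox hf h

lemma nonempty_compl (p : X) : (compl p : Set X).Nonempty := by
  obtain ⟨f, hf, h⟩ := SphereLike.exists_chart p
  exact ⟨f 0, (h ▸ ⟨0, rfl⟩ : f 0 ∈ ({p}ᶜ : Set X))⟩

variable (R X)

/-- The sphere is the union of two point complements, both planes, whose overlap is a punctured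
plane. Its connectedness kills degree one, and the connecting map carries its generator in degree
one to a generator in degree two. -/
lemma ext_const_const : IsPreconnected (Set.univ : Set X) ∧
    Subsingleton (Ext (FU R (⊤ : Opens X)) (FU R (⊤ : Opens X)) 1) ∧
    (∃ ζ : Ext (FU R (⊤ : Opens X)) (FU R (⊤ : Opens X)) 2, IsGen R ζ) ∧
    ∀ n, 3 ≤ n → Subsingleton (Ext (FU R (⊤ : Opens X)) (FU R (⊤ : Opens X)) n) := by
  obtain ⟨q⟩ := SphereLike.nonempty (X := X)
  obtain ⟨f, hf, hq⟩ := SphereLike.exists_chart q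
  have e : compl (f 0) ⊔ compl q = ⊤ := by
    ext y
    refine ⟨fun _ => trivial, fun _ => ?_⟩
    by_cases h : y = q
    · exact Or.inl fun h' => (hq ▸ ⟨0, rfl⟩ : f 0 ∈ ({q}ᶜ : Set X)) (h' ▸ h)
    · exact Or.inr h
  obtain ⟨hp, ⟨ξ, hξ⟩, hn⟩ := punctured_chart (R := R) hf (V := compl (f 0) ⊓ compl q) (by
    intro y
    constructor
    · rintro ⟨h1, h2⟩
      have h3 : y ∈ Set.range f := by rw [hq]; exact h2
      obtain ⟨v, rfl⟩ := h3
      exact ⟨v, fun h => h1 (by rw [h]; rfl), rfl⟩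
    · rintro ⟨v, hv, rfl⟩
      exact ⟨fun h => hv (hf.injective h), by
        change f v ∈ ({q}ᶜ : Set X)
        rw [← hq]; exact ⟨v, rfl⟩⟩)
  have a₁ := constAcyclic_compl (R := R) (f 0)
  have a₂ := constAcyclic_compl (R := R) q
  -- The total space also occurs in the coefficient sheaf; generalizing replaces it by the union in
  -- the first argument only.
  suffices ∀ U : Opens X, U = compl (f 0) ⊔ compl q → IsPreconnected (U : Set X) ∧
    Subsingleton (Ext (FU R U) (FU R (⊤ : Opens X)) 1) ∧
    (∃ ζ : Ext (FU R U) (FU R (⊤ : Opens X)) 2, IsGen R ζ) ∧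
    ∀ n, 3 ≤ n → Subsingleton (Ext (FU R U) (FU R (⊤ : Opens X)) n) by
    simpa using this ⊤ e.symm
  rintro U rfl
  refine ⟨?_, subsingleton_ext_one_sup (surjective_res_of_isPreconnected _ hp) (a₁ 1 le_rfl)
    (a₂ 1 le_rfl), ⟨_, hξ.of_bijective _ (mvδ_bijective _ _ _
      (by lia : 1 + 1 = 2) (a₁ 1 le_rfl) (a₂ 1 le_rfl) (a₁ 2 (by lia)) (a₂ 2 (by lia)))⟩, fun n hn' => ?_⟩
  · refine (isPreconnected_compl (f 0)).union (f 1) (fun h => ?_) ?_ (isPreconnected_compl q)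
    · exact one_ne_zero (hf.injective h)
    · change f 1 ∈ ({q}ᶜ : Set X)
      rw [← hq]; exact ⟨1, rfl⟩
  · obtain ⟨k, rfl⟩ := Nat.exists_eq_add_of_le hn'
    exact subsingleton_ext_sup (n := 2 + k) (by lia) (hn _ (by lia)) (a₁ _ (by lia))
      (a₂ _ (by lia))

end Sphere

end ModSheaf

namespace ModSheaf
open Abelian
variable {R : Type u} [CommRing R] {X : TopCat.{u}}

lemma subsingleton_ext_zero {F G : ModSheaf R X} (h : ∀ φ : F ⟶ G, φ = 0) :
    Subsingleton (Ext F G 0) := by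
  refine subsingleton_of_forall_eq 0 fun x => ?_
  obtain ⟨φ, rfl⟩ := (Ext.mk₀_bijective _ _).2 x
  rw [h φ, Ext.mk₀_zero]

/-! ### Ext groups between skyscrapers. -/

section Skyscraper

variable (R)

lemma surjective_res_skyscraper (x : X) {V U : Opens X} (h : V ≤ U) :
    Function.Surjective (res (skyscraper R x) h) := by
  by_cases hx : x ∈ V
  · exact (bijective_res_skyscraper R x h hx).2
  · have := subsingleton_sec_skyscraper R x hx
    exact fun s => ⟨0, Subsingleton.elim _ _⟩

lemma subsingleton_ext_FU_skyscraper (V : Opens X) (x : X) {n : ℕ} (hn : 1 ≤ n) :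
    Subsingleton (Ext (FU R V) (skyscraper R x) n) :=
  subsingleton_of_forall_eq 0 (ext_eq_zero_of_isLifting (isLifting_le V) le_rfl hn
    fun _ _ h _ _ => surjective_res_skyscraper R x h)

lemma isGen_toSky {x : X} {V : Opens X} (hx : x ∈ V) : IsGen R (toSky R x V) := by
  rw [isGen_toSec, app_toSky_gen]
  exact bijective_smul_skyGen R x hx

variable [T1Space X]

lemma FUmap_compl_toSky (x : X) : FUmap R (le_top : compl x ≤ ⊤) ≫ toSky R x ⊤ = 0 := by
  rw [FUmap_toSky]
  exact hom_skyscraper_eq_zero R (fun h : x ∈ compl x => h rfl) _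

/-- The short exact sequence `FU R {x}ᶜ ⟶ FU R ⊤ ⟶ skyscraper R x`. -/
noncomputable def skySeq (x : X) : ShortComplex (ModSheaf R X) :=
  ShortComplex.mk (FUmap R (le_top : compl x ≤ ⊤)) (toSky R x ⊤)
    (FUmap_compl_toSky R x)

lemma skySeq_shortExact (x : X) : (skySeq R x).ShortExact :=
  shortExact_point le_top trivial fun _ => ⟨fun h => ⟨trivial, h⟩, fun h => h.2⟩

instance epi_toSky (x : X) : Epi (toSky R x ⊤) := (skySeq_shortExact R x).epi_g

/-- Such a map is a global section of the skyscraper at `y` that vanishes off `x`; but the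
complement of `x` contains `y`, so restriction to it loses nothing. -/
lemma hom_skyscraper_skyscraper {x y : X} (hxy : x ≠ y)
    (φ : skyscraper R x ⟶ skyscraper R y) : φ = 0 := by
  rw [← cancel_epi (toSky R x ⊤), comp_zero]
  apply FU_hom_ext
  apply (bijective_res_skyscraper R y (le_top : compl x ≤ ⊤) hxy.symm).1
  rw [← app_FUmap_comp, ← Category.assoc, FUmap_compl_toSky, zero_comp, app_zero, app_zero,
    map_zero]

lemma isGen_id_skyscraper (x : X) : IsGen R (𝟙 (skyscraper R x)) := by
  have h := isGen_toSky R (x := x) (V := ⊤) trivial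
  refine isGen_of (fun φ => ?_) fun r hr => ?_
  · obtain ⟨r, hr⟩ := h.2 (toSky R x ⊤ ≫ φ)
    refine ⟨r, ?_⟩
    rw [← cancel_epi (toSky R x ⊤), ← hr, Linear.comp_smul, Category.comp_id]
  · apply h.smul_eq_zero
    rw [← Category.comp_id (toSky R x ⊤), ← Linear.comp_smul, hr, comp_zero]

/-- Skyscrapers are flasque, hence acyclic on every open set. In `skySeq` this settles degrees at
least two; in degree one, sections over the complement of `x` extend globally. -/
lemma subsingleton_ext_skyscraper (x y : X) {n : ℕ} (hn : 1 ≤ n) :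
    Subsingleton (Ext (skyscraper R x) (skyscraper R y) n) := by
  obtain rfl | hn' := hn.eq_or_lt
  · refine (skySeq_shortExact R x).ext_X₃ (add_zero 1) (fun z => ?_)
      (subsingleton_ext_FU_skyscraper R ⊤ y le_rfl)
    obtain ⟨s, rfl⟩ := exists_eq_mk₀_ofSec (F := skyscraper R y) (U := compl x) z
    obtain ⟨t, rfl⟩ := surjective_res_skyscraper R y (le_top : compl x ≤ ⊤) s
    refine ⟨Ext.mk₀ (ofSec t), (Ext.mk₀_comp_mk₀ _ _).trans (congrArg _ ?_)⟩
    exact FU_hom_ext ((app_FUmap_comp _ _).trans (by rw [app_ofSec_gen, app_ofSec_gen]))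
  · obtain ⟨k, rfl⟩ := Nat.exists_eq_add_of_lt hn'
    exact (skySeq_shortExact R x).ext_X₃' (n := k + 1) (by lia)
      (subsingleton_ext_FU_skyscraper R _ y (by lia)) (subsingleton_ext_FU_skyscraper R _ y (by lia))

end Skyscraper

/-! ### Ext groups between skyscrapers and the constant sheaf. -/

section SphereLike

variable [SphereLike X]

lemma isGen_id_const : IsGen R (𝟙 (FU R (⊤ : Opens X))) := by
  rw [isGen_toSec, app_id]
  have := isGen_res_gen (R := R) (le_refl (⊤ : Opens X)) (ext_const_const R X).1
    (by obtain ⟨p⟩ := SphereLike.nonempty (X := X); exact ⟨p, trivial⟩)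
  rwa [res_refl] at this

lemma subsingleton_ext_const_const {n : ℕ} (h0 : n ≠ 0) (h2 : n ≠ 2) :
    Subsingleton (Ext (FU R (⊤ : Opens X)) (FU R (⊤ : Opens X)) n) := by
  obtain rfl | h : n = 1 ∨ 3 ≤ n := by lia
  · exact (ext_const_const R X).2.1
  · exact (ext_const_const R X).2.2.2 n h

/-- The complement of `x` is a plane, acyclic in degrees one and two, so all of the second
cohomology of the sphere is supported at `x`. This normalizes β_i against ω, and places ω at an
arbitrary point. -/
lemma bijective_extPrecomp_toSky (x : X) :
    Function.Bijective (extPrecomp (FU R (⊤ : Opens X)) (toSky R x ⊤) 2) :=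
  bijective_extPrecomp (skySeq_shortExact R x) _ (by lia : 1 + 1 = 2)
    (constAcyclic_compl x 1 le_rfl) (constAcyclic_compl x 2 (by lia))

/-- In degree zero a map would be a constant vanishing off `x`. In degree one, constants on the
connected complement extend globally. Above degree two both neighbours in the long exact sequence
vanish. -/
lemma subsingleton_ext_skyscraper_const (x : X) {n : ℕ} (hn : n ≠ 2) :
    Subsingleton (Ext (skyscraper R x) (FU R (⊤ : Opens X)) n) := by
  obtain rfl | rfl | h : n = 0 ∨ n = 1 ∨ 3 ≤ n := by lia
  · refine subsingleton_ext_zero fun φ => ?_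
    rw [← cancel_epi (toSky R x ⊤), comp_zero]
    obtain ⟨r, hr⟩ := (isGen_id_const (R := R) (X := X)).2 (toSky R x ⊤ ≫ φ)
    have h0 : r • res _ le_top (gen R (⊤ : Opens X)) = (0 : Sec (FU R (⊤ : Opens X)) (compl x)) := by
      have h := congr(app $(FUmap_compl_toSky R x =≫ φ) _ (gen R _))
      rw [Category.assoc, zero_comp] at h
      rw [← hr, app_FUmap_comp, app_smul, app_id, map_smul] at h
      exact h
    obtain ⟨y, hy⟩ := nonempty_compl x
    rw [← hr, gen_smul_eq_zero le_top r y hy h0]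
    exact zero_smul R (𝟙 (FU R (⊤ : Opens X)))
  · refine (skySeq_shortExact R x).ext_X₃ (add_zero 1) (fun z => ?_)
      (subsingleton_ext_const_const one_ne_zero (by lia))
    obtain ⟨s, rfl⟩ := exists_eq_mk₀_ofSec (F := FU R (⊤ : Opens X)) (U := compl x) z
    obtain ⟨t, rfl⟩ := surjective_res_of_isPreconnected (R := R) (le_top : compl x ≤ ⊤)
      (isPreconnected_compl x) s
    refine ⟨Ext.mk₀ (ofSec t), (Ext.mk₀_comp_mk₀ _ _).trans (congrArg _ ?_)⟩
    exact FU_hom_ext ((app_FUmap_comp _ _).trans (by rw [app_ofSec_gen, app_ofSec_gen]))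
  · obtain ⟨k, rfl⟩ := Nat.exists_eq_add_of_le h
    exact (skySeq_shortExact R x).ext_X₃' (n := 2 + k) (by lia)
      (constAcyclic_compl x _ (by lia)) (subsingleton_ext_const_const (by lia) (by lia))

end SphereLike

end ModSheaf

/-! ### The hemisphere sequence and the class ζ. -/

/-- A chart of the space in which the lower half-plane is the exterior of the upper half-plane, and
such that the upper half-plane is locally connected at every point outside the lower one. -/
structure Hemisphere (X : TopCat.{u}) where
  f : ℝ × ℝ → X
  isOpenEmbedding : Topology.IsOpenEmbedding f
  le_iff : ∀ V : Opens X, V ≤ ModSheaf.box isOpenEmbedding ⊤ ModSheaf.neg ↔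
    V ⊓ ModSheaf.box isOpenEmbedding ⊤ ModSheaf.pos = ⊥
  exists_isPreconnected : ∀ y ∉ ModSheaf.box isOpenEmbedding ⊤ ModSheaf.neg, ∀ V : Opens X, y ∈ V →
    ∃ N ≤ V, y ∈ N ∧
      IsPreconnected ((N ⊓ ModSheaf.box isOpenEmbedding ⊤ ModSheaf.pos : Opens X) : Set X)

namespace Hemisphere
open Abelian ModSheaf
variable {X : TopCat.{u}} (E : Hemisphere X) (R : Type u) [CommRing R]

/-- The lower half-plane. -/
def lower : Opens X := box E.isOpenEmbedding ⊤ neg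

/-- The upper half-plane. -/
def upper : Opens X := box E.isOpenEmbedding ⊤ pos

lemma isBox_lower : IsBox E.isOpenEmbedding E.lower :=
  isBox_box _ ordConnected_top ordConnected_neg

lemma isBox_upper : IsBox E.isOpenEmbedding E.upper :=
  isBox_box _ ordConnected_top ordConnected_pos

/-- The constant sheaf supported on the closure of the upper half-plane. -/
noncomputable def Z : ModSheaf R X := restrictSheaf (FU R ⊤) E.upper

/-- The restriction map from the constant sheaf. -/
noncomputable def toZ : FU R (⊤ : Opens X) ⟶ E.Z R := toRestrict _ _

lemma FUmap_toZ : FUmap R (le_top : E.lower ≤ ⊤) ≫ E.toZ R = 0 := by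
  have := subsingleton_sec_bot (FU R (⊤ : Opens X)) (V := E.lower ⊓ E.upper)
    ((E.le_iff E.lower).1 le_rfl)
  exact FU_hom_ext (this.elim _ _)

/-- The short exact sequence `FU R D ⟶ FU R ⊤ ⟶ Z`, for `D` the lower half-plane. -/
noncomputable def seq : ShortComplex (ModSheaf R X) :=
  ShortComplex.mk (FUmap R (le_top : E.lower ≤ ⊤)) (E.toZ R) (E.FUmap_toZ R)

lemma seq_shortExact : (E.seq R).ShortExact := by
  refine shortExact_restrict E.le_iff fun y hy V hV => ?_
  obtain ⟨N, hN, hyN, h⟩ := E.exists_isPreconnected y hy V hV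
  exact ⟨N, hN, hyN, surjective_res_of_isPreconnected _ h⟩

instance epi_toZ : Epi (E.toZ R) := (E.seq_shortExact R).epi_g

lemma subsingleton_sec_Z {V : Opens X} (hV : V ≤ E.lower) : Subsingleton (Sec (E.Z R) V) :=
  subsingleton_sec_bot (FU R (⊤ : Opens X)) ((E.le_iff V).1 hV)

/-- `Z` has no sections inside the lower half-plane, so the flasque criterion applies trivially
there. -/
lemma subsingleton_ext_FU_Z {V : Opens X} (hV : V ≤ E.lower) (n : ℕ) :
    Subsingleton (Ext (FU R V) (E.Z R) n) := by
  obtain rfl | hn := Nat.eq_zero_or_pos n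
  · have := E.subsingleton_sec_Z R hV
    exact subsingleton_ext_zero fun φ => FU_hom_ext (Subsingleton.elim _ _)
  · refine subsingleton_of_forall_eq 0 (ext_eq_zero_of_isLifting (isLifting_le E.lower) hV hn
      fun A B h hA hB s => ?_)
    have := E.subsingleton_sec_Z R hA
    exact ⟨0, Subsingleton.elim _ _⟩

/-- In the hemisphere sequence, `Z` contributes nothing over the lower half-plane, and the constant
sheaf is acyclic there because it is a rectangle. -/
lemma subsingleton_ext_lower_lower {n : ℕ} (hn : 1 ≤ n) :
    Subsingleton (Ext (FU R E.lower) (FU R E.lower) n) := by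
  obtain ⟨k, rfl⟩ := Nat.exists_eq_add_of_le hn
  exact (E.seq_shortExact R).ext_X₁ (add_comm k 1) (E.subsingleton_ext_FU_Z R le_rfl k)
    (subsingleton_ext_box_const _ E.isBox_lower (by lia))

lemma bijective_res_Z (N : Opens X) :
    Function.Bijective (res (E.Z R) (inf_le_left : N ⊓ E.upper ≤ N)) := by
  have key : ∀ (A B : Opens X) (h : A ≤ B), A = B →
      Function.Bijective (res (FU R (⊤ : Opens X)) h) := by
    rintro A B h rfl
    convert Function.bijective_id
    ext s
    exact res_refl _ _
  exact key ((N ⊓ E.upper) ⊓ E.upper) (N ⊓ E.upper) _ (by rw [inf_assoc, inf_idem])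

/-- Sections of `Z` depend only on the trace on the upper half-plane, so lifting can be done over
that half-plane first and then extended. There rectangles meet the half-plane in connected sets, and
the rectangle criterion applies. -/
lemma subsingleton_ext_one_Z {V : Opens X} (hV : E.upper ≤ V) :
    Subsingleton (Ext (FU R V) (E.Z R) 1) := by
  refine subsingleton_of_forall_eq 0
    (ext_one_eq_zero_of_bijective_res (U := E.upper) (fun N _ => E.bijective_res_Z R N) ?_)
  rw [inf_eq_right.2 hV]
  refine ext_eq_zero_of_isLifting (isLifting_isBox E.isOpenEmbedding) E.isBox_upper le_rfl ?_
  intro A B h hA hB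
  exact surjective_res_of_isPreconnected (inf_le_inf_right E.upper h)
    (isPreconnected_of_isBox E.isOpenEmbedding (isBox_inf _ hA E.isBox_upper))

variable [SphereLike X]

/-- Since `x` is not in the upper half-plane, its complement contains that half-plane; then Ext¹
into `Z` and Ext² into the constant sheaf both vanish. -/
lemma subsingleton_ext_compl_lower {x : X} (hx : x ∉ E.upper) :
    Subsingleton (Ext (FU R (compl x)) (FU R E.lower) 2) :=
  (E.seq_shortExact R).ext_X₁ (by lia : 1 + 1 = 2)
    (E.subsingleton_ext_one_Z R fun _ hy e => hx (e ▸ hy)) (constAcyclic_compl x 2 (by lia))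

section Eval

variable {x : X} (hx : x ∉ E.lower)

/-- Evaluation at a point outside the lower half-plane. -/
noncomputable def evalZ : E.Z R ⟶ skyscraper R x :=
  (E.seq_shortExact R).gIsCokernel.desc (CokernelCofork.ofπ (toSky R x ⊤) (by
    exact hom_skyscraper_eq_zero R hx _))

@[simp] lemma toZ_evalZ : E.toZ R ≫ E.evalZ R hx = toSky R x ⊤ :=
  Cofork.IsColimit.π_desc (E.seq_shortExact R).gIsCokernel

instance epi_evalZ : Epi (E.evalZ R hx) := by
  have : Epi (E.toZ R ≫ E.evalZ R hx) := by rw [toZ_evalZ]; infer_instance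
  exact epi_of_epi (E.toZ R) _

/-- The subsheaf of sections vanishing at `x`. -/
noncomputable def kerEval : ModSheaf R X := kernel (E.evalZ R hx)

/-- The inclusion of the subsheaf of sections vanishing at `x`. -/
noncomputable def kerEvalι : E.kerEval R hx ⟶ E.Z R := kernel.ι _

instance : Mono (E.kerEvalι R hx) := inferInstanceAs (Mono (kernel.ι _))

lemma kerEvalι_evalZ : E.kerEvalι R hx ≫ E.evalZ R hx = 0 := kernel.condition _

lemma evalSeq_shortExact :
    (ShortComplex.mk (E.kerEvalι R hx) (E.evalZ R hx) (E.kerEvalι_evalZ R hx)).ShortExact where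
  exact := ShortComplex.exact_of_f_is_kernel _ (kernelIsKernel _)
  mono_f := inferInstanceAs (Mono (E.kerEvalι R hx))
  epi_g := inferInstanceAs (Epi (E.evalZ R hx))

/-- The map from the sheaf freely generated over the complement of `x`. -/
noncomputable def toKerEval : FU R (compl x) ⟶ E.kerEval R hx :=
  kernel.lift _ (FUmap R le_top ≫ E.toZ R) (by
    rw [Category.assoc, toZ_evalZ, FUmap_compl_toSky])

lemma toKerEval_ι : E.toKerEval R hx ≫ E.kerEvalι R hx = FUmap R le_top ≫ E.toZ R :=
  kernel.lift_ι _ _ _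

include hx in
lemma lower_le_compl : E.lower ≤ compl x := fun _ hy e => hx (e ▸ hy)

/-- The third isomorphism theorem: `Z` and the skyscraper are quotients of the constant sheaf by the
free sheaves on the lower half-plane and on the complement of `x`, so the kernel of evaluation is
the quotient of the second by the first. -/
lemma kerEvalSeq_shortExact :
    (ShortComplex.mk (FUmap R (E.lower_le_compl hx)) (E.toKerEval R hx) (by
      rw [← cancel_mono (E.kerEvalι R hx), Category.assoc, toKerEval_ι, ← Category.assoc,
        FUmap_FUmap, FUmap_toZ, zero_comp])).ShortExact := by
  refine shortExact_of_sections _ _ _ (app_FUmap_injective _) ?_ ?_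
  · intro V s hs y hy
    refine ⟨V, le_rfl, hy, ?_⟩
    obtain ⟨t, ht⟩ : ∃ t : Sec (FU R E.lower) V,
        app (FUmap R le_top) V t = app (FUmap R (le_top : compl x ≤ ⊤)) V s :=
      exact_sections (E.seq_shortExact R) (V := V)
      (s := app (FUmap R (le_top : compl x ≤ ⊤)) V s) (by
        have := congr(app $(E.toKerEval_ι R hx) V s)
        rw [app_comp, app_comp, hs, map_zero] at this
        exact this.symm)
    refine ⟨t, app_FUmap_injective le_top V ?_⟩
    rw [res_refl, ← ht, ← app_comp, FUmap_FUmap]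
  · intro V s y hy
    obtain ⟨N, hN, hyN, t, ht⟩ := (epi_iff_locally (E.toZ R)).1 inferInstance V
      (app (E.kerEvalι R hx) V s) y hy
    refine ⟨N, hN, hyN, ?_⟩
    obtain ⟨k, hk⟩ : ∃ k : Sec (FU R (compl x)) N, app (FUmap R le_top) N k = t :=
      exact_sections (skySeq_shortExact R x) (V := N) (s := t) (by
      change app (toSky R x ⊤) N t = 0
      rw [← E.toZ_evalZ R hx, app_comp, ht, app_res, ← app_comp, kerEvalι_evalZ, app_zero,
        map_zero])
    refine ⟨k, (mono_iff_injective (E.kerEvalι R hx)).1 inferInstance N ?_⟩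
    rw [← app_comp, toKerEval_ι, app_comp, app_res, ← ht, hk]

/-- This is the group containing the obstruction to extending ζ from `Z` to the skyscraper at `x`.
It needs `x` on neither side, that is, on the common boundary. -/
lemma subsingleton_ext_kerEval (hx' : x ∉ E.upper) :
    Subsingleton (Ext (E.kerEval R hx) (FU R E.lower) 2) :=
  (E.kerEvalSeq_shortExact R hx).ext_X₃' (by lia : 1 + 1 = 2)
    (E.subsingleton_ext_lower_lower R le_rfl) (E.subsingleton_ext_compl_lower R hx')

end Eval

/-- The skyscraper is resolved by free sheaves on subsets of the lower half-plane, where all Ext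
groups into `Z` vanish. -/
lemma subsingleton_ext_skyscraper_Z {x : X} (hx : x ∈ E.lower) :
    Subsingleton (Ext (skyscraper R x) (E.Z R) 2) :=
  (shortExact_point (R := R) (inf_le_left : E.lower ⊓ compl x ≤ E.lower) hx
    fun _ => Iff.rfl).ext_X₃' (by lia : 1 + 1 = 2) (E.subsingleton_ext_FU_Z R inf_le_left 1)
    (E.subsingleton_ext_FU_Z R le_rfl 2)

/-- A class in `Ext² (Z, FU R D)` which induces a generator of `Ext²` of the constant sheaf. -/
lemma exists_isGen : ∃ ζ : Ext (E.Z R) (FU R E.lower) 2,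
    IsGen R ((Ext.mk₀ (E.toZ R)).comp (ζ.comp (Ext.mk₀ (FUmap R le_top)) (add_zero 2))
      (zero_add 2) : Ext (FU R (⊤ : Opens X)) (FU R (⊤ : Opens X)) 2) := by
  obtain ⟨ξ, hξ⟩ := (ext_const_const R X).2.2.1
  -- Any point of the lower half-plane serves: the generator is concentrated there, away from the
  -- support of `Z`.
  have hp : E.f (0, -1) ∈ E.lower :=
    (mem_box E.isOpenEmbedding).2 ⟨trivial, show (-1 : ℝ) < 0 by norm_num⟩
  obtain ⟨η, rfl⟩ := (bijective_extPrecomp_toSky (R := R) (E.f (0, -1))).2 ξ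
  -- The coefficients are lifted to the subsheaf on the lower half-plane because there is no Ext²
  -- from this skyscraper into `Z`.
  obtain ⟨η', rfl⟩ : ∃ η' : Ext (skyscraper R (E.f (0, -1))) (FU R E.lower) 2,
      η'.comp (Ext.mk₀ (FUmap R le_top)) (add_zero 2) = η := Ext.covariant_sequence_exact₂ _ (E.seq_shortExact R) η
    ((E.subsingleton_ext_skyscraper_Z R hp).elim _ _)
  -- The class descends from the constant sheaf to `Z` because its restriction to the lower
  -- half-plane lies in a vanishing Ext².
  obtain ⟨ζ, hζ⟩ : ∃ ζ : Ext (E.Z R) (FU R E.lower) 2, (Ext.mk₀ (E.toZ R)).comp ζ (zero_add 2) =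
      (Ext.mk₀ (toSky R (E.f (0, -1)) ⊤)).comp η' (zero_add 2) := Ext.contravariant_sequence_exact₂ (E.seq_shortExact R) (FU R E.lower)
    ((Ext.mk₀ (toSky R (E.f (0, -1)) ⊤)).comp η' (zero_add 2))
    ((E.subsingleton_ext_lower_lower R (by lia)).elim _ _)
  refine ⟨ζ, ?_⟩
  rw [← Ext.comp_assoc _ _ _ (zero_add 2) (add_zero 2) (by lia), hζ,
    Ext.comp_assoc _ _ _ (zero_add 2) (add_zero 2) (by lia)]
  exact hξ

end Hemisphere

/-! ### Quasi-isomorphisms on representatives; dg bimodules. -/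

namespace DGModule

variable {R : Type u} [CommRing R] {M : DGModule.{u, v} R} {N : DGModule.{u, w} R}

lemma mk_eq_zero_iff {n : ℤ} {x : M.cocycles n} :
    (Submodule.Quotient.mk x : M.H n) = 0 ↔ x.1 ∈ M.coboundaries n :=
  Submodule.Quotient.mk_eq_zero _

lemma mk_eq_iff {n : ℤ} {x y : M.cocycles n} :
    (Submodule.Quotient.mk x : M.H n) = Submodule.Quotient.mk y ↔
      x.1 - y.1 ∈ M.coboundaries n :=
  Submodule.Quotient.eq _

lemma Hom.isQuasiIso_of (φ : Hom M N)
    (hi : ∀ n, ∀ x ∈ M.cocycles n, φ.f n x ∈ N.coboundaries n → x ∈ M.coboundaries n)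
    (hs : ∀ n, ∀ y ∈ N.cocycles n, ∃ x ∈ M.cocycles n, y - φ.f n x ∈ N.coboundaries n) :
    φ.IsQuasiIso := by
  intro n
  constructor
  · rw [injective_iff_map_eq_zero]
    intro x hx
    obtain ⟨x, rfl⟩ := Submodule.Quotient.mk_surjective _ x
    exact mk_eq_zero_iff.2 (hi n x.1 x.2 (mk_eq_zero_iff.1 hx))
  · intro y
    obtain ⟨y, rfl⟩ := Submodule.Quotient.mk_surjective _ y
    obtain ⟨x, hx, h⟩ := hs n y.1 y.2
    exact ⟨Submodule.Quotient.mk ⟨x, hx⟩, (mk_eq_iff.2 h).symm⟩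

lemma Hom.IsQuasiIso.mem_coboundaries {φ : Hom M N} (h : φ.IsQuasiIso) {n : ℤ} {x : M.X n}
    (hx : x ∈ M.cocycles n) (hx' : φ.f n x ∈ N.coboundaries n) : x ∈ M.coboundaries n := by
  have := (injective_iff_map_eq_zero _).1 (h n).1 (Submodule.Quotient.mk ⟨x, hx⟩)
    (mk_eq_zero_iff.2 hx')
  exact mk_eq_zero_iff.1 this

lemma Hom.IsQuasiIso.exists_sub_mem {φ : Hom M N} (h : φ.IsQuasiIso) {n : ℤ} {y : N.X n}
    (hy : y ∈ N.cocycles n) : ∃ x ∈ M.cocycles n, y - φ.f n x ∈ N.coboundaries n := by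
  obtain ⟨x, hx⟩ := (h n).2 (Submodule.Quotient.mk ⟨y, hy⟩)
  obtain ⟨x, rfl⟩ := Submodule.Quotient.mk_surjective _ x
  exact ⟨x.1, x.2, mk_eq_iff.1 hx.symm⟩

end DGModule

namespace DGBimodule

open DGModule

variable {R : Type u} [CommRing R] {A B : DGAlgebra.{u, v} R} (M : DGBimodule A B)

lemma lact_mem_coboundaries {i j k : ℤ} (h : i + j = k) {a : A.X i} {m : M.X j}
    (ha : a ∈ A.cocycles i) (hm : m ∈ M.coboundaries j) : M.lact h a m ∈ M.coboundaries k := by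
  obtain ⟨y, rfl⟩ := (mem_coboundaries (sub_add_cancel j 1)).1 hm
  rw [mem_cocycles rfl] at ha
  refine (mem_coboundaries (sub_add_cancel k 1)).2 ⟨i.negOnePow • M.lact (by lia) a y, ?_⟩
  rw [Units.smul_def, map_zsmul, ← Units.smul_def,
    M.d_lact (j' := j) _ rfl (by lia) _ (by lia) h, ha, map_zero, LinearMap.zero_apply,
    zero_add, smul_smul, Int.units_mul_self, one_smul]

lemma ract_mem_coboundaries {i j k : ℤ} (h : i + j = k) {m : M.X i} {b : B.X j}
    (hm : m ∈ M.coboundaries i) (hb : b ∈ B.cocycles j) : M.ract h m b ∈ M.coboundaries k := by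
  obtain ⟨y, rfl⟩ := (mem_coboundaries (sub_add_cancel i 1)).1 hm
  rw [mem_cocycles rfl] at hb
  refine (mem_coboundaries (sub_add_cancel k 1)).2 ⟨M.ract (by lia) y b, ?_⟩
  rw [M.d_ract (i' := i) _ (by lia) rfl _ h (by lia), hb]
  simp

lemma lact_mem_coboundaries_left {i j k : ℤ} (h : i + j = k) {a : A.X i} {m : M.X j}
    (ha : a ∈ A.coboundaries i) (hm : m ∈ M.cocycles j) : M.lact h a m ∈ M.coboundaries k := by
  obtain ⟨y, rfl⟩ := (mem_coboundaries (sub_add_cancel i 1)).1 ha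
  rw [mem_cocycles rfl] at hm
  refine (mem_coboundaries (sub_add_cancel k 1)).2 ⟨M.lact (by lia) y m, ?_⟩
  rw [M.d_lact (i' := i) _ (by lia) rfl _ h (by lia), hm]
  simp

lemma lact_mem_cocycles {i j k : ℤ} (h : i + j = k) {a : A.X i} {m : M.X j}
    (ha : a ∈ A.cocycles i) (hm : m ∈ M.cocycles j) : M.lact h a m ∈ M.cocycles k := by
  rw [mem_cocycles rfl] at ha hm ⊢
  rw [M.d_lact h rfl rfl rfl (by lia) (by lia), ha, hm]
  simp

lemma ract_mem_cocycles {i j k : ℤ} (h : i + j = k) {m : M.X i} {b : B.X j}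
    (hm : m ∈ M.cocycles i) (hb : b ∈ B.cocycles j) : M.ract h m b ∈ M.cocycles k := by
  rw [mem_cocycles rfl] at hb hm ⊢
  rw [M.d_ract h rfl rfl rfl (by lia) (by lia), hb, hm]
  simp

/-- Restriction of the right action along a morphism of algebras with zero differentials. -/
def restrictRight {B' : DGAlgebra.{u, v} R} (hB : ∀ i j h, B.d i j h = 0)
    (hB' : ∀ i j h, B'.d i j h = 0) (ψ : ∀ n, B'.X n →ₗ[R] B.X n) (hone : ψ 0 B'.one = B.one)
    (hmul : ∀ {i j k : ℤ} (h : i + j = k) (x : B'.X i) (y : B'.X j),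
      ψ k (B'.mul h x y) = B.mul h (ψ i x) (ψ j y)) : DGBimodule A B' where
  toDGModule := M.toDGModule
  lact := M.lact
  ract h := (M.ract h).compl₂ (ψ _)
  one_lact := M.one_lact
  ract_one m := by simp [hone, M.ract_one]
  mul_lact := M.mul_lact
  ract_mul hij hjk h h' m b b' := by simp [hmul hjk, M.ract_mul hij hjk h h']
  lact_ract hij hjk h h' a m b := M.lact_ract hij hjk h h' a m _
  d_lact := M.d_lact
  d_ract h hi hj hk h₁ h₂ m b := by
    have := M.d_ract h hi hj hk h₁ h₂ m (ψ _ b)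
    rw [hB] at this
    simpa [hB'] using this

end DGBimodule

/-! ### Formality from a model with zero differential. -/

namespace DGAlgebra

open DGModule

variable {R : Type u} [CommRing R] {A B : DGAlgebra.{u, v} R}

lemma one_mem_cocycles (A : DGAlgebra.{u, v} R) : A.one ∈ A.cocycles 0 :=
  (mem_cocycles (zero_add 1)).2 A.d_one

lemma mem_cocycles_of_d_eq_zero (hB : ∀ i j h, B.d i j h = 0) {n : ℤ} (b : B.X n) :
    b ∈ B.cocycles n := by
  rw [mem_cocycles rfl, hB]; rfl

lemma eq_zero_of_mem_coboundaries (hB : ∀ i j h, B.d i j h = 0) {n : ℤ} {b : B.X n}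
    (hb : b ∈ B.coboundaries n) : b = 0 := by
  obtain ⟨y, rfl⟩ := (mem_coboundaries (sub_add_cancel n 1)).1 hb
  rw [hB]; rfl

/-- A dg algebra which is quasi-equivalent to one with zero differential is formal. -/
theorem QuasiEquivalent.isFormal (h : QuasiEquivalent A B) (hB : ∀ i j h, B.d i j h = 0) :
    A.IsFormal := by
  obtain ⟨M, c, hc, hl, hr⟩ := h
  have hcc : c ∈ M.cocycles 0 := (mem_cocycles (zero_add 1)).2 hc
  -- `a` and `b` are related when `a • c` and `c • b` are cohomologous. On cocycles this is the
  -- graph of an algebra isomorphism from the cohomology of `A` to `B`.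
  let Rel : ∀ n, A.X n → B.X n → Prop := fun n a b =>
    M.lact (add_zero n) a c - M.ract (zero_add n) c b ∈ M.coboundaries n
  have hb : ∀ {n} (b : B.X n), b ∈ B.cocycles n := fun b => mem_cocycles_of_d_eq_zero hB b
  have ex₁ : ∀ n, ∀ a ∈ A.cocycles n, ∃ b, Rel n a b := fun n a ha => by
    obtain ⟨b, -, h⟩ := hr.exists_sub_mem (M.lact_mem_cocycles (add_zero n) ha hcc)
    exact ⟨b, h⟩
  have ex₂ : ∀ n (b : B.X n), ∃ a ∈ A.cocycles n, Rel n a b := fun n b => by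
    obtain ⟨a, ha, h⟩ := hl.exists_sub_mem (M.ract_mem_cocycles (zero_add n) hcc (hb b))
    refine ⟨a, ha, ?_⟩
    have := neg_mem h
    rwa [neg_sub] at this
  have rel_sub : ∀ {n a b a' b'}, Rel n a b → Rel n a' b' → Rel n (a - a') (b - b') := by
    intro n a b a' b' h h'
    have := sub_mem h h'
    change _ - _ ∈ _
    rw [map_sub, map_sub, LinearMap.sub_apply]
    convert this using 1
    abel
  have uniq₁ : ∀ {n a b b'}, Rel n a b → Rel n a b' → b = b' := by
    intro n a b b' h h'
    have h3 := rel_sub h h'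
    simp only [Rel, sub_self, map_zero, LinearMap.zero_apply, zero_sub, neg_mem_iff] at h3
    exact sub_eq_zero.1 (eq_zero_of_mem_coboundaries hB (hr.mem_coboundaries (hb _) h3))
  choose! ψ₀ hψ₀ using ex₁
  have hψ₀' : ∀ {n a b}, a ∈ A.cocycles n → Rel n a b → ψ₀ n a = b := fun ha h =>
    uniq₁ (hψ₀ _ _ ha) h
  let ψ₁ : ∀ n, A.cocycles n →ₗ[R] B.X n := fun n =>
    { toFun := fun a => ψ₀ n a.1
      map_add' := fun a a' => hψ₀' (a + a').2 (by
        have := add_mem (hψ₀ n _ a.2) (hψ₀ n _ a'.2)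
        change _ - _ ∈ _
        rw [Submodule.coe_add, map_add, map_add, LinearMap.add_apply]
        convert this using 1
        abel)
      map_smul' := fun r a => hψ₀' (r • a).2 (by
        have := Submodule.smul_mem _ r (hψ₀ n _ a.2)
        change _ - _ ∈ _
        rw [Submodule.coe_smul, map_smul, RingHom.id_apply, map_smul, LinearMap.smul_apply,
          ← smul_sub]
        exact this) }
  let ψ : ∀ n, A.cohomology.X n →ₗ[R] B.X n := fun n => Submodule.liftQ _ (ψ₁ n) (by
    rintro ⟨a, ha⟩ h
    refine hψ₀' ha ?_
    change _ - _ ∈ _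
    rw [map_zero, sub_zero]
    exact M.lact_mem_coboundaries_left _ h hcc)
  have hψ_one : ψ 0 A.cohomology.one = B.one := hψ₀' A.one_mem_cocycles (by
    change _ - _ ∈ _
    rw [M.one_lact, M.ract_one, sub_self]
    exact zero_mem _)
  have hψ_mul : ∀ {i j k : ℤ} (h : i + j = k) (x : A.cohomology.X i) (y : A.cohomology.X j),
      ψ k (A.cohomology.mul h x y) = B.mul h (ψ i x) (ψ j y) := by
    intro i j k h x y
    obtain ⟨⟨a, ha⟩, rfl⟩ := Submodule.Quotient.mk_surjective _ x
    obtain ⟨⟨a', ha'⟩, rfl⟩ := Submodule.Quotient.mk_surjective _ y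
    refine hψ₀' (A.mul_mem_cocycles h ha ha') ?_
    change M.lact _ (A.mul h a a') c - M.ract _ c (B.mul h (ψ₀ i a) (ψ₀ j a')) ∈ _
    -- Multiplicativity in two moves: `a a' c` is cohomologous to `a c b'`, which is cohomologous to
    -- `c b b'`.
    have h₁ := M.lact_mem_coboundaries h ha (hψ₀ j _ ha')
    have h₂ := M.ract_mem_coboundaries h (hψ₀ i _ ha) (hb (ψ₀ j a'))
    rw [map_sub] at h₁ h₂
    rw [LinearMap.sub_apply] at h₂
    rw [M.lact_ract (add_zero i) (zero_add j) h h] at h₂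
    rw [M.mul_lact h (add_zero j) (add_zero k) h,
      ← M.ract_mul (zero_add i) h h (zero_add k)]
    convert add_mem h₁ h₂ using 1
    abel
  have hψ_inj : ∀ n x, ψ n x = 0 → x = 0 := by
    intro n x hx
    obtain ⟨⟨a, ha⟩, rfl⟩ := Submodule.Quotient.mk_surjective _ x
    have h₁ : Rel n a 0 := by rw [← show ψ₀ n a = 0 from hx]; exact hψ₀ n a ha
    change _ - _ ∈ _ at h₁
    rw [map_zero, sub_zero] at h₁
    exact mk_eq_zero_iff.2 (hl.mem_coboundaries ha h₁)
  have hψ_surj : ∀ n, Function.Surjective (ψ n) := by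
    intro n b
    obtain ⟨a, ha, h⟩ := ex₂ n b
    exact ⟨Submodule.Quotient.mk ⟨a, ha⟩, hψ₀' ha h⟩
  -- Restricting the right action along the isomorphism turns the same bimodule and cocycle into a
  -- direct quasi-equivalence with the cohomology algebra.
  refine Relation.ReflTransGen.single
    ⟨M.restrictRight hB (fun _ _ _ => rfl) ψ hψ_one hψ_mul, c, hc, hl, ?_⟩
  refine DGModule.Hom.isQuasiIso_of _ (fun n x _ hx => ?_) (fun n y hy => ?_)
  · rw [hψ_inj n x (eq_zero_of_mem_coboundaries hB (hr.mem_coboundaries (hb _) hx))]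
    exact zero_mem _
  · obtain ⟨b, -, h⟩ := hr.exists_sub_mem hy
    obtain ⟨x, rfl⟩ := hψ_surj n b
    exact ⟨x, mem_cocycles_of_d_eq_zero (B := A.cohomology) (fun _ _ _ => rfl) x, h⟩

end DGAlgebra

/-! ### Cocycles and their classes in the derived category. -/

namespace CochainComplex.HomComplex

variable {C : Type w} [Category.{v} C]

section

variable [Preadditive C] {F G K : CochainComplex C ℤ}

/-- The composition of cocycles. -/
def Cocycle.comp {n₁ n₂ n₁₂ : ℤ} (z₁ : Cocycle F G n₁) (z₂ : Cocycle G K n₂) (h : n₁ + n₂ = n₁₂) :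
    Cocycle F K n₁₂ :=
  Cocycle.mk (z₁.1.comp z₂.1 h) (n₁₂ + 1) rfl (by
    rw [δ_comp _ _ h (n₁ + 1) (n₂ + 1) _ rfl rfl rfl, z₂.δ_eq_zero, z₁.δ_eq_zero]
    simp)

@[simp]
lemma Cocycle.comp_coe {n₁ n₂ n₁₂ : ℤ} (z₁ : Cocycle F G n₁) (z₂ : Cocycle G K n₂)
    (h : n₁ + n₂ = n₁₂) : (z₁.comp z₂ h).1 = z₁.1.comp z₂.1 h := rfl

lemma Cocycle.equivHomShift_comp_eq {a b c : ℤ} (f : F ⟶ G⟦a⟧) (g : G ⟶ K⟦b⟧) (h : b + a = c) :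
    Cocycle.equivHomShift (ShiftedHom.comp f g h : ShiftedHom F K c) =
      (Cocycle.equivHomShift f).comp (Cocycle.equivHomShift g) (by lia) := by
  ext p q hpq
  rw [Cocycle.comp_coe, Cochain.comp_v _ _ _ p (p + a) q rfl (by lia)]
  simp [Cocycle.equivHomShift_apply, Cochain.rightUnshift_v _ _ _ _ _ _ _ (add_zero _),
    ShiftedHom.comp, CochainComplex.shiftFunctorAdd'_inv_app_f']
  erw [Category.comp_id, Category.assoc, Category.assoc,
    HomologicalComplex.XIsoOfEq_hom_comp_XIsoOfEq_hom]

lemma Cocycle.equivHomShift_symm_comp {a b c : ℤ} (z₁ : Cocycle F G a) (z₂ : Cocycle G K b)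
    (h : a + b = c) : Cocycle.equivHomShift.symm (z₁.comp z₂ h) =
      ShiftedHom.comp (Cocycle.equivHomShift.symm z₁) (Cocycle.equivHomShift.symm z₂) (by lia) := by
  apply Cocycle.equivHomShift.injective
  rw [equivHomShift_comp_eq]
  simp

lemma Cocycle.equivHomShift_symm_ofHom (f : F ⟶ G) :
    Cocycle.equivHomShift.symm (Cocycle.ofHom f) = ShiftedHom.mk₀ (0 : ℤ) rfl f := by
  apply Cocycle.equivHomShift.injective
  ext p
  simp [Cocycle.equivHomShift_apply, Cochain.rightUnshift_v _ 0 _ p p _ p _,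
    ShiftedHom.mk₀, CategoryTheory.shiftFunctorZero',
    CochainComplex.shiftFunctorZero_inv_app_f]

lemma Cocycle.equivHomShift_symm_smul {R : Type*} [CommRing R] [Linear R C] {n : ℤ} (r : R)
    (z : Cocycle F G n) :
    Cocycle.equivHomShift.symm (r • z) = r • Cocycle.equivHomShift.symm z := by
  ext p
  simp [Cocycle.equivHomShift_symm_apply]

end

section

open DerivedCategory

variable [Abelian C] [HasDerivedCategory.{u} C] {F G K : CochainComplex C ℤ}

/-- The morphism in the derived category given by a cocycle. -/
noncomputable def Cocycle.cl {n : ℤ} (z : Cocycle F G n) : ShiftedHom (Q.obj F) (Q.obj G) n :=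
  ShiftedHom.map (X := F) (Y := G) (Cocycle.equivHomShift.symm z) Q

lemma Cocycle.cl_add {n : ℤ} (z₁ z₂ : Cocycle F G n) : (z₁ + z₂).cl = z₁.cl + z₂.cl := by
  rw [cl, map_add]
  exact ShiftedHom.map_add ..

lemma Cocycle.cl_sub {n : ℤ} (z₁ z₂ : Cocycle F G n) : (z₁ - z₂).cl = z₁.cl - z₂.cl := by
  rw [eq_sub_iff_add_eq, ← cl_add, sub_add_cancel]

lemma Cocycle.cl_smul {R : Type*} [CommRing R] [Linear R C] {n : ℤ} (r : R) (z : Cocycle F G n) :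
    (r • z).cl = r • z.cl := by
  rw [cl, equivHomShift_symm_smul]
  exact ShiftedHom.map_smul ..

lemma Cocycle.cl_comp {a b c : ℤ} (z₁ : Cocycle F G a) (z₂ : Cocycle G K b) (h : a + b = c) :
    (z₁.comp z₂ h).cl = z₁.cl.comp z₂.cl (by lia) := by
  rw [cl, equivHomShift_symm_comp]
  exact ShiftedHom.map_comp ..

lemma Cocycle.cl_ofHom (f : F ⟶ G) : (Cocycle.ofHom f).cl = ShiftedHom.mk₀ 0 rfl (Q.map f) := by
  rw [cl, equivHomShift_symm_ofHom]
  exact ShiftedHom.map_mk₀ ..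

lemma Cocycle.cl_eq {n : ℤ} (z : Cocycle F G n) :
    z.cl = ((quotientCompQhIso C).inv.app F ≫ Qh.map (CohomologyClass.toHom (.mk z)) ≫
      (quotientCompQhIso C).hom.app (G⟦n⟧)) ≫ (Q.commShiftIso n).hom.app G := by
  rw [CohomologyClass.toHom_mk, quotientCompQhIso_hom_naturality, Iso.inv_hom_id_app_assoc]
  rfl

/-- Into a K-injective complex, morphisms in the homotopy and derived categories coincide. So every
derived morphism comes from a cocycle and, by `Cocycle.exists_of_cl_eq_zero`, only coboundaries have
zero class. -/
lemma Cocycle.exists_cl_eq [G.IsKInjective] {n : ℤ} (f : ShiftedHom (Q.obj F) (Q.obj G) n) :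
    ∃ z : Cocycle F G n, z.cl = f := by
  obtain ⟨g, hg⟩ := (CochainComplex.IsKInjective.Qh_map_bijective _ (G⟦n⟧)).2
    ((quotientCompQhIso C).hom.app F ≫ (f ≫ (Q.commShiftIso n).inv.app G) ≫
      (quotientCompQhIso C).inv.app (G⟦n⟧))
  obtain ⟨z, rfl⟩ := (CohomologyClass.toHom_bijective F G n).2 g
  obtain ⟨z, rfl⟩ := z.mk_surjective
  refine ⟨z, ?_⟩
  rw [cl_eq, hg]
  simp

lemma Cocycle.cl_eq_zero {n : ℤ} {z : Cocycle F G n} {m : ℤ} (hm : m + 1 = n) (u : Cochain F G m)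
    (hu : δ m n u = z.1) : z.cl = 0 := by
  rw [cl_eq, (CohomologyClass.mk_eq_zero_iff z).2 ((mem_coboundaries_iff z m hm).2 ⟨u, hu⟩)]
  simp

lemma Cocycle.exists_of_cl_eq_zero [G.IsKInjective] {n : ℤ} {z : Cocycle F G n} (hz : z.cl = 0)
    (m : ℤ) (hm : m + 1 = n) : ∃ u : Cochain F G m, δ m n u = z.1 := by
  rw [← mem_coboundaries_iff z m hm, ← CohomologyClass.toHom_mk_eq_zero_iff]
  apply (CochainComplex.IsKInjective.Qh_map_bijective _ (G⟦n⟧)).1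
  rw [cl_eq] at hz
  rw [Functor.map_zero, ← cancel_epi ((quotientCompQhIso C).inv.app F),
    ← cancel_mono ((quotientCompQhIso C).hom.app (G⟦n⟧)), comp_zero, zero_comp,
    ← cancel_mono ((Q.commShiftIso n).hom.app G), zero_comp]
  simpa only [Category.assoc] using hz

end

end CochainComplex.HomComplex

namespace CochainComplex.HomComplex

open DerivedCategory

variable {C : Type w} [Category.{v} C]

section

variable [Preadditive C]

lemma Cochain.sum_comp {F G K : CochainComplex C ℤ} {n₁ n₂ n₁₂ : ℤ} {α : Type*} (s : Finset α)
    (z : α → Cochain F G n₁) (w : Cochain G K n₂) (h : n₁ + n₂ = n₁₂) :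
    (∑ i ∈ s, z i).comp w h = ∑ i ∈ s, (z i).comp w h :=
  map_sum (AddMonoidHom.mk' (fun z : Cochain F G n₁ => z.comp w h)
    (fun _ _ => Cochain.add_comp ..)) z s

lemma Cochain.comp_sum {F G K : CochainComplex C ℤ} {n₁ n₂ n₁₂ : ℤ} {α : Type*} (s : Finset α)
    (z : Cochain F G n₁) (w : α → Cochain G K n₂) (h : n₁ + n₂ = n₁₂) :
    z.comp (∑ i ∈ s, w i) h = ∑ i ∈ s, z.comp (w i) h :=
  map_sum (AddMonoidHom.mk' (fun w : Cochain G K n₂ => z.comp w h)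
    (fun _ _ => Cochain.comp_add ..)) w s

lemma Cocycle.coe_sum {F G : CochainComplex C ℤ} {n : ℤ} {α : Type*} (s : Finset α)
    (z : α → Cocycle F G n) : (∑ i ∈ s, z i).1 = ∑ i ∈ s, (z i).1 :=
  map_sum (cocycle F G n).subtype _ _

/-! ### Shifted direct sums and matrices of cochains. -/

/-- A complex decomposed as a direct sum of shifts of a finite family of complexes. -/
structure ShiftedSum {ι : Type*} [Fintype ι] (P : ι → CochainComplex C ℤ)
    (S : CochainComplex C ℤ) where
  s : ι → ℤ
  t : ι → ℤ
  ts : ∀ k, t k + s k = 0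
  st : ∀ k, s k + t k = 0
  inc : ∀ k, Cocycle (P k) S (t k)
  prj : ∀ k, Cocycle S (P k) (s k)
  inc_prj : ∀ k, (inc k).1.comp (prj k).1 (ts k) = Cochain.ofHom (𝟙 _)
  inc_prj_of_ne : ∀ k l, k ≠ l → (inc k).1.comp (prj l).1 rfl = 0
  sum_prj_inc : ∑ k, (prj k).1.comp (inc k).1 (st k) = Cochain.ofHom (𝟙 _)

namespace ShiftedSum

variable {ι : Type*} [Fintype ι] {P : ι → CochainComplex C ℤ} {S : CochainComplex C ℤ}
  (D : ShiftedSum P S)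

lemma eq_sum {G : CochainComplex C ℤ} {n : ℤ} (z : Cochain S G n) :
    z = ∑ k, (D.prj k).1.comp ((D.inc k).1.comp z rfl) (by have := D.ts k; lia) := by
  conv_lhs => rw [← Cochain.id_comp z, ← D.sum_prj_inc, Cochain.sum_comp]
  exact Finset.sum_congr rfl fun k _ =>
    Cochain.comp_assoc _ _ _ (D.st k) rfl (by have := D.ts k; lia)

lemma eq_zero_of_inc {G : CochainComplex C ℤ} {n : ℤ} (z : Cochain S G n)
    (h : ∀ k a (ha : D.t k + n = a), (D.inc k).1.comp z ha = 0) : z = 0 := by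
  rw [D.eq_sum z]
  exact Finset.sum_eq_zero fun k _ => by rw [h]; simp

lemma eq_zero_of_prj {G : CochainComplex C ℤ} {n : ℤ} (z : Cochain G S n)
    (h : ∀ k a (ha : n + D.s k = a), z.comp (D.prj k).1 ha = 0) : z = 0 := by
  rw [← Cochain.comp_id z, ← D.sum_prj_inc, Cochain.comp_sum]
  refine Finset.sum_eq_zero fun k _ => ?_
  rw [← Cochain.comp_assoc _ _ _ rfl (D.st k) (by have := D.ts k; lia), h]
  simp

lemma eq_zero {n : ℤ} (z : Cochain S S n)
    (h : ∀ k l a m (ha : D.t k + n = a) (hm : a + D.s l = m),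
      ((D.inc k).1.comp z ha).comp (D.prj l).1 hm = 0) : z = 0 :=
  D.eq_zero_of_inc _ fun k a ha => D.eq_zero_of_prj _ fun l m hm => h k l a m ha hm

@[simp]
lemma inc_comp_prj_comp {G : CochainComplex C ℤ} {a b : ℤ} (k : ι) (w : Cochain (P k) G a)
    (h : D.s k + a = b) (h' : D.t k + b = a) :
    (D.inc k).1.comp ((D.prj k).1.comp w h) h' = w := by
  rw [← Cochain.comp_assoc _ _ _ (D.ts k) h (by lia), D.inc_prj, Cochain.id_comp]

lemma inc_comp_prj_comp_of_ne {G : CochainComplex C ℤ} {a b c : ℤ} {k l : ι} (hkl : k ≠ l)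
    (w : Cochain (P l) G a) (h : D.s l + a = b) (h' : D.t k + b = c) :
    (D.inc k).1.comp ((D.prj l).1.comp w h) h' = 0 := by
  rw [← Cochain.comp_assoc _ _ _ rfl h (by lia), D.inc_prj_of_ne k l hkl, Cochain.zero_comp]

@[simp]
lemma comp_inc_comp_prj {G : CochainComplex C ℤ} {a b : ℤ} (k : ι) (w : Cochain G (P k) a)
    (h : a + D.t k = b) (h' : b + D.s k = a) :
    (w.comp (D.inc k).1 h).comp (D.prj k).1 h' = w := by
  rw [Cochain.comp_assoc _ _ _ h (D.ts k) (by lia), D.inc_prj, Cochain.comp_id]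

lemma comp_inc_comp_prj_of_ne {G : CochainComplex C ℤ} {a b c : ℤ} {k l : ι} (hkl : k ≠ l)
    (w : Cochain G (P k) a) (h : a + D.t k = b) (h' : b + D.s l = c) :
    (w.comp (D.inc k).1 h).comp (D.prj l).1 h' = 0 := by
  rw [Cochain.comp_assoc _ _ _ h rfl (by lia), D.inc_prj_of_ne k l hkl, Cochain.comp_zero]

end ShiftedSum

variable (R : Type u) [CommRing R] [Linear R C]

/-- A composition-closed family of submodules of cocycles. -/
structure StrictFamily {ι : Type*} (P : ι → CochainComplex C ℤ) where
  N : ∀ k l n, Submodule R (Cochain (P k) (P l) n)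
  δ_eq_zero : ∀ {k l n z}, z ∈ N k l n → ∀ m, n + 1 = m → δ n m z = 0
  one_mem : ∀ k, Cochain.ofHom (𝟙 (P k)) ∈ N k k 0
  comp_mem : ∀ {k l m a b c z w} (h : a + b = c), z ∈ N k l a → w ∈ N l m b →
    z.comp w h ∈ N k m c

namespace StrictFamily

variable {R} {ι : Type*} [Fintype ι] {P : ι → CochainComplex C ℤ} {S : CochainComplex C ℤ}
  (F : StrictFamily R P) (D : ShiftedSum P S)

/-- The endomorphisms of a shifted sum with all components in a given strict family. -/
def matrices (n : ℤ) : Submodule R (Cochain S S n) where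
  carrier := {z | ∀ k l a m (ha : D.t k + n = a) (hm : a + D.s l = m),
    ((D.inc k).1.comp z ha).comp (D.prj l).1 hm ∈ F.N k l m}
  zero_mem' k l a m ha hm := by simp
  add_mem' hx hy k l a m ha hm := by
    simpa using add_mem (hx k l a m ha hm) (hy k l a m ha hm)
  smul_mem' r x hx k l a m ha hm := by
    simpa using Submodule.smul_mem _ r (hx k l a m ha hm)

variable {F D}

/-- Inclusions and projections are cocycles, so each entry of the differential is, up to sign, the
differential of an entry, which is zero in a strict family. -/
lemma δ_eq_zero_of_mem_matrices {n : ℤ} {z : Cochain S S n} (hz : z ∈ F.matrices D n) :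
    δ n (n + 1) z = 0 := by
  refine D.eq_zero _ fun k l a m ha hm => ?_
  have h := F.δ_eq_zero (hz k l (a - 1) (m - 1) (by lia) (by lia)) m (by lia)
  rw [δ_comp _ _ _ a (D.s l + 1) m (by lia) (by lia) rfl,
    (D.prj l).δ_eq_zero, δ_comp _ _ _ (D.t k + 1) (n + 1) a (by lia) rfl rfl,
    (D.inc k).δ_eq_zero] at h
  simpa [smul_eq_zero_iff_eq] using h

lemma one_mem_matrices : Cochain.ofHom (𝟙 S) ∈ F.matrices D 0 := by
  intro k l a m ha hm
  obtain rfl : D.t k = a := by lia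
  rw [Cochain.comp_id]
  by_cases hkl : k = l
  · subst hkl
    obtain rfl : 0 = m := by have := D.ts k; lia
    rw [D.inc_prj]
    exact F.one_mem k
  · subst hm
    rw [D.inc_prj_of_ne k l hkl]
    exact zero_mem _

/-- Matrix multiplication: inserting the decomposition of the identity between the factors writes an
entry of the product as a sum of products of entries. -/
lemma comp_mem_matrices {a b c : ℤ} {z : Cochain S S a} {w : Cochain S S b} (h : a + b = c)
    (hz : z ∈ F.matrices D a) (hw : w ∈ F.matrices D b) : z.comp w h ∈ F.matrices D c := by
  intro k l a' m ha hm
  have e : ((D.inc k).1.comp (z.comp w h) ha).comp (D.prj l).1 hm =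
      ∑ j, (((D.inc k).1.comp z rfl).comp (D.prj j).1 rfl).comp
        (((D.inc j).1.comp w rfl).comp (D.prj l).1 rfl) (by have := D.ts j; lia) := by
    rw [← Cochain.comp_assoc _ _ _ (Eq.refl (D.t k + a)) h (by lia)]
    conv_lhs => rw [D.eq_sum w, Cochain.comp_sum, Cochain.sum_comp]
    refine Finset.sum_congr rfl fun j _ => ?_
    rw [← Cochain.comp_assoc _ _ _ rfl _ (by have := D.ts j; lia),
      Cochain.comp_assoc _ _ _ _ rfl (by have := D.ts j; lia)]
  rw [e]
  exact sum_mem fun j _ => F.comp_mem _ (hz k j _ _ rfl rfl) (hw j l _ _ rfl rfl)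

variable (F D) in
/-- The dg algebra with zero differential of matrices with entries in a strict family. -/
def matrixDGAlgebra : DGAlgebra.{u, v} R where
  X n := F.matrices D n
  d i j _ := 0
  d_d i j k _ _ x := rfl
  one := ⟨Cochain.ofHom (𝟙 S), one_mem_matrices⟩
  mul {i j k} h := LinearMap.mk₂ R
    (fun a b => ⟨b.1.comp a.1 (by lia), comp_mem_matrices _ b.2 a.2⟩)
    (fun a a' b => by ext1; simp) (fun r a b => by ext1; simp)
    (fun a b b' => by ext1; simp) (fun r a b => by ext1; simp)
  one_mul a := Subtype.ext (Cochain.comp_id a.1)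
  mul_one a := Subtype.ext (Cochain.id_comp a.1)
  mul_assoc hij hjk h h' a b c := Subtype.ext
    (Cochain.comp_assoc c.1 b.1 a.1 (by lia) (by lia) (by lia)).symm
  d_mul {i j k i' j' k'} h hi hj hk h₁ h₂ a b := by
    simp only [LinearMap.zero_apply, map_zero, smul_zero, add_zero]

variable (F D) in
/-- The cochains from a shifted sum to a complex, as a dg bimodule. -/
def homBimodule (I : CochainComplex C ℤ) :
    DGBimodule (endDGAlgebra R I) (F.matrixDGAlgebra D) where
  X n := Cochain S I n
  d i j _ := δ_hom R S I i j
  d_d i j k _ _ x := δ_δ i j k x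
  lact {i j k} h := LinearMap.mk₂ R (fun (a : Cochain I I i) m => m.comp a (by lia))
    (fun _ _ _ => Cochain.comp_add ..) (fun _ _ _ => Cochain.comp_smul ..)
    (fun _ _ _ => Cochain.add_comp ..) (fun _ _ _ => Cochain.smul_comp ..)
  ract {i j k} h := LinearMap.mk₂ R (fun m (b : F.matrices D j) => b.1.comp m (by lia))
    (fun _ _ _ => Cochain.comp_add ..) (fun _ _ _ => Cochain.comp_smul ..)
    (fun _ _ _ => Cochain.add_comp ..) (fun _ _ _ => Cochain.smul_comp ..)
  one_lact m := Cochain.comp_id m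
  ract_one m := Cochain.id_comp m
  mul_lact hij hjk h h' a b c :=
    (Cochain.comp_assoc c b a (by lia) (by lia) (by lia)).symm
  ract_mul hij hjk h h' a b c :=
    (Cochain.comp_assoc c.1 b.1 a (by lia) (by lia) (by lia)).symm
  lact_ract hij hjk h h' a m b :=
    (Cochain.comp_assoc b.1 m a (by lia) (by lia) (by lia)).symm
  d_lact {i j k i' j' k'} h hi hj hk h₁ h₂ a b :=
    δ_comp b a (show j + i = k by lia) j' i' k' hk hj hi
  d_ract {i j k i' j' k'} h hi hj hk h₁ h₂ a b := by
    refine (δ_comp b.1 a (show j + i = k by lia) j' i' k' hk hj hi).trans ?_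
    subst hj
    rw [δ_eq_zero_of_mem_matrices b.2]
    rw [Cochain.zero_comp, smul_zero, add_zero]
    change _ = _ + i.negOnePow • (Cochain.comp (0 : Cochain S S (j + 1)) a (by lia))
    rw [Cochain.zero_comp, smul_zero, add_zero]
    rfl

end StrictFamily

end

/-! ### Strict models of derived endomorphisms. -/

section

variable {R : Type u} [CommRing R] [Abelian C] [Linear R C] [HasDerivedCategory.{w''} C]
  {ι : Type*} [Fintype ι] {P : ι → CochainComplex C ℤ} {S : CochainComplex C ℤ}

lemma Cocycle.cl_sum {α : Type*} (s : Finset α) {F G : CochainComplex C ℤ} {n : ℤ}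
    (z : α → Cocycle F G n) : (∑ i ∈ s, z i).cl = ∑ i ∈ s, (z i).cl :=
  map_sum (AddMonoidHom.mk' (fun z : Cocycle F G n => z.cl) cl_add) z s

/-- A strict family represents the morphisms in the derived category if each of them is the
class of exactly one member of the family. -/
structure StrictFamily.IsModel (F : StrictFamily R P) : Prop where
  exists_cl_eq : ∀ {k l n} (f : ShiftedHom (Q.obj (P k)) (Q.obj (P l)) n),
    ∃ z : Cocycle (P k) (P l) n, z.1 ∈ F.N k l n ∧ z.cl = f
  eq_zero : ∀ {k l n} (z : Cocycle (P k) (P l) n), z.1 ∈ F.N k l n → z.cl = 0 → z.1 = 0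

/-- The decomposition of the identity survives in the derived category, so morphisms out of the sum
are still detected on summands. -/
lemma ShiftedSum.eq_zero_of_cl (D : ShiftedSum P S) {Y : DerivedCategory C} {n : ℤ}
    (f : ShiftedHom (Q.obj S) Y n)
    (h : ∀ k, (D.inc k).cl.comp f (Int.add_comm n (D.t k)) = 0) : f = 0 := by
  have e : (∑ k, (D.prj k).comp (D.inc k) (D.st k)) = Cocycle.ofHom (𝟙 S) :=
    Subtype.ext (by
      rw [← show _ = (Cocycle.ofHom (𝟙 S)).1 from D.sum_prj_inc]
      exact Cocycle.coe_sum _ _)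
  have e' := congrArg (fun z : Cocycle S S 0 => z.cl.comp f (add_zero n)) e
  simp only [Cocycle.cl_ofHom, CategoryTheory.Functor.map_id, ShiftedHom.mk₀_comp,
    Category.id_comp] at e'
  rw [← e', Cocycle.cl_sum]
  refine (map_sum (AddMonoidHom.mk' (fun z : ShiftedHom (Q.obj S) (Q.obj S) (0 : ℤ) =>
    z.comp f (add_zero n)) (fun _ _ => ShiftedHom.add_comp ..)) _ _).trans
      (Finset.sum_eq_zero fun k _ => ?_)
  simp only [AddMonoidHom.mk'_apply, Cocycle.cl_comp]
  rw [ShiftedHom.comp_assoc _ _ _ _ (Int.add_comm n (D.t k)) (by have := D.ts k; lia), h,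
    ShiftedHom.comp_zero]

lemma ShiftedSum.eq_zero_of_cl' (D : ShiftedSum P S) {Y : DerivedCategory C} {n : ℤ}
    (f : ShiftedHom Y (Q.obj S) n)
    (h : ∀ k, f.comp (D.prj k).cl (Int.add_comm (D.s k) n) = 0) : f = 0 := by
  have e : (∑ k, (D.prj k).comp (D.inc k) (D.st k)) = Cocycle.ofHom (𝟙 S) :=
    Subtype.ext (by
      rw [← show _ = (Cocycle.ofHom (𝟙 S)).1 from D.sum_prj_inc]
      exact Cocycle.coe_sum _ _)
  have e' := congrArg (fun z : Cocycle S S 0 => f.comp z.cl (zero_add n)) e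
  simp only [Cocycle.cl_ofHom, CategoryTheory.Functor.map_id, ShiftedHom.comp_mk₀,
    Category.comp_id] at e'
  rw [← e', Cocycle.cl_sum]
  refine (map_sum (AddMonoidHom.mk' (fun z : ShiftedHom (Q.obj S) (Q.obj S) (0 : ℤ) =>
    f.comp z (zero_add n)) (fun _ _ => ShiftedHom.comp_add ..)) _ _).trans
      (Finset.sum_eq_zero fun k _ => ?_)
  simp only [AddMonoidHom.mk'_apply, Cocycle.cl_comp]
  rw [← ShiftedHom.comp_assoc _ _ _ (Int.add_comm (D.s k) n) _ (by have := D.ts k; lia), h,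
    ShiftedHom.zero_comp]

namespace StrictFamily

variable {F : StrictFamily R P} {D : ShiftedSum P S}

lemma IsModel.eq_zero_of_mem_matrices (hF : F.IsModel) {n : ℤ} (z : Cocycle S S n)
    (hz : z.1 ∈ F.matrices D n) (h : z.cl = 0) : z.1 = 0 := by
  refine D.eq_zero _ fun k l a m ha hm => ?_
  refine hF.eq_zero (((D.inc k).comp z ha).comp (D.prj l) hm) (hz k l a m ha hm) ?_
  rw [Cocycle.cl_comp, Cocycle.cl_comp, h]
  simp

/-- Each entry of `f` is represented inside the strict family, and the representatives are assembled
into one cocycle. Its class is `f` because both have the same entries in the derived category. -/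
lemma IsModel.exists_mem_matrices (hF : F.IsModel) {n : ℤ}
    (f : ShiftedHom (Q.obj S) (Q.obj S) n) :
    ∃ z : Cocycle S S n, z.1 ∈ F.matrices D n ∧ z.cl = f := by
  choose y hy hyf using fun k l => hF.exists_cl_eq
    ((((D.inc k).cl.comp f (Int.add_comm _ _)).comp (D.prj l).cl (Int.add_comm _ _) :
      ShiftedHom (Q.obj (P k)) (Q.obj (P l)) (D.t k + n + D.s l)))
  let x : Cocycle S S n := ∑ k, ∑ l, ((D.prj k).comp (y k l)
    (show D.s k + (D.t k + n + D.s l) = n + D.s l by have := D.ts k; lia)).comp (D.inc l)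
    (by have := D.ts l; lia)
  have hx : x.1 = ∑ k, ∑ l, ((D.prj k).1.comp ((y k l).1.comp (D.inc l).1
      (show D.t k + n + D.s l + D.t l = D.t k + n by have := D.ts l; lia)))
      (show _ = n by have := D.ts k; lia) := by
    simp only [x, Cocycle.coe_sum]
    refine Finset.sum_congr rfl fun k _ => Finset.sum_congr rfl fun l _ => ?_
    have hk := D.ts k
    have hl := D.ts l
    exact Cochain.comp_assoc (n₁₂ := n + D.s l) (n₂₃ := D.t k + n) _ _ _ (by lia) (by lia) (by lia)
  have hxy : ∀ k l, ((D.inc k).1.comp x.1 rfl).comp (D.prj l).1 rfl = (y k l).1 := fun k l => by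
    rw [hx, Cochain.comp_sum, Finset.sum_eq_single k, Cochain.comp_sum, Cochain.sum_comp,
      Finset.sum_eq_single l]
    · simp
    · intro l' _ hl
      simp [D.comp_inc_comp_prj_of_ne hl]
    · simp
    · intro k' _ hk
      simp [Cochain.comp_sum, D.inc_comp_prj_comp_of_ne hk.symm]
    · simp
  refine ⟨x, ?_, ?_⟩
  · rintro k l _ _ rfl rfl
    rw [hxy]
    exact hy k l
  · refine sub_eq_zero.1 (D.eq_zero_of_cl _ fun k => D.eq_zero_of_cl' _ fun l => ?_)
    rw [sub_eq_add_neg, ShiftedHom.comp_add, ShiftedHom.comp_neg, ShiftedHom.add_comp,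
      ShiftedHom.neg_comp, add_neg_eq_zero, ← hyf, ← Cocycle.cl_comp,
      ← Cocycle.cl_comp]
    exacts [congrArg Cocycle.cl (Subtype.ext (hxy k l)), rfl, rfl]

/-- The bimodule is the complex of cochains from `S` to `I`, with `c` a cocycle representing `e`.
Composing with `c` identifies its cohomology with derived endomorphisms of `I` on one side and of
`S` on the other; cocycles on `I` compute the former by K-injectivity, strict matrices the latter by
`hF`. -/
theorem IsModel.isFormal (hF : F.IsModel) (D : ShiftedSum P S) {I : CochainComplex C ℤ}
    [I.IsKInjective] (e : Q.obj S ≅ Q.obj I) : (endDGAlgebra R I).IsFormal := by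
  refine DGAlgebra.QuasiEquivalent.isFormal (B := F.matrixDGAlgebra D) ?_ fun _ _ _ => rfl
  obtain ⟨c, hc⟩ := Cocycle.exists_cl_eq (ShiftedHom.mk₀ (0 : ℤ) rfl e.hom)
  refine ⟨F.homBimodule D I, c.1, c.δ_eq_zero 1, DGModule.Hom.isQuasiIso_of _ ?_ ?_,
    DGModule.Hom.isQuasiIso_of _ ?_ ?_⟩
  · intro n x hx hx'
    rw [DGModule.mem_cocycles rfl] at hx
    rw [DGModule.mem_coboundaries (sub_add_cancel n 1)] at hx' ⊢
    obtain ⟨y, hy⟩ := hx'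
    let x' : Cocycle I I n := Cocycle.mk x (n + 1) rfl hx
    have h := Cocycle.cl_eq_zero (z := c.comp x' (zero_add n)) (sub_add_cancel n 1) y hy
    rw [Cocycle.cl_comp, hc, ShiftedHom.mk₀_comp] at h
    exact Cocycle.exists_of_cl_eq_zero (z := x') (by simpa using h) _ (sub_add_cancel n 1)
  · intro n y hy
    rw [DGModule.mem_cocycles rfl] at hy
    let y' : Cocycle S I n := Cocycle.mk y (n + 1) rfl hy
    obtain ⟨x, hx⟩ := Cocycle.exists_cl_eq (e.inv ≫ y'.cl : ShiftedHom (Q.obj I) (Q.obj I) n)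
    refine ⟨x.1, (DGModule.mem_cocycles rfl).2 (x.δ_eq_zero _), ?_⟩
    refine (DGModule.mem_coboundaries (sub_add_cancel n 1)).2 ?_
    exact Cocycle.exists_of_cl_eq_zero (z := y' - c.comp x (zero_add n)) (by
      rw [Cocycle.cl_sub, Cocycle.cl_comp, hc, hx, ShiftedHom.mk₀_comp, e.hom_inv_id_assoc,
        sub_self]) _ (sub_add_cancel n 1)
  · intro n x hx hx'
    rw [DGModule.mem_coboundaries (sub_add_cancel n 1)] at hx'
    obtain ⟨y, hy⟩ := hx'
    let x' : Cocycle S S n := Cocycle.mk x.1 (n + 1) rfl (δ_eq_zero_of_mem_matrices x.2)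
    have h := Cocycle.cl_eq_zero (z := x'.comp c (add_zero n)) (sub_add_cancel n 1) y hy
    rw [Cocycle.cl_comp, hc, ShiftedHom.comp_mk₀] at h
    have h0 : x = 0 := Subtype.ext (hF.eq_zero_of_mem_matrices x' x.2 (by simpa using h))
    rw [h0]
    exact zero_mem _
  · intro n y hy
    rw [DGModule.mem_cocycles rfl] at hy
    let y' : Cocycle S I n := Cocycle.mk y (n + 1) rfl hy
    obtain ⟨x, hx, hx'⟩ := hF.exists_mem_matrices (D := D)
      (y'.cl ≫ e.inv⟦n⟧' : ShiftedHom (Q.obj S) (Q.obj S) n)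
    refine ⟨⟨x.1, hx⟩, (DGModule.mem_cocycles rfl).2 rfl, ?_⟩
    refine (DGModule.mem_coboundaries (sub_add_cancel n 1)).2 ?_
    exact Cocycle.exists_of_cl_eq_zero (z := y' - x.comp c (add_zero n)) (by
      rw [Cocycle.cl_sub, Cocycle.cl_comp, hc, hx', ShiftedHom.comp_mk₀, Category.assoc,
        ← CategoryTheory.Functor.map_comp, e.inv_hom_id, CategoryTheory.Functor.map_id, Category.comp_id, sub_self])
      _ (sub_add_cancel n 1)

end StrictFamily

end

end CochainComplex.HomComplex

/-! ### The multiplication table of a star. -/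

namespace CochainComplex.HomComplex

open DerivedCategory

variable (R : Type u) [CommRing R] {C : Type w} [Category.{v} C]

/-- Cocycles between a central complex and finitely many others: `α i` from the center, `β i` of
degree `2` to the center, such that `ω = α i ≫ β i` does not depend on `i` and all the other
products of these vanish. -/
structure StarCocycles [Preadditive C] {ι : Type*} (P : Option ι → CochainComplex C ℤ) where
  α : ∀ i, Cocycle (P none) (P (some i)) 0
  β : ∀ i, Cocycle (P (some i)) (P none) 2
  ω : Cocycle (P none) (P none) 2
  α_β : ∀ i, (α i).1.comp (β i).1 (zero_add 2) = ω.1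
  β_α : ∀ i j, (β i).1.comp (α j).1 (add_zero 2) = 0
  ω_ω : ω.1.comp ω.1 rfl = 0
  ω_α : ∀ i, ω.1.comp (α i).1 (add_zero 2) = 0
  β_ω : ∀ i, (β i).1.comp ω.1 rfl = 0

namespace StarCocycles

variable {ι : Type*}

section

variable [Preadditive C] {P : Option ι → CochainComplex C ℤ} (c : StarCocycles P)

/-- The identities and the given cocycles. -/
inductive IsBasic : ∀ k l n, Cochain (P k) (P l) n → Prop
  | id (k) : IsBasic k k 0 (Cochain.ofHom (𝟙 (P k)))
  | α (i) : IsBasic none (some i) 0 (c.α i).1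
  | β (i) : IsBasic (some i) none 2 (c.β i).1
  | ω : IsBasic none none 2 c.ω.1

variable {c}

lemma IsBasic.δ_eq_zero {k l n} {z : Cochain (P k) (P l) n} (h : c.IsBasic k l n z) (m : ℤ) :
    δ n m z = 0 := by
  cases h with
  | id => simp
  | α i => exact (c.α i).δ_eq_zero m
  | β i => exact (c.β i).δ_eq_zero m
  | ω => exact c.ω.δ_eq_zero m

/-- The basic cochains multiply to basic cochains or to zero, with no coefficients or correction
terms; hence their spans are closed under composition. -/
lemma IsBasic.comp {k l m a b d} {z : Cochain (P k) (P l) a} {y : Cochain (P l) (P m) b}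
    (hz : c.IsBasic k l a z) (hy : c.IsBasic l m b y) (h : a + b = d) :
    z.comp y h = 0 ∨ c.IsBasic k m d (z.comp y h) := by
  cases hz with
  | id =>
    obtain rfl : b = d := by lia
    rw [Cochain.id_comp]
    exact .inr hy
  | α i =>
    cases hy with
    | id =>
      subst h
      exact .inr (by rw [Cochain.comp_id]; exact .α i)
    | β =>
      subst h
      exact .inr (by rw [show _ = c.ω.1 from c.α_β i]; exact .ω)
  | β i =>
    cases hy with
    | id =>
      subst h
      exact .inr (by rw [Cochain.comp_id]; exact .β i)
    | α j =>
      subst h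
      exact .inl (c.β_α i j)
    | ω =>
      subst h
      exact .inl (c.β_ω i)
  | ω =>
    cases hy with
    | id =>
      subst h
      exact .inr (by rw [Cochain.comp_id]; exact .ω)
    | α j =>
      subst h
      exact .inl (c.ω_α j)
    | ω =>
      subst h
      exact .inl c.ω_ω

lemma IsBasic.none_none {n} {z : Cochain (P none) (P none) n} (h : c.IsBasic none none n z) :
    (n = 0 ∧ z ≍ Cochain.ofHom (𝟙 (P none))) ∨ (n = 2 ∧ z ≍ c.ω.1) := by
  cases h <;> simp

lemma IsBasic.none_some {n i} {z : Cochain (P none) (P (some i)) n}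
    (h : c.IsBasic none (some i) n z) : n = 0 ∧ z ≍ (c.α i).1 := by
  cases h; simp

lemma IsBasic.some_none {n i} {z : Cochain (P (some i)) (P none) n}
    (h : c.IsBasic (some i) none n z) : n = 2 ∧ z ≍ (c.β i).1 := by
  cases h; simp

lemma IsBasic.some_some {n i j} {z : Cochain (P (some i)) (P (some j)) n}
    (h : c.IsBasic (some i) (some j) n z) :
    n = 0 ∧ i = j ∧ z ≍ Cochain.ofHom (𝟙 (P (some i))) := by
  cases h; simp

variable [Linear R C]

variable (c) in
/-- The strict family spanned by the identities and the given cocycles. -/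
def strictFamily : StrictFamily R P where
  N k l n := Submodule.span R {z | c.IsBasic k l n z}
  δ_eq_zero {k l n z} hz m _ := by
    change z ∈ LinearMap.ker (δ_hom R (P k) (P l) n m)
    refine Submodule.span_le.2 (fun z hz => ?_) hz
    exact hz.δ_eq_zero m
  one_mem k := Submodule.subset_span (.id k)
  comp_mem {k l m a b d z y} h hz hy := by
    induction hz, hy using Submodule.span_induction₂ with
    | mem_mem z y hz hy =>
      rcases hz.comp hy h with e | e
      · rw [e]; exact zero_mem _
      · exact Submodule.subset_span e
    | zero_left => simp
    | zero_right => simp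
    | add_left x y z _ _ _ hx hy => rw [Cochain.add_comp]; exact add_mem hx hy
    | add_right x y z _ _ _ hx hy => rw [Cochain.comp_add]; exact add_mem hx hy
    | smul_left r x y _ _ h => rw [Cochain.smul_comp]; exact Submodule.smul_mem _ r h
    | smul_right r x y _ _ h => rw [Cochain.comp_smul]; exact Submodule.smul_mem _ r h

end

section

variable {R} [Abelian C] [Linear R C] [HasDerivedCategory.{w''} C]
  {P : Option ι → CochainComplex C ℤ} {c : StarCocycles P}

lemma model_of_isGen {k l n} (g : Cocycle (P k) (P l) n) (hg : c.IsBasic k l n g.1)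
    (h : ∀ z, c.IsBasic k l n z → z = g.1) (hgen : IsGen R g.cl) :
    (∀ f : ShiftedHom (Q.obj (P k)) (Q.obj (P l)) n,
      ∃ z : Cocycle (P k) (P l) n, z.1 ∈ (c.strictFamily R).N k l n ∧ z.cl = f) ∧
    ∀ z : Cocycle (P k) (P l) n, z.1 ∈ (c.strictFamily R).N k l n → z.cl = 0 → z.1 = 0 := by
  refine ⟨fun f => ?_, fun z hz hz' => ?_⟩
  · obtain ⟨r, rfl⟩ := hgen.2 f
    exact ⟨r • g, Submodule.smul_mem _ r (Submodule.subset_span hg), Cocycle.cl_smul r g⟩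
  · have : z.1 ∈ Submodule.span R {g.1} :=
      Submodule.span_mono (fun y hy => h y hy) hz
    obtain ⟨r, hr⟩ := Submodule.mem_span_singleton.1 this
    obtain rfl : r • g = z := Subtype.ext hr
    rw [Cocycle.cl_smul] at hz'
    obtain rfl : r = 0 := hgen.1 (hz'.trans (zero_smul R _).symm)
    simp

lemma model_of_subsingleton {k l n} (h : ∀ z, ¬ c.IsBasic k l n z)
    (hs : Subsingleton (ShiftedHom (Q.obj (P k)) (Q.obj (P l)) n)) :
    (∀ f : ShiftedHom (Q.obj (P k)) (Q.obj (P l)) n,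
      ∃ z : Cocycle (P k) (P l) n, z.1 ∈ (c.strictFamily R).N k l n ∧ z.cl = f) ∧
    ∀ z : Cocycle (P k) (P l) n, z.1 ∈ (c.strictFamily R).N k l n → z.cl = 0 → z.1 = 0 := by
  refine ⟨fun f => ⟨0, zero_mem _, Subsingleton.elim _ _⟩, fun z hz _ => ?_⟩
  have : z.1 ∈ Submodule.span R (∅ : Set (Cochain (P k) (P l) n)) :=
    Submodule.span_mono (fun y hy => (h y hy).elim) hz
  simpa using this

/-- For given vertices and degree there is at most one basic cochain. The hypotheses say that the
derived morphisms are free on its class if it exists and zero otherwise. -/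
theorem isModel_strictFamily
    (h₀₀ : ∀ n : ℤ, n ≠ 0 → n ≠ 2 → Subsingleton (ShiftedHom (Q.obj (P none)) (Q.obj (P none)) n))
    (h₀₁ : ∀ i, ∀ n : ℤ, n ≠ 0 → Subsingleton (ShiftedHom (Q.obj (P none)) (Q.obj (P (some i))) n))
    (h₁₀ : ∀ i, ∀ n : ℤ, n ≠ 2 → Subsingleton (ShiftedHom (Q.obj (P (some i))) (Q.obj (P none)) n))
    (h₁₁ : ∀ i j, ∀ n : ℤ, ¬ (n = 0 ∧ i = j) →
      Subsingleton (ShiftedHom (Q.obj (P (some i))) (Q.obj (P (some j))) n))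
    (h_id : ∀ k, IsGen R (Cocycle.ofHom (𝟙 (P k))).cl)
    (hα : ∀ i, IsGen R (c.α i).cl) (hβ : ∀ i, IsGen R (c.β i).cl) (hω : IsGen R c.ω.cl) :
    (c.strictFamily R).IsModel := by
  have key : ∀ k l n, (∀ f : ShiftedHom (Q.obj (P k)) (Q.obj (P l)) n,
      ∃ z : Cocycle (P k) (P l) n, z.1 ∈ (c.strictFamily R).N k l n ∧ z.cl = f) ∧
    ∀ z : Cocycle (P k) (P l) n, z.1 ∈ (c.strictFamily R).N k l n → z.cl = 0 → z.1 = 0 := by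
    rintro (_ | i) (_ | j) n
    · by_cases hn : n = 0
      · subst hn
        refine model_of_isGen (Cocycle.ofHom (𝟙 _)) (.id _) (fun z hz => ?_) (h_id none)
        simpa using hz.none_none
      · by_cases hn' : n = 2
        · subst hn'
          refine model_of_isGen c.ω .ω (fun z hz => ?_) hω
          simpa using hz.none_none
        · exact model_of_subsingleton (fun z hz => by simpa [hn, hn'] using hz.none_none)
            (h₀₀ n hn hn')
    · by_cases hn : n = 0
      · subst hn
        exact model_of_isGen (c.α j) (.α j) (fun z hz => by simpa using hz.none_some) (hα j)
      · exact model_of_subsingleton (fun z hz => hn hz.none_some.1) (h₀₁ j n hn)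
    · by_cases hn : n = 2
      · subst hn
        exact model_of_isGen (c.β i) (.β i) (fun z hz => by simpa using hz.some_none) (hβ i)
      · exact model_of_subsingleton (fun z hz => hn hz.some_none.1) (h₁₀ i n hn)
    · by_cases h : n = 0 ∧ i = j
      · obtain ⟨rfl, rfl⟩ := h
        exact model_of_isGen (Cocycle.ofHom (𝟙 _)) (.id _)
          (fun z hz => by simpa using hz.some_some) (h_id _)
      · exact model_of_subsingleton (fun z hz => h ⟨hz.some_some.1, hz.some_some.2.1⟩)
          (h₁₁ i j n h)
  exact ⟨fun f => (key _ _ _).1 f, fun z => (key _ _ _).2 z⟩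

end

end StarCocycles

end CochainComplex.HomComplex

/-! ### Building the complexes at the centre and at the leaves. -/

/-- The pushout of a short exact sequence along a morphism from its first term. -/
lemma CategoryTheory.ShortComplex.ShortExact.pushout {A : Type w} [Category.{v} A] [Abelian A]
    {S : ShortComplex A} (hS : S.ShortExact) {J : A} (k : S.X₁ ⟶ J) :
    (ShortComplex.mk (pushout.inr S.f k) (pushout.desc S.g 0 (by simp))
      (pushout.inr_desc ..)).ShortExact := by
  have := hS.mono_f
  have := hS.epi_g
  let t : Limits.pushout S.f k ⟶ S.X₃ := pushout.desc S.g 0 (by simp)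
  have ht : pushout.inl S.f k ≫ t = S.g := pushout.inl_desc ..
  have ht' : pushout.inr S.f k ≫ t = 0 := pushout.inr_desc ..
  have : Mono (pushout.inr S.f k) := Abelian.mono_inr_of_isColimit _ _ (pushout.isColimit S.f k)
  have : Epi t := epi_of_epi_fac ht
  have key : ∀ {B : A} (u : Limits.pushout S.f k ⟶ B) (_ : pushout.inr S.f k ≫ u = 0),
      ∃ v : S.X₃ ⟶ B, t ≫ v = u := fun {B} u hu => by
    have h : S.f ≫ pushout.inl S.f k ≫ u = 0 := by
      rw [← Category.assoc, pushout.condition, Category.assoc, hu, comp_zero]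
    refine ⟨hS.exact.desc _ h, ?_⟩
    apply pushout.hom_ext
    · rw [← Category.assoc, ht, hS.exact.g_desc]
    · rw [← Category.assoc, ht', zero_comp, hu]
  exact
    { exact := ShortComplex.exact_of_g_is_cokernel _ <|
        CokernelCofork.IsColimit.ofπ _ _ (fun u hu => (key u hu).choose)
          (fun u hu => (key u hu).choose_spec)
          (fun u hu m hm => by
            rw [← cancel_epi t, (key u hu).choose_spec]
            exact hm)
      mono_f := by assumption
      epi_g := by assumption }

section Leaves

open CochainComplex HomComplex DerivedCategory Abelian

variable {C : Type w} [Category.{v} C] [Abelian C]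

lemma shortExact_map_single (S : ShortComplex C) (hS : S.ShortExact) :
    (S.map (CochainComplex.singleFunctor C 0)).ShortExact :=
  hS.map_of_exact (HomologicalComplex.single C (.up ℤ) 0)

/-- Replacing the first term of a short exact sequence by a quasi-isomorphic complex. -/
lemma exists_center {U : ShortComplex (CochainComplex C ℤ)} (hU : U.ShortExact)
    {J : CochainComplex C ℤ} (κ : U.X₁ ⟶ J) (hκ : QuasiIso κ) :
    ∃ (P : CochainComplex C ℤ) (q : U.X₂ ⟶ P) (s : J ⟶ P) (t : P ⟶ U.X₃),
      QuasiIso q ∧ s ≫ t = 0 ∧ q ≫ t = U.g ∧ U.f ≫ q = κ ≫ s := by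
  have := HasDerivedCategory.standard C
  let f : U ⟶ ShortComplex.mk (pushout.inr U.f κ) (pushout.desc U.g 0 (by simp))
      (pushout.inr_desc ..) :=
    { τ₁ := κ, τ₂ := pushout.inl U.f κ, τ₃ := 𝟙 _
      comm₁₂ := pushout.condition.symm
      comm₂₃ := (pushout.inl_desc ..).trans (Category.comp_id _).symm }
  have hq' : QuasiIso (pushout.inl U.f κ) := by
    rw [← isIso_Q_map_iff_quasiIso] at hκ ⊢
    -- The pushout changes the outer terms by a quasi-isomorphism and an identity, so the
    -- two-out-of-three property for triangles handles the middle.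
    exact Pretriangulated.isIso₂_of_isIso₁₃ (triangleOfSES.map hU (hU.pushout κ) f)
      (triangleOfSES_distinguished hU) (triangleOfSES_distinguished (hU.pushout κ)) hκ
      (inferInstanceAs (IsIso (Q.map (𝟙 _))))
  exact ⟨_, pushout.inl U.f κ, pushout.inr U.f κ, pushout.desc U.g 0 (by simp), hq',
    pushout.inr_desc .., pushout.inl_desc .., pushout.condition⟩

/-- Extending a cocycle on the middle term of a short exact sequence to a complex
quasi-isomorphic to the last term. -/
lemma exists_leaf [HasDerivedCategory.{w''} C] {U : ShortComplex (CochainComplex C ℤ)}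
    (hU : U.ShortExact) {J : CochainComplex C ℤ} [J.IsKInjective] (ζ : Cocycle U.X₂ J 2)
    (hζ : ((Cocycle.ofHom U.f).comp ζ (zero_add 2)).cl = 0) :
    ∃ (P : CochainComplex C ℤ) (r : U.X₂ ⟶ P) (d : P ⟶ U.X₃) (β : Cocycle P J 2),
      QuasiIso d ∧ r ≫ d = U.g ∧ (Cochain.ofHom r).comp β.1 (zero_add 2) = ζ.1 := by
  -- A cocycle on the cone of `U.f` extending `ζ` is a null-homotopy of the restriction of `ζ` to
  -- the first term; `η` is that null-homotopy, and K-injectivity of `J` provides it. In degree 2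
  -- the sign in the cocycle condition is trivial.
  obtain ⟨η, hη⟩ := Cocycle.exists_of_cl_eq_zero hζ 1 rfl
  refine ⟨mappingCone U.f, mappingCone.inr U.f, mappingCone.descShortComplex U,
    mappingCone.descCocycle U.f η ζ rfl ?_, mappingCone.quasiIso_descShortComplex hU,
    mappingCone.inr_descShortComplex _, mappingCone.inr_descCochain _ _ _ rfl⟩
  rw [hη, Int.negOnePow_even 2 ⟨1, rfl⟩, one_smul]
  rfl

/-! ### Comparing shifted morphisms with Ext groups. -/

namespace CategoryTheory.ShiftedHom

variable {D : Type*} [Category* D] [HasShift D ℤ] {X Y Z X' Y' Z' : D}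

/-- Transport of shifted morphisms along isomorphisms. -/
noncomputable def conj (e : X ≅ X') (e' : Y ≅ Y') {n : ℤ} (f : ShiftedHom X Y n) :
    ShiftedHom X' Y' n := e.inv ≫ f ≫ e'.hom⟦n⟧'

lemma conj_comp (e : X ≅ X') (e' : Y ≅ Y') (e'' : Z ≅ Z') {a b c : ℤ} (f : ShiftedHom X Y a)
    (g : ShiftedHom Y Z b) (h : b + a = c) :
    conj e e'' (f.comp g h) = (conj e e' f).comp (conj e' e'' g) h := by
  have := (shiftFunctorAdd' D b a c h).inv.naturality e''.hom
  simp only [Functor.comp_map] at this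
  simp [conj, ShiftedHom.comp, this]

lemma conj_mk₀ (e : X ≅ X') (e' : Y ≅ Y') (f : X ⟶ Y) :
    conj e e' (mk₀ (0 : ℤ) rfl f) = mk₀ 0 rfl (e.inv ≫ f ≫ e'.hom) := by
  have := ((shiftFunctorZero' D (0 : ℤ) rfl).inv.naturality e'.hom).symm
  simp only [Functor.id_obj, Functor.id_map] at this
  simp [conj, mk₀, this]

lemma conj_bijective (e : X ≅ X') (e' : Y ≅ Y') (n : ℤ) :
    Function.Bijective (conj e e' (n := n)) := by
  refine ⟨fun f g h => ?_, fun f => ⟨conj e.symm e'.symm f, ?_⟩⟩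
  · rw [conj, conj, cancel_epi, cancel_mono] at h
    exact h
  · simp [conj, ← Functor.map_comp]

end CategoryTheory.ShiftedHom

namespace CochainComplex

variable {R : Type u} [CommRing R] [Linear R C] [HasDerivedCategory.{w''} C] [HasExt.{w'} C]
  {P P' P'' : CochainComplex C ℤ} {A A' A'' : C}

/-- The class in `Ext` of a shifted morphism between complexes identified in the derived
category with objects. -/
noncomputable def toExt (e : Q.obj P ≅ Q.obj ((CochainComplex.singleFunctor C 0).obj A))
    (e' : Q.obj P' ≅ Q.obj ((CochainComplex.singleFunctor C 0).obj A')) {n : ℕ} {m : ℤ}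
    (h : (n : ℤ) = m) :
    ShiftedHom (Q.obj P) (Q.obj P') m ≃ₗ[R] Ext A A' n := by
  subst h
  exact (LinearEquiv.ofBijective
    (M₂ := ShiftedHom ((DerivedCategory.singleFunctor C 0).obj A)
      ((DerivedCategory.singleFunctor C 0).obj A') (n : ℤ))
    { toFun := ShiftedHom.conj e e'
      map_add' := fun f g => by simp [ShiftedHom.conj]; rfl
      map_smul' := fun r f => by simp [ShiftedHom.conj]; rfl }
      (ShiftedHom.conj_bijective e e' n)).trans (Ext.homLinearEquiv (R := R)).symm

variable (R) in
lemma toExt_hom (e : Q.obj P ≅ Q.obj ((CochainComplex.singleFunctor C 0).obj A))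
    (e' : Q.obj P' ≅ Q.obj ((CochainComplex.singleFunctor C 0).obj A')) (n : ℕ)
    (f : ShiftedHom (Q.obj P) (Q.obj P') (n : ℤ)) :
    (toExt (R := R) e e' rfl f).hom = ShiftedHom.conj e e' f :=
  (Ext.homLinearEquiv (R := R)).apply_symm_apply _

variable (R) in
lemma toExt_comp (e : Q.obj P ≅ Q.obj ((CochainComplex.singleFunctor C 0).obj A))
    (e' : Q.obj P' ≅ Q.obj ((CochainComplex.singleFunctor C 0).obj A'))
    (e'' : Q.obj P'' ≅ Q.obj ((CochainComplex.singleFunctor C 0).obj A''))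
    {a b c : ℕ} {a' b' c' : ℤ} (ha : (a : ℤ) = a') (hb : (b : ℤ) = b') (hc : (c : ℤ) = c')
    (f : ShiftedHom (Q.obj P) (Q.obj P') a') (g : ShiftedHom (Q.obj P') (Q.obj P'') b')
    (h : a + b = c) (h' : b' + a' = c') :
    toExt (R := R) e e'' hc (f.comp g h') =
      (toExt (R := R) e e' ha f).comp (toExt (R := R) e' e'' hb g) h := by
  subst ha hb hc
  ext
  rw [toExt_hom, ShiftedHom.conj_comp e e', Ext.comp_hom, toExt_hom, toExt_hom]
  rfl

variable (R) in
lemma toExt_cl_ofHom (e : Q.obj P ≅ Q.obj ((CochainComplex.singleFunctor C 0).obj A))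
    (e' : Q.obj P' ≅ Q.obj ((CochainComplex.singleFunctor C 0).obj A')) (f : P ⟶ P') (g : A ⟶ A')
    (h : Q.map f ≫ e'.hom = e.hom ≫ Q.map ((CochainComplex.singleFunctor C 0).map g)) :
    toExt (R := R) e e' Nat.cast_zero (Cocycle.ofHom f).cl = Ext.mk₀ g := by
  ext
  rw [Cocycle.cl_ofHom, Ext.mk₀_hom]
  refine (toExt_hom R e e' 0 _).trans ?_
  erw [ShiftedHom.conj_mk₀, h, e.inv_hom_id_assoc]
  rfl

lemma isGen_of_toExt (e : Q.obj P ≅ Q.obj ((CochainComplex.singleFunctor C 0).obj A))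
    (e' : Q.obj P' ≅ Q.obj ((CochainComplex.singleFunctor C 0).obj A')) {n : ℕ} {m : ℤ}
    (hm : (n : ℤ) = m) {f : ShiftedHom (Q.obj P) (Q.obj P') m}
    (h : IsGen R (toExt (R := R) e e' hm f)) : IsGen R f := by
  simpa using h.of_bijective (toExt (R := R) e e' hm).symm.toLinearMap
    (toExt (R := R) e e' hm).symm.bijective

/-- Ext groups cover degrees at least zero; in negative degrees the canonical t-structure forbids
morphisms between objects concentrated in degree zero. -/
lemma subsingleton_shiftedHom (e : Q.obj P ≅ Q.obj ((CochainComplex.singleFunctor C 0).obj A))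
    (e' : Q.obj P' ≅ Q.obj ((CochainComplex.singleFunctor C 0).obj A')) (n : ℤ)
    (h : ∀ m : ℕ, (m : ℤ) = n → Subsingleton (Ext A A' m)) :
    Subsingleton (ShiftedHom (Q.obj P) (Q.obj P') n) := by
  rcases lt_or_ge n 0 with hn | hn
  · suffices ∀ f : ShiftedHom (Q.obj P) (Q.obj P') n, f = 0 from
      ⟨fun f g => (this f).trans (this g).symm⟩
    intro f
    have h₁ : (Q.obj P).IsLE 0 := TStructure.t.isLE_of_iso
      (show (DerivedCategory.singleFunctor C 0).obj A ≅ Q.obj P from e.symm) 0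
    have h₂ : (Q.obj P').IsGE 0 := TStructure.t.isGE_of_iso
      (show (DerivedCategory.singleFunctor C 0).obj A' ≅ Q.obj P' from e'.symm) 0
    have h₃ := TStructure.t.isGE_shift (Q.obj P') 0 n (-n)
    exact TStructure.t.zero f 0 (-n)
  · lift n to ℕ using hn
    have := h n rfl
    exact (toExt (R := ℤ) e e' rfl).injective.subsingleton

end CochainComplex

end Leaves

/-! ### Construction of the star cocycles. -/

section

open CochainComplex HomComplex DerivedCategory Abelian

variable {C : Type w} [Category.{v} C] [Abelian C] {R : Type u} [CommRing R] [Linear R C]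
  [HasDerivedCategory.{w''} C] [HasExt.{w'} C]

/-- The objects at the vertices of a star. -/
abbrev starObj {ι : Type*} (O : C) (W : ι → C) : Option ι → C
  | none => O
  | some i => W i

omit [HasDerivedCategory C] in
lemma isGen_ext_mk₀ {A B : C} {φ : A ⟶ B} : IsGen R (Ext.mk₀ φ : Ext A B 0) ↔ IsGen R φ := by
  let e := Ext.linearEquiv₀ (R := R) (X := A) (Y := B)
  refine ⟨fun h => ?_, fun h => h.of_bijective e.symm.toLinearMap e.symm.bijective⟩
  have := h.of_bijective e.toLinearMap e.bijective
  rwa [show e.toLinearMap (Ext.mk₀ φ) = φ from e.apply_symm_apply φ] at this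

/-- The centre contains `J`, a resolution of `T.X₁`, and maps to `T.X₃` with exact composite zero.
The class ζ becomes a cocycle from `T.X₃` to `J`, and each leaf is a cone to which this cocycle
extends strictly, not merely up to homotopy. -/
theorem exists_starCocycles [EnoughInjectives C] (T : ShortComplex C) (hT : T.ShortExact)
    {ι : Type*} (L : ι → C) (W : ι → C) (j : ∀ i, L i ⟶ T.X₃) (a : ∀ i, T.X₃ ⟶ W i)
    (ja : ∀ i, j i ≫ a i = 0) (hL : ∀ i, (ShortComplex.mk (j i) (a i) (ja i)).ShortExact)
    (ζ : Ext T.X₃ T.X₁ 2) (hζ : IsGen R ((Ext.mk₀ T.g).comp (ζ.comp (Ext.mk₀ T.f) (add_zero 2))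
      (zero_add 2)))
    (hL' : ∀ i, Subsingleton (Ext (L i) T.X₁ 2))
    (h₀₀ : ∀ n, n ≠ 0 → n ≠ 2 → Subsingleton (Ext T.X₂ T.X₂ n)) (h₀ : IsGen R (𝟙 T.X₂))
    (h₀₁ : ∀ i n, n ≠ 0 → Subsingleton (Ext T.X₂ (W i) n))
    (ha : ∀ i, IsGen R (T.g ≫ a i))
    (h₁₀ : ∀ i n, n ≠ 2 → Subsingleton (Ext (W i) T.X₂ n))
    (hb : ∀ i, Function.Bijective fun x : Ext (W i) T.X₂ 2 =>
      (Ext.mk₀ (T.g ≫ a i)).comp x (zero_add 2))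
    (h₁₁ : ∀ i k n, ¬ (n = 0 ∧ i = k) → Subsingleton (Ext (W i) (W k) n))
    (h₁ : ∀ i, IsGen R (𝟙 (W i))) :
    ∃ (P : Option ι → CochainComplex C ℤ) (c : StarCocycles P), (c.strictFamily R).IsModel ∧
      ∀ k, Nonempty (Q.obj (P k) ≅
        Q.obj ((CochainComplex.singleFunctor C 0).obj (starObj T.X₂ W k))) := by
  have hST := shortExact_map_single T hT
  let J := (injectiveResolution T.X₁).cochainComplex
  let κ : (CochainComplex.singleFunctor C 0).obj T.X₁ ⟶ J := (injectiveResolution T.X₁).ι'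
  obtain ⟨P₀, q, s, t, hq, hst, hqt, hiq⟩ :=
    exists_center hST (J := J) κ (inferInstanceAs (QuasiIso (injectiveResolution T.X₁).ι'))
  change (CochainComplex.singleFunctor C 0).obj T.X₂ ⟶ P₀ at q
  change P₀ ⟶ (CochainComplex.singleFunctor C 0).obj T.X₃ at t
  change s ≫ t = 0 at hst
  change q ≫ t = (CochainComplex.singleFunctor C 0).map T.g at hqt
  change (CochainComplex.singleFunctor C 0).map T.f ≫ q = κ ≫ s at hiq
  have : J.IsKInjective := inferInstance
  have hκ : IsIso (Q.map κ) := (isIso_Q_map_iff_quasiIso _ _).2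
    (inferInstanceAs (QuasiIso (injectiveResolution T.X₁).ι'))
  have : IsIso (Q.map q) := (isIso_Q_map_iff_quasiIso _ _).2 hq
  let eJ : Q.obj J ≅ Q.obj ((CochainComplex.singleFunctor C 0).obj T.X₁) := (asIso (Q.map κ)).symm
  let e₀ : Q.obj P₀ ≅ Q.obj ((CochainComplex.singleFunctor C 0).obj T.X₂) :=
    (asIso (Q.map q)).symm
  let eS (A : C) : Q.obj ((CochainComplex.singleFunctor C 0).obj A) ≅
    Q.obj ((CochainComplex.singleFunctor C 0).obj A) := Iso.refl _
  obtain ⟨z, hz⟩ := Cocycle.exists_cl_eq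
    ((toExt (R := R) (eS T.X₃) eJ (show ((2 : ℕ) : ℤ) = 2 from rfl)).symm ζ)
  replace hz : toExt (R := R) (eS T.X₃) eJ (show ((2 : ℕ) : ℤ) = 2 from rfl) z.cl = ζ := by
    rw [hz, LinearEquiv.apply_symm_apply]
  -- The obstruction on `L i` lies in Ext² from `L i` to `T.X₁`, which vanishes by assumption.
  have hjz : ∀ i, ((Cocycle.ofHom ((CochainComplex.singleFunctor C 0).map (j i))).comp z
      (zero_add 2)).cl = 0 := fun i => by
    apply (toExt (R := R) (eS (L i)) eJ (show ((2 : ℕ) : ℤ) = 2 from rfl)).injective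
    exact (hL' i).elim _ _
  choose P₁ r d β hd hrd hβ using fun i =>
    exists_leaf (shortExact_map_single _ (hL i)) z (hjz i)
  change ∀ i, (CochainComplex.singleFunctor C 0).obj T.X₃ ⟶ P₁ i at r
  change ∀ i, P₁ i ⟶ (CochainComplex.singleFunctor C 0).obj (W i) at d
  change ∀ i, r i ≫ d i = (CochainComplex.singleFunctor C 0).map (a i) at hrd
  have : ∀ i, IsIso (Q.map (d i)) := fun i => (isIso_Q_map_iff_quasiIso _ _).2 (hd i)
  let e₁ (i : ι) : Q.obj (P₁ i) ≅ Q.obj ((CochainComplex.singleFunctor C 0).obj (W i)) :=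
    asIso (Q.map (d i))
  have ht : Q.map t ≫ (eS T.X₃).hom =
      e₀.hom ≫ Q.map ((CochainComplex.singleFunctor C 0).map T.g) := by
    simp only [eS, e₀, Iso.refl_hom, Category.comp_id, Iso.symm_hom, asIso_inv,
      IsIso.eq_inv_comp, ← Functor.map_comp, hqt]
  have hs : Q.map s ≫ e₀.hom = eJ.hom ≫ Q.map ((CochainComplex.singleFunctor C 0).map T.f) := by
    simp only [eJ, e₀, Iso.symm_hom, asIso_inv, IsIso.eq_inv_comp]
    rw [← Category.assoc, IsIso.comp_inv_eq, ← Q.map_comp, ← Q.map_comp, hiq]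
  have hα : ∀ i, Q.map (t ≫ r i) ≫ (e₁ i).hom =
      e₀.hom ≫ Q.map ((CochainComplex.singleFunctor C 0).map (T.g ≫ a i)) := fun i => by
    simp only [e₁, e₀, Iso.symm_hom, asIso_inv, asIso_hom, IsIso.eq_inv_comp]
    rw [← Q.map_comp, ← Q.map_comp, Category.assoc, hrd, ← Category.assoc, hqt,
      ← Functor.map_comp]
  let P : Option ι → CochainComplex C ℤ
    | none => P₀
    | some i => P₁ i
  let e : ∀ k, Q.obj (P k) ≅ Q.obj ((CochainComplex.singleFunctor C 0).obj (starObj T.X₂ W k))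
    | none => e₀
    | some i => e₁ i
  -- Every product that should vanish passes through `s` followed by `t`; this one computation gives
  -- all relations of the star except `α_β`.
  have hzero : ∀ {F G : CochainComplex C ℤ} {a b a' b' n : ℤ} (x : Cochain F J a)
      (y : Cochain ((CochainComplex.singleFunctor C 0).obj T.X₃) G b) (h : a + 0 = a')
      (h' : 0 + b = b') (hn : a' + b' = n),
      (x.comp (Cochain.ofHom s) h).comp ((Cochain.ofHom t).comp y h') hn = 0 := by
    intro F G a b a' b' n x y h h' hn
    obtain rfl : a = a' := by lia
    obtain rfl : b = b' := by lia
    rw [Cochain.comp_assoc_of_second_is_zero_cochain,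
      ← Cochain.comp_assoc_of_first_is_zero_cochain, ← Cochain.ofHom_comp, hst]
    simp
  let c : StarCocycles P :=
    { α := fun i => Cocycle.ofHom (t ≫ r i)
      β := fun i => (β i).comp (Cocycle.ofHom s) (add_zero 2)
      ω := (Cocycle.ofHom t).comp (z.comp (Cocycle.ofHom s) (add_zero 2)) (zero_add 2)
      α_β := fun i => by
        rw [Cocycle.comp_coe, Cocycle.comp_coe, Cocycle.comp_coe]
        change (Cochain.ofHom (t ≫ r i)).comp ((β i).1.comp (Cochain.ofHom s) _) _ =
          (Cochain.ofHom t).comp (z.1.comp (Cochain.ofHom s) _) _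
        rw [← hβ i, Cochain.ofHom_comp]
        simp only [Cochain.comp_assoc_of_first_is_zero_cochain]
        congr 1
        exact (Cochain.comp_assoc_of_first_is_zero_cochain ..).symm
      β_α := fun i k => by
        have := hzero (β i).1 (Cochain.ofHom (r k)) (add_zero 2) (add_zero 0) (add_zero 2)
        rwa [← Cochain.ofHom_comp] at this
      ω_ω := by
        have := hzero ((Cochain.ofHom t).comp z.1 (zero_add 2)) (z.1.comp (Cochain.ofHom s)
          (add_zero 2)) (add_zero 2) (zero_add 2) rfl
        rwa [Cochain.comp_assoc_of_first_is_zero_cochain] at this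
      ω_α := fun i => by
        have := hzero ((Cochain.ofHom t).comp z.1 (zero_add 2)) (Cochain.ofHom (r i))
          (add_zero 2) (add_zero 0) (add_zero 2)
        rwa [← Cochain.ofHom_comp, Cochain.comp_assoc_of_first_is_zero_cochain] at this
      β_ω := fun i => hzero (β i).1 (z.1.comp (Cochain.ofHom s) (add_zero 2)) (add_zero 2)
        (zero_add 2) rfl }
  have hα' : ∀ i, toExt (R := R) e₀ (e₁ i) Nat.cast_zero (c.α i).cl = Ext.mk₀ (T.g ≫ a i) :=
    fun i => toExt_cl_ofHom R _ _ _ _ (hα i)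
  have hω' : toExt (R := R) e₀ e₀ (show ((2 : ℕ) : ℤ) = 2 from rfl) c.ω.cl =
      (Ext.mk₀ T.g).comp (ζ.comp (Ext.mk₀ T.f) (add_zero 2)) (zero_add 2) := by
    rw [← toExt_cl_ofHom R _ _ _ _ ht, ← toExt_cl_ofHom R _ _ _ _ hs, ← hz,
      ← toExt_comp R (eS _) eJ e₀ (a' := 2) (b' := 0) rfl rfl rfl _ _ _ (by lia),
      ← toExt_comp R e₀ (eS _) e₀ (a' := 0) (b' := 2) rfl rfl rfl _ _ _ (by lia)]
    congr 1
    exact (Cocycle.cl_comp _ _ _).trans (by rw [Cocycle.cl_comp])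
  have hω : IsGen R c.ω.cl := isGen_of_toExt e₀ e₀ (show ((2 : ℕ) : ℤ) = 2 from rfl) (by
    rw [hω']; exact hζ)
  refine ⟨P, c, StarCocycles.isModel_strictFamily ?_ ?_ ?_ ?_ ?_ ?_ ?_ hω, fun k => ⟨e k⟩⟩
  · intro n h0 h2
    exact subsingleton_shiftedHom e₀ e₀ n fun m hm => h₀₀ m (by lia) (by lia)
  · intro i n h0
    exact subsingleton_shiftedHom e₀ (e₁ i) n fun m hm => h₀₁ i m (by lia)
  · intro i n h2
    exact subsingleton_shiftedHom (e₁ i) e₀ n fun m hm => h₁₀ i m (by lia)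
  · intro i k n h
    exact subsingleton_shiftedHom (e₁ i) (e₁ k) n fun m hm => h₁₁ i k m (by lia)
  · intro k
    refine isGen_of_toExt (e k) (e k) Nat.cast_zero ?_
    rw [toExt_cl_ofHom R (e k) (e k) (𝟙 _) (𝟙 _) (by simp), isGen_ext_mk₀]
    cases k with
    | none => exact h₀
    | some i => exact h₁ i
  · intro i
    refine isGen_of_toExt e₀ (e₁ i) Nat.cast_zero ?_
    rw [hα', isGen_ext_mk₀]
    exact ha i
  · intro i
    refine isGen_of_toExt (e₁ i) e₀ (show ((2 : ℕ) : ℤ) = 2 from rfl) ?_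
    -- Precomposition with evaluation is bijective and sends the class of β_i to that of ω, so β_i
    -- is a generator because ω is.
    let φ : Ext (W i) T.X₂ 2 →ₗ[R] Ext T.X₂ T.X₂ 2 :=
      Ext.precompOfLinear (Ext.mk₀ (T.g ≫ a i)) R T.X₂ (zero_add 2)
    let φ' := LinearEquiv.ofBijective φ (hb i)
    have h : φ' (toExt (R := R) (e₁ i) e₀ (show ((2 : ℕ) : ℤ) = 2 from rfl) (c.β i).cl) =
        (Ext.mk₀ T.g).comp (ζ.comp (Ext.mk₀ T.f) (add_zero 2)) (zero_add 2) := by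
      rw [← hω']
      change (Ext.mk₀ (T.g ≫ a i)).comp _ (zero_add 2) = _
      rw [← hα', ← toExt_comp R e₀ (e₁ i) e₀ (a' := 0) (b' := 2) rfl rfl rfl _ _ _ (by lia)]
      congr 1
      have h3 : (c.α i).comp (c.β i) (zero_add 2) = c.ω := Subtype.ext (c.α_β i)
      exact (Cocycle.cl_comp (c.α i) (c.β i) (zero_add 2)).symm.trans (congrArg Cocycle.cl h3)
    have := hζ.of_bijective φ'.symm.toLinearMap φ'.symm.bijective
    rw [← h] at this
    simpa using this

end

/-! ### The sum with one shifted summand. -/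

namespace CochainComplex.HomComplex

open DerivedCategory

variable {C : Type w} [Category.{v} C]

section

variable [Preadditive C] (K : CochainComplex C ℤ)

/-- The tautological cocycle of degree `-1` from a complex to its shift. -/
def toShift : Cocycle K (K⟦(1 : ℤ)⟧) (-1) := (Cocycle.ofHom (𝟙 K)).rightShift 1 (-1) (by lia)

/-- The tautological cocycle of degree `1` from the shift of a complex to the complex. -/
def ofShift : Cocycle (K⟦(1 : ℤ)⟧) K 1 :=
  (Cocycle.ofHom (𝟙 (K⟦(1 : ℤ)⟧))).rightUnshift 1 (by lia)

lemma toShift_v (p q : ℤ) (h : p + -1 = q) :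
    (toShift K).1.v p q h = (K.shiftFunctorObjXIso 1 q p (by lia)).inv := by
  simp [toShift, (Cochain.ofHom (𝟙 K)).rightShift_v 1 (-1) (by lia) p q h p (by lia)]

lemma ofShift_v (p q : ℤ) (h : p + 1 = q) :
    (ofShift K).1.v p q h = (K.shiftFunctorObjXIso 1 p q (by lia)).hom := by
  simp [ofShift, (Cochain.ofHom (𝟙 (K⟦(1 : ℤ)⟧))).rightUnshift_v 1 (by lia) p q h p (by lia)]

lemma toShift_ofShift :
    (toShift K).1.comp (ofShift K).1 (neg_add_cancel 1) = Cochain.ofHom (𝟙 K) := by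
  ext p
  rw [Cochain.comp_v _ _ _ p (p - 1) p (by lia) (by lia), toShift_v, ofShift_v]
  simp

lemma ofShift_toShift :
    (ofShift K).1.comp (toShift K).1 (add_neg_cancel 1) = Cochain.ofHom (𝟙 (K⟦(1 : ℤ)⟧)) := by
  ext p
  rw [Cochain.comp_v _ _ _ p (p + 1) p (by lia) (by lia), toShift_v, ofShift_v]
  simp

end

section

attribute [local instance] Abelian.hasFiniteBiproducts

variable [Abelian C] {ι : Type} [Fintype ι] (P : Option ι → CochainComplex C ℤ)

/-- The sum of a finite family of complexes and of the shift of one more. -/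
noncomputable abbrev sumShift : CochainComplex C ℤ :=
  (⨁ fun i => P (some i)) ⊞ (P none)⟦(1 : ℤ)⟧

/-- The inclusion of a summand. -/
noncomputable abbrev sumShiftι (i : ι) : P (some i) ⟶ sumShift P :=
  biproduct.ι (fun i => P (some i)) i ≫ biprod.inl

/-- The projection to a summand. -/
noncomputable abbrev sumShiftπ (i : ι) : sumShift P ⟶ P (some i) :=
  biprod.fst ≫ biproduct.π (fun i => P (some i)) i

/-- The inclusion of the shifted summand. -/
noncomputable abbrev sumShiftInr : (P none)⟦(1 : ℤ)⟧ ⟶ sumShift P := biprod.inr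

/-- The projection to the shifted summand. -/
noncomputable abbrev sumShiftSnd : sumShift P ⟶ (P none)⟦(1 : ℤ)⟧ := biprod.snd

lemma sum_sumShiftπ_ι : ∑ i, sumShiftπ P i ≫ sumShiftι P i + sumShiftSnd P ≫ sumShiftInr P =
    𝟙 (sumShift P) := by
  rw [← biprod.total]
  congr 1
  simp only [sumShiftπ, sumShiftι, Category.assoc]
  rw [← Preadditive.comp_sum]
  congr 1
  simp only [← Category.assoc]
  rw [← Preadditive.sum_comp]
  exact (congrArg (· ≫ biprod.inl) (biproduct.total (f := fun i => P (some i)))).trans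
    (Category.id_comp _)

/-- The decomposition of the sum of a finite family of complexes and of the shift of one more. -/
noncomputable def shiftedSum : ShiftedSum P (sumShift P) where
  s := fun | none => 1 | some _ => 0
  t := fun | none => -1 | some _ => 0
  ts := fun | none => rfl | some _ => rfl
  st := fun | none => rfl | some _ => rfl
  inc := fun
    | none => (toShift (P none)).comp (Cocycle.ofHom (sumShiftInr P)) (add_zero _)
    | some i => Cocycle.ofHom (sumShiftι P i)
  prj := fun
    | none => (Cocycle.ofHom (sumShiftSnd P)).comp (ofShift (P none)) (zero_add _)
    | some i => Cocycle.ofHom (sumShiftπ P i)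
  inc_prj := fun
    | none => by
      change ((toShift (P none)).1.comp (Cochain.ofHom (sumShiftInr P)) (add_zero _)).comp
        ((Cochain.ofHom (sumShiftSnd P)).comp (ofShift (P none)).1 (zero_add _))
          (neg_add_cancel 1) = _
      rw [Cochain.comp_assoc_of_second_is_zero_cochain,
        ← Cochain.comp_assoc_of_first_is_zero_cochain, ← Cochain.ofHom_comp, biprod.inr_snd,
        Cochain.id_comp, toShift_ofShift]
    | some i => by
      change (Cochain.ofHom (sumShiftι P i)).comp (Cochain.ofHom (sumShiftπ P i))
        (zero_add 0) = _
      rw [← Cochain.ofHom_comp]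
      congr 1
      simp
  inc_prj_of_ne := fun
    | none, none, h => (h rfl).elim
    | none, some i, _ => by
      change ((toShift (P none)).1.comp (Cochain.ofHom (sumShiftInr P)) (add_zero _)).comp
        (Cochain.ofHom (sumShiftπ P i)) (add_zero _) = 0
      rw [Cochain.comp_assoc_of_second_is_zero_cochain, ← Cochain.ofHom_comp]
      simp
    | some i, none, _ => by
      change (Cochain.ofHom (sumShiftι P i)).comp
        ((Cochain.ofHom (sumShiftSnd P)).comp (ofShift (P none)).1 (zero_add _))
          (zero_add 1) = 0
      rw [← Cochain.comp_assoc_of_first_is_zero_cochain, ← Cochain.ofHom_comp]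
      simp
    | some i, some j, h => by
      change (Cochain.ofHom (sumShiftι P i)).comp (Cochain.ofHom (sumShiftπ P j))
        (zero_add 0) = 0
      rw [← Cochain.ofHom_comp]
      have hij : i ≠ j := fun e => h (congrArg some e)
      simp [biproduct.ι_π_ne _ hij]
  sum_prj_inc := by
    rw [Fintype.sum_option, add_comm]
    change ∑ i, (Cochain.ofHom (sumShiftπ P i)).comp (Cochain.ofHom (sumShiftι P i)) (zero_add 0) +
      ((Cochain.ofHom (sumShiftSnd P)).comp (ofShift (P none)).1 (zero_add _)).comp
        ((toShift (P none)).1.comp (Cochain.ofHom (sumShiftInr P)) (add_zero _))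
        (add_neg_cancel 1) = _
    have h : ((Cochain.ofHom (sumShiftSnd P)).comp (ofShift (P none)).1 (zero_add _)).comp
        ((toShift (P none)).1.comp (Cochain.ofHom (sumShiftInr P)) (add_zero _))
        (add_neg_cancel 1) = Cochain.ofHom (sumShiftSnd P ≫ sumShiftInr P) := by
      rw [Cochain.comp_assoc_of_first_is_zero_cochain,
        ← Cochain.comp_assoc_of_third_is_zero_cochain, ofShift_toShift, Cochain.id_comp,
        Cochain.ofHom_comp]
    rw [h, ← sum_sumShiftπ_ι]
    simp only [← Cochain.ofHom_comp]
    rw [Cochain.ofHom_add]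
    congr 1
    exact (map_sum (AddMonoidHom.mk' (fun f : sumShift P ⟶ sumShift P => Cochain.ofHom f)
      Cochain.ofHom_add) _ _).symm

end

section

variable [Abelian C] [HasDerivedCategory.{w''} C] {ι : Type} [Fintype ι]
  (P : Option ι → CochainComplex C ℤ)

attribute [local instance] Abelian.hasFiniteBiproducts

/-- Localization is additive and commutes with the shift, so isomorphisms of the summands assemble.
-/
lemma nonempty_iso_sumShift (A : Option ι → C)
    (e : ∀ k, Q.obj (P k) ≅ Q.obj ((CochainComplex.singleFunctor C 0).obj (A k))) :
    Nonempty (Q.obj (sumShift P) ≅ Q.obj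
      ((CochainComplex.singleFunctor C 0).obj (⨁ fun i => A (some i)) ⊞
        ((CochainComplex.singleFunctor C 0).obj (A none))⟦(1 : ℤ)⟧)) := by
  have : PreservesBinaryBiproducts (Q (C := C)) := preservesBinaryBiproducts_of_preservesBiproducts _
  let S := CochainComplex.singleFunctor C 0
  have : S.Additive := inferInstance
  have : (S ⋙ Q).Additive := inferInstance
  let e₁ : Q.obj (⨁ fun i => P (some i)) ≅ Q.obj (S.obj (⨁ fun i => A (some i))) :=
    Q.mapBiproduct _ ≪≫ biproduct.mapIso (fun i => e (some i)) ≪≫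
      ((S ⋙ Q).mapBiproduct (fun i => A (some i))).symm
  let e₂ : Q.obj ((P none)⟦(1 : ℤ)⟧) ≅ Q.obj ((S.obj (A none))⟦(1 : ℤ)⟧) :=
    (Q.commShiftIso (1 : ℤ)).app _ ≪≫ (CategoryTheory.shiftFunctor _ (1 : ℤ)).mapIso (e none) ≪≫
      ((Q.commShiftIso (1 : ℤ)).app _).symm
  exact ⟨Q.mapBiprod _ _ ≪≫ biprod.mapIso e₁ e₂ ≪≫ (Q.mapBiprod _ _).symm⟩

end

end CochainComplex.HomComplex

/-! ### Formality for sheaves given a hemisphere. -/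

section

open CochainComplex HomComplex DerivedCategory Abelian

attribute [local instance] Abelian.hasFiniteBiproducts

variable {C : Type w} [Category.{v} C] [Abelian C] {R : Type u} [CommRing R] [Linear R C]
  [HasExt.{w'} C]

/-- Formality of the endomorphisms of an injective resolution of `⨁ W i ⊞ O⟦1⟧`, where `O` is
the middle term of a short exact sequence. -/
theorem isFormal_endDGAlgebra [EnoughInjectives C] (T : ShortComplex C) (hT : T.ShortExact)
    {ι : Type} [Fintype ι] (L : ι → C) (W : ι → C) (j : ∀ i, L i ⟶ T.X₃) (a : ∀ i, T.X₃ ⟶ W i)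
    (ja : ∀ i, j i ≫ a i = 0) (hL : ∀ i, (ShortComplex.mk (j i) (a i) (ja i)).ShortExact)
    (ζ : Ext T.X₃ T.X₁ 2) (hζ : IsGen R ((Ext.mk₀ T.g).comp (ζ.comp (Ext.mk₀ T.f) (add_zero 2))
      (zero_add 2)))
    (hL' : ∀ i, Subsingleton (Ext (L i) T.X₁ 2))
    (h₀₀ : ∀ n, n ≠ 0 → n ≠ 2 → Subsingleton (Ext T.X₂ T.X₂ n)) (h₀ : IsGen R (𝟙 T.X₂))
    (h₀₁ : ∀ i n, n ≠ 0 → Subsingleton (Ext T.X₂ (W i) n))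
    (ha : ∀ i, IsGen R (T.g ≫ a i))
    (h₁₀ : ∀ i n, n ≠ 2 → Subsingleton (Ext (W i) T.X₂ n))
    (hb : ∀ i, Function.Bijective fun x : Ext (W i) T.X₂ 2 =>
      (Ext.mk₀ (T.g ≫ a i)).comp x (zero_add 2))
    (h₁₁ : ∀ i k n, ¬ (n = 0 ∧ i = k) → Subsingleton (Ext (W i) (W k) n))
    (h₁ : ∀ i, IsGen R (𝟙 (W i))) {I : CochainComplex C ℤ} [I.IsKInjective]
    (φ : (CochainComplex.singleFunctor C 0).obj (⨁ W) ⊞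
      ((CochainComplex.singleFunctor C 0).obj T.X₂)⟦(1 : ℤ)⟧ ⟶ I) (hφ : QuasiIso φ) :
    (endDGAlgebra R I).IsFormal := by
  have := HasDerivedCategory.standard C
  obtain ⟨P, c, hc, e⟩ := exists_starCocycles T hT L W j a ja hL ζ hζ hL' h₀₀ h₀ h₀₁ ha h₁₀ hb
    h₁₁ h₁
  obtain ⟨e'⟩ := nonempty_iso_sumShift P (starObj T.X₂ W) fun k => (e k).some
  have : IsIso (Q.map φ) := (isIso_Q_map_iff_quasiIso _ _).2 hφ
  exact hc.isFormal (shiftedSum P) (e' ≪≫ asIso (Q.map φ))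

end

namespace ModSheaf
open Abelian

variable {R : Type u} [CommRing R] {X : TopCat.{u}}
  [SphereLike X]

/-- The abstract criterion is applied to the hemisphere sequence, with the kernels of evaluation as
obstruction sheaves. A bounded below complex of injectives is K-injective, and the constant sheaf is
exchanged for the free sheaf on the whole space. -/
theorem isFormal_endDGAlgebra_of_hemisphere (E : Hemisphere X) {m : ℕ} (x : Fin m → X)
    (hx : Function.Injective x) (hl : ∀ i, x i ∉ E.lower) (hu : ∀ i, x i ∉ E.upper)
    (I : CochainComplex (ModSheaf R X) ℤ) (φ : skyscrapersPlusShiftedConst R x ⟶ I)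
    (hφ : IsInjectiveResolution φ) : (endDGAlgebra R I).IsFormal := by
  obtain ⟨ζ, hζ⟩ := E.exists_isGen (R := R)
  obtain ⟨d, hd⟩ := hφ.boundedBelow
  have := hφ.injective
  have : I.IsKInjective := CochainComplex.isKInjective_of_injective I d
  let S := CochainComplex.singleFunctor (ModSheaf R X) 0
  let e : (S.obj (⨁ fun i => skyscraper R (x i)) ⊞ (S.obj (FU R ⊤))⟦(1 : ℤ)⟧) ≅
      skyscrapersPlusShiftedConst R x :=
    biprod.mapIso (Iso.refl _)
      ((CategoryTheory.shiftFunctor _ (1 : ℤ)).mapIso (S.mapIso (constSheafIso R X).symm))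
  have hq : QuasiIso (e.hom ≫ φ) := by
    have := hφ.quasiIso
    have h : QuasiIso e.hom := ⟨fun n => by
      rw [quasiIsoAt_iff_isIso_homologyMap]
      infer_instance⟩
    exact quasiIso_comp e.hom φ
  refine isFormal_endDGAlgebra (E.seq R) (E.seq_shortExact R) (fun i => E.kerEval R (hl i))
    (fun i => skyscraper R (x i)) (fun i => E.kerEvalι R (hl i)) (fun i => E.evalZ R (hl i))
    (fun i => E.kerEvalι_evalZ R (hl i)) (fun i => E.evalSeq_shortExact R (hl i)) ζ hζ
    (fun i => E.subsingleton_ext_kerEval R (hl i) (hu i))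
    (fun n => subsingleton_ext_const_const) isGen_id_const
    (fun i n hn => subsingleton_ext_FU_skyscraper R ⊤ (x i) (Nat.one_le_iff_ne_zero.2 hn))
    (fun i => ?_) (fun i n hn => subsingleton_ext_skyscraper_const (x i) hn) (fun i => ?_)
    (fun i k n h => ?_) (fun i => isGen_id_skyscraper R (x i)) (e.hom ≫ φ) hq
  · change IsGen R (E.toZ R ≫ E.evalZ R (hl i))
    rw [E.toZ_evalZ]
    exact isGen_toSky R trivial
  · have h := bijective_extPrecomp_toSky (R := R) (x i)
    rw [← E.toZ_evalZ R (hl i)] at h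
    exact h
  · by_cases hn : n = 0
    · subst hn
      refine subsingleton_ext_zero fun φ => hom_skyscraper_skyscraper R ?_ φ
      exact fun hik => h ⟨rfl, hx hik⟩
    · exact subsingleton_ext_skyscraper R _ _ (Nat.one_le_iff_ne_zero.2 hn)

end ModSheaf

/-! ### Hemispheres adapted to finitely many points. -/

section Charts
open ModSheaf

variable {X : TopCat.{u}}

lemma ball_inter_isPreconnected (v : ℝ × ℝ) (r : ℝ) :
    _root_.IsPreconnected (Metric.ball v r ∩ {w | 0 < w.2}) :=
  ((convex_ball v r).inter (convex_halfSpace_gt (f := fun w : ℝ × ℝ => w.2)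
    (LinearMap.snd ℝ ℝ ℝ).isLinear 0)).isPreconnected

/-- In the sup norm the ball is a square, so the region is the union of convex pieces to its right,
above it and to its left, the upper piece meeting the other two. Using `max r 0` also covers
negative radii. -/
lemma compl_closedBall_inter_isPreconnected (r : ℝ) :
    _root_.IsPreconnected ((Metric.closedBall (0 : ℝ × ℝ) r)ᶜ ∩ {w | 0 < w.2}) := by
  have c : ∀ A B : Set ℝ, Convex ℝ A → Convex ℝ B → _root_.IsPreconnected (A ×ˢ B) :=
    fun A B hA hB => (hA.prod hB).isPreconnected
  have hr : r < max r 0 + 1 := (le_max_left r 0).trans_lt (lt_add_one _)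
  have hr' : 0 < max r 0 + 1 := (le_max_right r 0).trans_lt (lt_add_one _)
  have e : (Metric.closedBall (0 : ℝ × ℝ) r)ᶜ ∩ {w | 0 < w.2} =
      (Set.Ioi r ×ˢ Set.Ioi 0 ∪ Set.univ ×ˢ Set.Ioi (max r 0)) ∪ Set.Iio (-r) ×ˢ Set.Ioi 0 := by
    ext w
    simp only [Set.mem_inter_iff, Set.mem_compl_iff, Metric.mem_closedBall, dist_zero_right,
      not_le, Set.mem_ofPred_eq, Set.mem_union, Set.mem_prod, Set.mem_Ioi, Set.mem_univ, true_and,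
      Set.mem_Iio, Prod.norm_def, Real.norm_eq_abs, lt_max_iff, lt_abs, max_lt_iff]
    constructor
    · rintro ⟨(h | h) | (h | h), h0⟩
      · exact .inl (.inl ⟨h, h0⟩)
      · exact .inr ⟨by linarith, h0⟩
      · exact .inl (.inr ⟨h, h0⟩)
      · exact .inl (.inr ⟨by linarith, h0⟩)
    · rintro ((⟨h, h0⟩ | ⟨h, h0⟩) | ⟨h, h0⟩)
      · exact ⟨.inl (.inl h), h0⟩
      · exact ⟨.inr (.inl h), h0⟩
      · exact ⟨.inl (.inr (by linarith)), h0⟩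
  rw [e]
  refine ((c _ _ (convex_Ioi r) (convex_Ioi 0)).union (r + 1, max r 0 + 1) ?_ ?_
    (c _ _ convex_univ (convex_Ioi _))).union (-r - 1, max r 0 + 1) (.inr ?_) ?_
      (c _ _ (convex_Iio (-r)) (convex_Ioi 0))
  · exact ⟨lt_add_one r, hr'⟩
  · exact ⟨trivial, lt_add_one (max r 0)⟩
  · exact ⟨trivial, lt_add_one (max r 0)⟩
  · exact ⟨sub_one_lt (-r), hr'⟩

/-- A chart covering the complement of a point. -/
def hemisphereOfChart [T2Space X] [CompactSpace X] (f : ℝ × ℝ → X)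
    (hf : Topology.IsOpenEmbedding f) (y : X) (hy : Set.range f = {y}ᶜ) : Hemisphere X := by
  -- Neighbourhoods of the missing point contain everything far out in the chart: their complements
  -- are compact and hence bounded in the plane.
  have hlarge : ∀ V : Opens X, y ∈ V → ∃ r : ℝ, ∀ v, r < ‖v‖ → f v ∈ V := by
    intro V hV
    have h1 : IsCompact (f ⁻¹' (V : Set X)ᶜ) := by
      refine hf.isInducing.isCompact_preimage' V.2.isClosed_compl.isCompact ?_
      rw [hy]
      exact fun z hz hzy => hz (hzy ▸ hV)
    obtain ⟨r, hr⟩ := h1.isBounded.exists_norm_le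
    exact ⟨r, fun v hv => by_contra fun h => absurd (hr v h) (not_le.2 hv)⟩
  have hcases : ∀ z : X, z = y ∨ ∃ v, f v = z := fun z => by
    by_cases h : z = y
    · exact .inl h
    · exact .inr (by rw [← Set.mem_range, hy]; exact h)
  refine ⟨f, hf, fun V => ⟨fun h => ?_, fun h z hz => ?_⟩, fun z hz V hzV => ?_⟩
  · rw [eq_bot_iff]
    rintro z ⟨hz, v, hv, rfl⟩
    have h1 := (mem_box hf).1 (h hz)
    exact lt_asymm (Set.mem_Ioi.1 hv.2) h1.2
  · have h0 : ∀ v : ℝ × ℝ, 0 < v.2 → f v ∉ V := fun v hv hvV => by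
      have h2 : f v ∈ V ⊓ box hf ⊤ pos := ⟨hvV, (mem_box hf).2 ⟨trivial, hv⟩⟩
      rw [h] at h2
      exact h2
    obtain rfl | ⟨v, rfl⟩ := hcases z
    · obtain ⟨r, hr⟩ := hlarge V hz
      refine (h0 (0, |r| + 1) (by positivity) (hr _ ?_)).elim
      have := le_abs_self r
      have h3 := norm_snd_le ((0, |r| + 1) : ℝ × ℝ)
      rw [Real.norm_of_nonneg (by positivity)] at h3
      simp only at h3
      linarith
    · refine (mem_box hf).2 ⟨trivial, ?_⟩
      by_contra hv
      replace hv : 0 ≤ v.2 := not_lt.1 hv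
      obtain ⟨ε, hε, h3⟩ := Metric.isOpen_iff.1 (V.2.preimage hf.continuous) v hz
      refine h0 (v.1, v.2 + ε / 2) (by simp only; linarith) (h3 ?_)
      rw [Metric.mem_ball, Prod.dist_eq]
      simp [abs_of_pos hε, hε]
  · obtain rfl | ⟨v, rfl⟩ := hcases z
    · obtain ⟨r, hr⟩ := hlarge V hzV
      -- At the missing point, the outside of a large ball is a neighbourhood whose trace on the
      -- upper half-plane is connected.
      let N : Opens X := ⟨(f '' Metric.closedBall 0 r)ᶜ,
        ((isCompact_closedBall 0 r).image hf.continuous).isClosed.isOpen_compl⟩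
      refine ⟨N, fun a ha => ?_, ?_, ?_⟩
      · obtain rfl | ⟨v, rfl⟩ := hcases a
        · exact hzV
        · refine hr v (not_le.1 fun h => ha ⟨v, ?_, rfl⟩)
          simpa using h
      · rintro ⟨v, -, hv⟩
        have : f v ∈ Set.range f := ⟨v, rfl⟩
        rw [hy] at this
        exact this hv
      · have : ((N ⊓ box hf ⊤ pos : Opens X) : Set X) =
            f '' ((Metric.closedBall (0 : ℝ × ℝ) r)ᶜ ∩ {w | 0 < w.2}) := by
          ext a
          constructor
          · rintro ⟨h1, v, hv, rfl⟩
            exact ⟨v, ⟨fun h => h1 ⟨v, h, rfl⟩, hv.2⟩, rfl⟩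
          · rintro ⟨v, ⟨h1, h2⟩, rfl⟩
            refine ⟨?_, (mem_box hf).2 ⟨trivial, h2⟩⟩
            rintro ⟨w, hw, hwv⟩
            exact h1 (hf.injective hwv ▸ hw)
        rw [this]
        exact (compl_closedBall_inter_isPreconnected r).image _ hf.continuous.continuousOn
    · obtain ⟨ε, hε, h3⟩ := Metric.isOpen_iff.1 (V.2.preimage hf.continuous) v hzV
      refine ⟨⟨f '' Metric.ball v ε, hf.isOpenMap _ Metric.isOpen_ball⟩, ?_,
        ⟨v, Metric.mem_ball_self hε, rfl⟩, ?_⟩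
      · rintro _ ⟨w, hw, rfl⟩
        exact h3 hw
      · have : ((⟨f '' Metric.ball v ε, hf.isOpenMap _ Metric.isOpen_ball⟩ ⊓ box hf ⊤ pos :
            Opens X) : Set X) = f '' (Metric.ball v ε ∩ {w | 0 < w.2}) := by
          ext a
          constructor
          · rintro ⟨⟨w, hw, hwv⟩, v', hv, rfl⟩
            exact ⟨v', ⟨hf.injective hwv ▸ hw, hv.2⟩, rfl⟩
          · rintro ⟨w, ⟨h1, h2⟩, rfl⟩
            exact ⟨⟨w, h1, rfl⟩, (mem_box hf).2 ⟨trivial, h2⟩⟩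
        rw [this]
        exact (ball_inter_isPreconnected v ε).image _ hf.continuous.continuousOn

/-- A shear makes the first coordinates distinct; subtracting the interpolation polynomial of the
second coordinates then puts all points on the axis. -/
lemma exists_homeomorph_snd_eq_zero {ι : Type*} [Finite ι] (v : ι → ℝ × ℝ)
    (hv : Function.Injective v) : ∃ h : ℝ × ℝ ≃ₜ ℝ × ℝ, ∀ i, (h (v i)).2 = 0 := by
  cases nonempty_fintype ι
  -- For each pair at most one shear parameter makes the first coordinates collide, so some real
  -- number avoids all collisions.
  have hbad : (⋃ i, ⋃ j, {c : ℝ | i ≠ j ∧ (v i).1 + c * (v i).2 = (v j).1 + c * (v j).2}).Finite := by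
    refine Set.finite_iUnion fun i => Set.finite_iUnion fun j => Set.Subsingleton.finite ?_
    rintro c ⟨hij, hc⟩ c' ⟨-, hc'⟩
    by_contra hcc
    have h1 : (c - c') * ((v i).2 - (v j).2) = 0 := by linarith
    have h2 : (v i).2 = (v j).2 := by
      rcases mul_eq_zero.1 h1 with h | h
      · exact (hcc (sub_eq_zero.1 h)).elim
      · exact sub_eq_zero.1 h
    rw [h2] at hc
    exact hij (hv (Prod.ext (by linarith) h2))
  obtain ⟨c, hc⟩ := hbad.infinite_compl.nonempty
  let u : ι → ℝ := fun i => (v i).1 + c * (v i).2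
  have hu : Function.Injective u := fun i j hij => by
    by_contra h
    exact hc (Set.mem_iUnion.2 ⟨i, Set.mem_iUnion.2 ⟨j, h, hij⟩⟩)
  classical
  let g := Lagrange.interpolate Finset.univ u fun i => (v i).2
  refine ⟨{ toFun := fun w => (w.1 + c * w.2, w.2 - g.eval (w.1 + c * w.2))
            invFun := fun w => (w.1 - c * (w.2 + g.eval w.1), w.2 + g.eval w.1)
            left_inv := fun w => by ext <;> simp
            right_inv := fun w => by ext <;> simp
            continuous_toFun := by
              have := g.continuous
              fun_prop
            continuous_invFun := by
              have := g.continuous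
              fun_prop }, fun i => ?_⟩
  change (v i).2 - g.eval (u i) = 0
  rw [Lagrange.eval_interpolate_at_node _ hu.injOn (Finset.mem_univ i), sub_self]

/-- A chart omitting a point other than the given ones contains them all; after the homeomorphism
they lie on the axis, which belongs to neither open half-plane. -/
theorem exists_hemisphere [SphereLike X] [T2Space X] [CompactSpace X] {ι : Type*} [Finite ι]
    (x : ι → X) (hx : Function.Injective x) :
    ∃ E : Hemisphere X, ∀ i, x i ∉ E.lower ∧ x i ∉ E.upper := by
  have : Infinite X := by
    obtain ⟨p⟩ := SphereLike.nonempty (X := X)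
    obtain ⟨f, hf, -⟩ := SphereLike.exists_chart p
    exact Infinite.of_injective f hf.injective
  obtain ⟨y, hy⟩ := (Set.finite_range x).infinite_compl.nonempty
  obtain ⟨f, hf, hfy⟩ := SphereLike.exists_chart y
  have h : ∀ i, ∃ v, f v = x i := fun i => by
    rw [← Set.mem_range, hfy]
    exact fun h => hy ⟨i, h⟩
  choose v hv using h
  obtain ⟨g, hg⟩ := exists_homeomorph_snd_eq_zero v fun i j hij => hx (by rw [← hv, ← hv, hij])
  have hf' : Topology.IsOpenEmbedding (f ∘ g.symm) := hf.comp g.symm.isOpenEmbedding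
  let E := hemisphereOfChart (f ∘ g.symm) hf' y (by
    rw [g.symm.surjective.range_comp, hfy])
  have hxi : ∀ i, x i = (f ∘ g.symm) (g (v i)) := fun i => by simp [hv]
  refine ⟨E, fun i => ?_⟩
  rw [hxi]
  constructor
  · intro h
    have := ((mem_box hf').1 h).2
    rw [hg] at this
    exact lt_irrefl (0 : ℝ) this
  · intro h
    have := ((mem_box hf').1 h).2
    rw [hg] at this
    exact lt_irrefl (0 : ℝ) this

/-- The charts are inverse stereographic projections from the given point. -/
instance : SphereLike TwoSphere.{u} where
  nonempty := by
    obtain ⟨v, hv⟩ := (NormedSpace.sphere_nonempty (E := EuclideanSpace ℝ (Fin 3)) (x := 0)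
      (r := 1)).2 zero_le_one
    exact ⟨⟨⟨v, hv⟩⟩⟩
  exists_chart p := by
    have : Fact (Module.finrank ℝ (EuclideanSpace ℝ (Fin 3)) = 2 + 1) := ⟨by simp⟩
    let s := (stereographic' 2 p.down).symm
    have hs : Topology.IsOpenEmbedding s := s.isOpenEmbedding (by simp [s])
    let h : ℝ × ℝ ≃ₜ EuclideanSpace ℝ (Fin 2) :=
      Homeomorph.finTwoArrow.symm.trans (EuclideanSpace.equiv (Fin 2) ℝ).symm.toHomeomorph
    refine ⟨fun v => ULift.up (s (h v)), Homeomorph.ulift.symm.isOpenEmbedding.comp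
      (hs.comp h.isOpenEmbedding), ?_⟩
    ext ⟨z⟩
    constructor
    · rintro ⟨v, hv⟩ (hz : ULift.up z = p)
      have h1 := (stereographic' 2 p.down).map_target (x := h v) (by simp)
      rw [stereographic'_source] at h1
      exact h1 ((congrArg ULift.down (hv.trans hz)) :)
    · intro hz
      have h1 : z ∈ (stereographic' 2 p.down).source := by
        rw [stereographic'_source]
        exact fun e => hz (congrArg ULift.up e)
      refine ⟨h.symm (stereographic' 2 p.down z), congrArg ULift.up ?_⟩
      rw [Homeomorph.apply_symm_apply]
      exact (stereographic' 2 p.down).left_inv h1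

end Charts

theorem mainTheorem2 {R : Type u} [CommRing R] [IsDomain R] [IsPrincipalIdealRing R]
    {m : ℕ} (hm : 2 ≤ m) (x : Fin m → TwoSphere.{u}) (hx : Function.Injective x)
    (I : CochainComplex (ModSheaf R TwoSphere.{u}) ℤ)
    (φ : skyscrapersPlusShiftedConst R x ⟶ I) (hφ : IsInjectiveResolution φ) :
    (endDGAlgebra R I).IsFormal := by
  obtain ⟨E, hE⟩ := exists_hemisphere x hx
  exact ModSheaf.isFormal_endDGAlgebra_of_hemisphere E x hx (fun i => (hE i).1)
    (fun i => (hE i).2) I φ hφ
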